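/- **Setting.** Let $B(0,R)\subset\mathbb R^3$ be the open ball, $N=B(0,2)$, $N_1=B(0,2)\setminus\overline{B(0,1)}$, $N_2=B(0,1)$, $\Sigma=\partial N_2$; let $M_1=B(0,2)$ and $M_2=B(0,1)$ be separate copies of balls and $M\setminus\{0\}=(M_1\setminus\{0\})\sqcup M_2$. Let $F:M\setminus\{0\}\to N\setminus\Sigma$ be given by $F(x)=\left(\frac{|x|}2+1\right)\frac{x}{|x|}$ on $M_1\setminus\{0\}$ and $F(x)=x$ on $M_2$. On $N_1$ let $\tilde g=F_*g$ be the push-forward of the Euclidean metric, and put $$\tilde\varepsilon^{jk}=\tilde\mu^{jk}=|\tilde g|^{1/2}\tilde g^{jk}\ \text{ on }N_1,\qquad \tilde\varepsilon^{jk}=\tilde\mu^{jk}=\delta^{jk}\ \text{ on }N_2 .$$ **Finite energy solutions.** Let $k\in\mathbb R\setminus\{0\}$. For an open ball $\Omega\subset\mathbb R^3$ and matrix-valued $\varepsilon,\mu$ on $\Omega$, a pair of complex 1-forms $(E,H)$ is a *finite energy solution on $\Omega$* of $$\nabla\times E=ik\mu H,\qquad \nabla\times H=-ik\varepsilon E+J$$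 if $E$, $H$, $\varepsilon E$, $\mu H$ have $L^1(\Omega)$ coefficients, $\int_\Omega\varepsilon^{jk}E_j\overline{E_k}\,dx<\infty$ and $\int_\Omega\mu^{jk}H_j\overline{H_k}\,dx<\infty$, and $$\int_\Omega\big((\nabla\times h)\cdot E-ik\,h\cdot\mu H\big)dx=0,\qquad \int_\Omega\big((\nabla\times e)\cdot H+e\cdot(ik\varepsilon E-J)\big)dx=0$$ for all 1-forms $e,h$ with $C_0^\infty(\Omega)$ coefficients ($\cdot$ is the bilinear Euclidean product). **Traces.** For $u\in L^1(\Omega)$ whose distributional curl is in $L^1(\Omega)$, the tangential trace $\nu\times u|_{\partial\Omega}$ ($\nu$ the outer unit normal) is understood in the weak sense: it is the linear functional on smooth $\mathbb C^3$-valued fields on $\partial\Omega$ given by $$\langle\nu\times u,\varphi|_{\partial\Omega}\rangle=\int_\Omega\big((\nabla\times u)\cdot\varphi-u\cdot(\nabla\times\varphi)\big)dx,\qquad \varphi\in C^\infty(\mathbb R^3;\mathbb C^3).$$ An equation $\nu\times u|_{\partial\Omega}=f$ includes the assertion that $u$ and its distributional curl are in $L^1(\Omega)$. **Theorem.** Let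 $E,H$ be 1-forms with measurable coefficients on $M\setminus\{0\}$ and $\tilde E,\tilde H$ 1-forms on $N\setminus\Sigma$ with $\tilde E=F_*E$, $\tilde H=F_*H$. Let $J$, $\tilde J$ be 2-forms with smooth coefficients on $M\setminus\{0\}$ and $N\setminus\Sigma$, supported away from $0\in M_1$ and from $\Sigma$ (so $J$ vanishes near $0\in M_1$ and near $\partial M_2$), with $\tilde J=F_*J$. Let $f$ be a tangential boundary datum, that is, a linear functional on smooth $\mathbb C^3$-valued fields on $\partial N=\partial M_1$ (recall that $F$ is the identity on $|x|=2$). Then the following are equivalent. 1. $(\tilde E,\tilde H)$ is a finite energy solution on $N$ of $$\nabla\times\tilde E=ik\tilde\mu\tilde H,\quad \nabla\times\tilde H=-ik\tilde\varepsilon\tilde E+\tilde J,\qquad\text{and}\quad \nu\times\tilde E|_{\partial N}=f .$$ 2. $(E,H)$ is a finite energy solution on $M_1$ of $$\nabla\times E=ikH,\quad\nabla\times H=-ikE+J,\qquad\text{with}\quad \nu\times E|_{\partial M_1}=f,$$ and $(E,H)$ is a finite energy solution on $M_2$ of the same equations with Cauchy data $\nu\times E|_{\partial M_2}=b^e$,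 $\nu\times H|_{\partial M_2}=b^h$ satisfying $b^e=b^h=0$. Moreover, if $(E,H)$ is a finite energy solution on $M_1$ and on $M_2$ as in 2, with some boundary datum $f$ and with Cauchy data $b^e,b^h$ on $\partial M_2$ that are not both zero, then $(\tilde E,\tilde H)$ is not a finite energy solution on $N$. -/

import Mathlib

open MeasureTheory Metric
open scoped Matrix ContDiff

namespace Cloaking

noncomputable section

/-- Euclidean three-space. -/
abbrev Space : Type := EuclideanSpace ℝ (Fin 3)

/-- A complex field on space given by its three Euclidean components. It stands for the one-form
`E_0 dx^0 + E_1 dx^1 + E_2 dx^2`, or for the two-form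
`J_0 dx^1 ∧ dx^2 + J_1 dx^2 ∧ dx^0 + J_2 dx^0 ∧ dx^1`. -/
abbrev VField : Type := Space → Fin 3 → ℂ

/-- The partial derivative of the `j`-th component of `u` in the `i`-th coordinate direction. -/
def partialD (u : VField) (i j : Fin 3) (x : Space) : ℂ :=
  fderiv ℝ u x (EuclideanSpace.single i 1) j

/-- The classical curl. -/
def curl (u : VField) : VField := fun x =>
  ![partialD u 1 2 x - partialD u 2 1 x,
    partialD u 2 0 x - partialD u 0 2 x,
    partialD u 0 1 x - partialD u 1 0 x]

/-- The action of a real matrix on a complex vector. -/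
def applyMatrix (A : Matrix (Fin 3) (Fin 3) ℝ) (v : Fin 3 → ℂ) : Fin 3 → ℂ :=
  A.map Complex.ofReal *ᵥ v

/-! ### The domains and the map that blows up a point -/

/-- The ball `M_1` of radius 2. -/
abbrev M₁ : Set Space := ball 0 2

/-- The ball `M_2` of radius 1. -/
abbrev M₂ : Set Space := ball 0 1

/-- The ball `N` of radius 2 that carries the cloaking device. -/
abbrev N : Set Space := ball 0 2

/-- The open layer `N_1`, filled with the metamaterial. -/
abbrev N₁ : Set Space := ball 0 2 \ closedBall 0 1

/-- The cloaked region `N_2`. -/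
abbrev N₂ : Set Space := ball 0 1

/-- The singular map `F_1 : M_1 \ {0} → N_1`. -/
def blowUp (x : Space) : Space := ((‖x‖ / 2 + 1) / ‖x‖) • x

/-- The inverse map of `blowUp`, from `N_1` to `M_1 \ {0}`. -/
def blowUpInv (y : Space) : Space := (2 * (‖y‖ - 1) / ‖y‖) • y

theorem norm_blowUp {x : Space} (hx : x ≠ 0) : ‖blowUp x‖ = ‖x‖ / 2 + 1 := by
  have h : 0 < ‖x‖ := norm_pos_iff.mpr hx
  rw [blowUp, norm_smul, Real.norm_of_nonneg (by positivity)]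
  field_simp

theorem norm_blowUpInv {y : Space} (hy : 1 < ‖y‖) : ‖blowUpInv y‖ = 2 * (‖y‖ - 1) := by
  have h : 0 < ‖y‖ := by linarith
  have h' : 0 ≤ ‖y‖ - 1 := by linarith
  rw [blowUpInv, norm_smul, Real.norm_of_nonneg (by positivity)]
  field_simp

theorem blowUpInv_blowUp {x : Space} (hx : x ≠ 0) : blowUpInv (blowUp x) = x := by
  have h : 0 < ‖x‖ := norm_pos_iff.mpr hx
  have hn := norm_blowUp hx
  rw [blowUpInv, hn, blowUp, smul_smul]
  have : 2 * (‖x‖ / 2 + 1 - 1) / (‖x‖ / 2 + 1) * ((‖x‖ / 2 + 1) / ‖x‖) = 1 := by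
    field_simp
    ring
  rw [this, one_smul]

theorem blowUp_blowUpInv {y : Space} (hy : 1 < ‖y‖) : blowUp (blowUpInv y) = y := by
  have h : 0 < ‖y‖ := by linarith
  have h' : 0 < ‖y‖ - 1 := by linarith
  have hn := norm_blowUpInv hy
  rw [blowUp, hn, blowUpInv, smul_smul]
  have : (2 * (‖y‖ - 1) / 2 + 1) / (2 * (‖y‖ - 1)) * (2 * (‖y‖ - 1) / ‖y‖) = 1 := by
    field_simp
    ring
  rw [this, one_smul]

/-- On the outer boundary the map is the identity. -/
theorem blowUp_of_norm_eq_two {x : Space} (hx : ‖x‖ = 2) : blowUp x = x := by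
  rw [blowUp, hx]
  norm_num

/-- The Jacobian matrix: row `i`, column `j` holds the derivative of the `i`-th component of `G`
in the `j`-th coordinate direction. -/
def jacobian (G : Space → Space) (y : Space) : Matrix (Fin 3) (Fin 3) ℝ :=
  Matrix.of fun i j => fderiv ℝ G y (EuclideanSpace.single j 1) i

/-! ### Push-forwards and the singular material parameters -/

/-- The push-forward of the Euclidean metric under `F`, where `G` is the inverse of `F`:
`g_{jk} = ∑_p (∂_j G^p) (∂_k G^p)`. -/
def pushMetric (G : Space → Space) (y : Space) : Matrix (Fin 3) (Fin 3) ℝ :=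
  (jacobian G y)ᵀ * jacobian G y

/-- The material tensor `|g|^{1/2} g^{jk}` of a metric `g_{jk}`. -/
def materialOfMetric (g : Matrix (Fin 3) (Fin 3) ℝ) : Matrix (Fin 3) (Fin 3) ℝ :=
  Real.sqrt g.det • g⁻¹

open Classical in
/-- The singular permittivity, equal to the permeability, of the single coating: the material
tensor of the pushed-forward metric in `N_1` and the identity in `N_2`. (The value on the unit
sphere, a null set, plays no role.) -/
def singleCoating (y : Space) : Matrix (Fin 3) (Fin 3) ℝ :=
  if y ∈ N₁ then materialOfMetric (pushMetric blowUpInv y) else 1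

/-- The push-forward of a one-form under `F`, where `G` is the inverse of `F`:
`(F_* E)_j (y) = ∑_k (∂_j G^k)(y) E_k (G y)`. -/
def pushOneForm (G : Space → Space) (E : VField) : VField := fun y =>
  applyMatrix (jacobian G y)ᵀ (E (G y))

/-- The push-forward of a two-form under `F`, where `G` is the inverse of `F`. Its `j`-th component
is its value on the pair of coordinate vectors `e_{j+1}, e_{j+2}` (indices modulo 3), that is, the
value of `J` at `G y` on the pair `∂_{j+1} G, ∂_{j+2} G`. -/
def pushTwoForm (G : Space → Space) (J : VField) : VField := fun y j =>
  J (G y) ⬝ᵥ crossProduct (fun i => (jacobian G y i (j + 1) : ℂ))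
    (fun i => (jacobian G y i (j + 2) : ℂ))

/-- `Et = F_* E` on `N_1 ∪ N_2` for one-forms, where `E` is `E₁` on `M_1 \ {0}` and `E₂` on `M_2`,
and `F` is `blowUp` on `M_1 \ {0}` and the identity on `M_2`. -/
def IsPushOneForm (E₁ E₂ Et : VField) : Prop :=
  (∀ y ∈ N₁, Et y = pushOneForm blowUpInv E₁ y) ∧ ∀ y ∈ N₂, Et y = E₂ y

/-- `Jt = F_* J` on `N_1 ∪ N_2` for two-forms, with the same `F`. -/
def IsPushTwoForm (J₁ J₂ Jt : VField) : Prop :=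
  (∀ y ∈ N₁, Jt y = pushTwoForm blowUpInv J₁ y) ∧ ∀ y ∈ N₂, Jt y = J₂ y

/-! ### Weak solutions -/

/-- Smooth fields with compact support in `Ω`. -/
def IsTestField (Ω : Set Space) (φ : VField) : Prop :=
  ContDiff ℝ ∞ φ ∧ HasCompactSupport φ ∧ tsupport φ ⊆ Ω

/-- Finite energy solutions of the time-harmonic Maxwell equations
`∇ × E = i k μ H`, `∇ × H = - i k ε E + J` on `Ω`, in the sense of distributions. -/
structure IsFiniteEnergySolution (Ω : Set Space) (ε μ : Space → Matrix (Fin 3) (Fin 3) ℝ)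
    (k : ℝ) (J E H : VField) : Prop where
  integrable_E : IntegrableOn E Ω
  integrable_H : IntegrableOn H Ω
  integrable_D : IntegrableOn (fun x => applyMatrix (ε x) (E x)) Ω
  integrable_B : IntegrableOn (fun x => applyMatrix (μ x) (H x)) Ω
  energy_E : IntegrableOn (fun x => applyMatrix (ε x) (E x) ⬝ᵥ star (E x)) Ω
  energy_H : IntegrableOn (fun x => applyMatrix (μ x) (H x) ⬝ᵥ star (H x)) Ω
  faraday : ∀ h : VField, IsTestField Ω h →
    ∫ x in Ω, (curl h x ⬝ᵥ E x - Complex.I * k * (h x ⬝ᵥ applyMatrix (μ x) (H x))) = 0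
  ampere : ∀ e : VField, IsTestField Ω e →
    ∫ x in Ω, (curl e x ⬝ᵥ H x +
      e x ⬝ᵥ ((Complex.I * k) • applyMatrix (ε x) (E x) - J x)) = 0

/-- `w` is the curl of `u` on `Ω` in the sense of distributions. -/
def HasWeakCurl (Ω : Set Space) (u w : VField) : Prop :=
  ∀ φ : VField, IsTestField Ω φ → ∫ x in Ω, curl φ x ⬝ᵥ u x = ∫ x in Ω, φ x ⬝ᵥ w x

/-- The space of all smooth fields on the whole space. -/
def smoothFields : Submodule ℂ VField where
  carrier := {φ | ContDiff ℝ ∞ φ}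
  add_mem' := fun {_ _} ha hb =>
    ContDiff.add (Set.mem_ofPred_eq.mp ha) (Set.mem_ofPred_eq.mp hb)
  zero_mem' := Set.mem_ofPred_eq.mpr contDiff_const
  smul_mem' := fun c _ h => ContDiff.const_smul c (Set.mem_ofPred_eq.mp h)

/-- The space of the restrictions to `S` of smooth fields. -/
def smoothFieldsOn (S : Set Space) : Submodule ℂ (S → Fin 3 → ℂ) :=
  smoothFields.map (LinearMap.funLeft ℂ (Fin 3 → ℂ) (Subtype.val : S → Space))

/-- The restriction of a smooth field to `S`. -/
def restrictField (S : Set Space) (φ : smoothFields) : smoothFieldsOn S :=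
  ⟨fun x => (φ : VField) x, Submodule.mem_map_of_mem φ.2⟩

/-- Boundary data: linear functionals on the smooth complex vector fields along the boundary. An
integrable vector field `f` on the boundary is identified with `φ ↦ ∫ f · φ dS`. -/
abbrev BoundaryDatum (Ω : Set Space) : Type := smoothFieldsOn (frontier Ω) →ₗ[ℂ] ℂ

/-- `ν × u = f` on the boundary of `Ω`, where `ν` is the outer unit normal. The trace is that of
integrable fields with integrable weak curl; it is defined by Green's formula
`∫_{∂Ω} (ν × u) · φ dS = ∫_Ω ((∇ × u) · φ - u · (∇ × φ)) dx`. -/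
def HasTangentialTrace (Ω : Set Space) (u : VField) (f : BoundaryDatum Ω) : Prop :=
  IntegrableOn u Ω ∧ ∃ w : VField, IntegrableOn w Ω ∧ HasWeakCurl Ω u w ∧
    ∀ φ : smoothFields, f (restrictField (frontier Ω) φ) =
      ∫ x in Ω, (w x ⬝ᵥ (φ : VField) x - u x ⬝ᵥ curl φ x)

end

end Cloaking

open Cloaking

/-!
The map `blowUp` transports the Maxwell system on the punctured ball `M₁ \ {0}` to the layer `N₁`:
the exterior derivative commutes with pull-backs (`curl_pushOneForm`), and the material tensor
`|g|^{1/2} g^{jk}` of the pushed-forward metric turns the push-forward of a one-form into the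
push-forward of the same field regarded as a two-form (`applyMatrix_singleCoating_pushOneForm`).
So the defect of the weak equation on `N₁` against `h` equals the defect on `M₁ \ {0}` against the
pull-back of `h` (`weakPairing_N₁`), and the two energies agree (`energy_N₁_iff`). What remains is
to understand the blown-up point `0`, the interface `|y| = 1` and the outer sphere `|y| = 2`.
All three are treated by cutting off test fields (`weakPairing_eq_zero_of_cutoff`): an error
`(∇χ × φ) · u` is produced, which tends to zero if `(∇q × φ) · u` is `q` times an integrable
function, where `q` is a defining function of the set to be removed.

* The point: a solution of finite energy on `M₁ \ {0}` is a solution on `M₁`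
  (`weakPairing_eq_zero_of_punctured`), because `|x|⁻¹` is square integrable in dimension three.
* The interface: near `0` there are no sources and the frequency is not zero, so the components of
  `E` and `H` solve the Helmholtz equation (`helmholtz_of_maxwell`) and are locally bounded
  (`ae_bounded_of_helmholtz`). This makes the transported fields integrable, although the Jacobian
  determinant of `blowUp` is of size `|x|⁻²`. As `blowUpInv` contracts the unit sphere to a point,
  the tangential components of the transported fields are of size `|y| - 1`. Hence they satisfy
  the weak equation on `N₁` even for test fields that do not vanish at the interface
  (`weakPairing_N₁_eq_zero`). Consequently the equation on all of `N` holds if and only if the core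
  `N₂` contributes nothing for arbitrary smooth test fields, that is, if and only if the solution
  on `M₂` has vanishing Cauchy data (`weakPairing_core_eq_zero`, `WeakEq.to_N`).
* The outer sphere: `blowUp` is the identity there and radial nearby, so a pull-back changes a test
  field on the sphere only in its normal component, which the tangential trace does not see
  (`weakPairing_eq_zero_of_normal`, `weakPairing_N_eq_weakPairing_M₁`).

Local boundedness is obtained by testing the Helmholtz equation with a localized
`(|y - x|² + ε²)^{-1/2}`. The Laplacian of this function is minus a multiple of an approximate
identity, so the smeared values of the solution are bounded uniformly in `ε`
(`smeared_bound_of_helmholtz`), and the solution itself is recovered by Lebesgue differentiation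
(`ae_norm_le_of_kernel_bound`).
-/

namespace Cloaking

noncomputable section

/-! ### Differential and vector calculus for fields -/

/-- The gradient of a real function, as a complex field. -/
def cgrad (q : Space → ℝ) : VField := fun x i =>
  (fderiv ℝ q x (EuclideanSpace.single i 1) : ℂ)

/-- The position vector, as a complex field. -/
def position : VField := fun x i => (x i : ℂ)

/-- The defect of `w` as a weak curl of `u`, tested against `φ`. -/
def weakPairing (Ω : Set Space) (u w φ : VField) : ℂ :=
  ∫ x in Ω, (curl φ x ⬝ᵥ u x - φ x ⬝ᵥ w x)

theorem partialD_add {φ ψ : VField} {x : Space} (hφ : DifferentiableAt ℝ φ x)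
    (hψ : DifferentiableAt ℝ ψ x) (i j : Fin 3) :
    partialD (fun y => φ y + ψ y) i j x = partialD φ i j x + partialD ψ i j x := by
  simp [partialD, fderiv_fun_add hφ hψ]

theorem curl_add {φ ψ : VField} {x : Space} (hφ : DifferentiableAt ℝ φ x)
    (hψ : DifferentiableAt ℝ ψ x) :
    curl (fun y => φ y + ψ y) x = curl φ x + curl ψ x := by
  ext i
  fin_cases i <;> simp [curl, partialD_add hφ hψ] <;> ring

theorem partialD_smul {q : Space → ℝ} {φ : VField} {x : Space} (hq : DifferentiableAt ℝ q x)
    (hφ : DifferentiableAt ℝ φ x) (i j : Fin 3) :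
    partialD (fun y => q y • φ y) i j x = q x * partialD φ i j x + cgrad q x i * φ x j := by
  simp [partialD, fderiv_fun_smul hq hφ, cgrad]

/-- The Leibniz rule for the curl. -/
theorem curl_smul {q : Space → ℝ} {φ : VField} {x : Space} (hq : DifferentiableAt ℝ q x)
    (hφ : DifferentiableAt ℝ φ x) :
    curl (fun y => q y • φ y) x = q x • curl φ x + crossProduct (cgrad q x) (φ x) := by
  ext i
  fin_cases i <;> simp [curl, partialD_smul hq hφ, cross_apply] <;> ring

theorem partialD_congr {φ ψ : VField} {x : Space} (h : φ =ᶠ[nhds x] ψ) (i j : Fin 3) :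
    partialD φ i j x = partialD ψ i j x := by
  simp [partialD, h.fderiv_eq]

theorem curl_congr {φ ψ : VField} {x : Space} (h : φ =ᶠ[nhds x] ψ) : curl φ x = curl ψ x := by
  simp [curl, partialD_congr h]

theorem curl_zero_of_eventuallyEq {φ : VField} {x : Space} (h : φ =ᶠ[nhds x] 0) :
    curl φ x = 0 := by
  rw [curl_congr h]
  have : ∀ i j, partialD (0 : VField) i j x = 0 := fun i j => by
    simp [partialD]
  ext i
  fin_cases i <;> simp [curl, this]

theorem curl_eq_zero_of_notMem_tsupport {φ : VField} {x : Space} (h : x ∉ tsupport φ) :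
    curl φ x = 0 :=
  curl_zero_of_eventuallyEq (notMem_tsupport_iff_eventuallyEq.mp h)

theorem continuous_curl {φ : VField} (h : ContDiff ℝ ∞ φ) : Continuous (curl φ) := by
  have h1 : ∀ i j, Continuous (partialD φ i j) := fun i j => by
    exact (continuous_apply j).comp
      ((h.continuous_fderiv (by simp)).clm_apply continuous_const)
  refine continuous_pi fun i => ?_
  fin_cases i
  · exact (h1 1 2).sub (h1 2 1)
  · exact (h1 2 0).sub (h1 0 2)
  · exact (h1 0 1).sub (h1 1 0)

theorem continuous_cgrad {q : Space → ℝ} (h : ContDiff ℝ ∞ q) : Continuous (cgrad q) := by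
  have := h.continuous_fderiv (by simp)
  refine continuous_pi fun i => ?_
  unfold cgrad
  fun_prop

/-- The sup norm on `ℂ³` accounts for the constant. -/
theorem norm_dotProduct_le (a b : Fin 3 → ℂ) : ‖a ⬝ᵥ b‖ ≤ 3 * ‖a‖ * ‖b‖ := by
  refine (norm_sum_le _ _).trans ?_
  have : ∀ i ∈ Finset.univ, ‖a i * b i‖ ≤ ‖a‖ * ‖b‖ := fun i _ => by
    rw [norm_mul]
    exact mul_le_mul (norm_le_pi_norm a i) (norm_le_pi_norm b i) (norm_nonneg _) (norm_nonneg _)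
  refine (Finset.sum_le_card_nsmul _ _ _ this).trans (le_of_eq ?_)
  simp
  ring

theorem norm_crossProduct_le (a b : Fin 3 → ℂ) : ‖crossProduct a b‖ ≤ 2 * ‖a‖ * ‖b‖ := by
  have h : ∀ i j, ‖a i * b j‖ ≤ ‖a‖ * ‖b‖ := fun i j => by
    rw [norm_mul]
    exact mul_le_mul (norm_le_pi_norm a i) (norm_le_pi_norm b j) (norm_nonneg _) (norm_nonneg _)
  have h2 : ∀ i j k l, ‖a i * b j - a k * b l‖ ≤ 2 * ‖a‖ * ‖b‖ := fun i j k l =>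
    (norm_sub_le _ _).trans (by linarith [h i j, h k l])
  refine (pi_norm_le_iff_of_nonneg (by positivity)).mpr fun i => ?_
  rw [cross_apply]
  fin_cases i
  · exact h2 1 2 2 1
  · exact h2 2 0 0 2
  · exact h2 0 1 1 0

theorem norm_applyMatrix_le (A : Matrix (Fin 3) (Fin 3) ℝ) {c : ℝ} (hA : ∀ i j, |A i j| ≤ c)
    (v : Fin 3 → ℂ) : ‖applyMatrix A v‖ ≤ 3 * c * ‖v‖ := by
  have hc : 0 ≤ c := (abs_nonneg _).trans (hA 0 0)
  refine (pi_norm_le_iff_of_nonneg (by positivity)).mpr fun i => ?_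
  change ‖∑ j, (A.map Complex.ofReal) i j * v j‖ ≤ _
  refine (norm_sum_le _ _).trans ?_
  have : ∀ j ∈ Finset.univ, ‖(A.map Complex.ofReal) i j * v j‖ ≤ c * ‖v‖ := fun j _ => by
    rw [norm_mul]
    refine mul_le_mul ?_ (norm_le_pi_norm v j) (norm_nonneg _) hc
    simpa using hA i j
  refine (Finset.sum_le_card_nsmul _ _ _ this).trans (le_of_eq ?_)
  simp
  ring

theorem continuous_dotProduct {X : Type*} [TopologicalSpace X] {a b : X → Fin 3 → ℂ}
    (ha : Continuous a) (hb : Continuous b) : Continuous fun x => a x ⬝ᵥ b x := by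
  unfold dotProduct
  fun_prop

theorem aestronglyMeasurable_dotProduct {μ : Measure Space} {a b : VField}
    (ha : AEStronglyMeasurable a μ) (hb : AEStronglyMeasurable b μ) :
    AEStronglyMeasurable (fun x => a x ⬝ᵥ b x) μ :=
  (continuous_dotProduct continuous_fst continuous_snd).comp_aestronglyMeasurable (ha.prodMk hb)

/-- Pairing an integrable field on a bounded set with a continuous one gives an integrable
function. -/
theorem integrableOn_dotProduct {Ω : Set Space} {R : ℝ} (hΩ : Ω ⊆ ball 0 R)
    (hm : MeasurableSet Ω) {a u : VField}
    (ha : Continuous a) (hu : IntegrableOn u Ω) : IntegrableOn (fun x => a x ⬝ᵥ u x) Ω := by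
  obtain ⟨C, hC⟩ := (isCompact_closedBall (0 : Space) R).exists_bound_of_continuousOn
    ha.continuousOn
  refine Integrable.mono' (hu.norm.const_mul (3 * C))
    (aestronglyMeasurable_dotProduct ha.aestronglyMeasurable hu.aestronglyMeasurable) ?_
  filter_upwards [ae_restrict_mem hm] with x hx
  refine (norm_dotProduct_le _ _).trans ?_
  have := hC x (ball_subset_closedBall (hΩ hx))
  gcongr

theorem IsTestField.mono {Ω Ω' : Set Space} {φ : VField} (h : IsTestField Ω φ) (hs : Ω ⊆ Ω') :
    IsTestField Ω' φ :=
  ⟨h.1, h.2.1, h.2.2.trans hs⟩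

theorem IsTestField.eq_zero {Ω : Set Space} {φ : VField} (h : IsTestField Ω φ) {x : Space}
    (hx : x ∉ Ω) : φ x = 0 :=
  image_eq_zero_of_notMem_tsupport fun h' => hx (h.2.2 h')

theorem IsTestField.curl_eq_zero {Ω : Set Space} {φ : VField} (h : IsTestField Ω φ) {x : Space}
    (hx : x ∉ Ω) : curl φ x = 0 :=
  curl_eq_zero_of_notMem_tsupport fun h' => hx (h.2.2 h')

/-- For a test field supported in a smaller set the pairing may be taken over that set. -/
theorem weakPairing_eq_of_subset {Ω Ω' : Set Space} (hs : Ω' ⊆ Ω) (hm : MeasurableSet Ω)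
    {u w φ : VField} (h : IsTestField Ω' φ) :
    weakPairing Ω u w φ = weakPairing Ω' u w φ := by
  refine setIntegral_eq_of_subset_of_forall_sdiff_eq_zero hm hs fun x hx => ?_
  simp [h.eq_zero hx.2, h.curl_eq_zero hx.2]

/-! ### The derivative of the blow-up map -/

theorem hasFDerivAt_norm_of_ne_zero {x : Space} (hx : x ≠ 0) :
    HasFDerivAt (fun y : Space => ‖y‖) (‖x‖⁻¹ • innerSL ℝ x) x := by
  have h1 := (hasStrictFDerivAt_norm_sq x).hasFDerivAt.sqrt (by simpa using hx)
  have h2 : (fun y : Space => ‖y‖) = fun y => Real.sqrt (‖y‖ ^ 2) := by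
    ext y
    rw [Real.sqrt_sq (norm_nonneg y)]
  rw [h2]
  refine h1.congr_fderiv ?_
  rw [Real.sqrt_sq (norm_nonneg x)]
  ext v
  have : ‖x‖ ≠ 0 := by simpa using hx
  simp
  field_simp

/-- The derivative of a radial rescaling. -/
theorem hasFDerivAt_radial {c : ℝ → ℝ} {c' : ℝ} {x : Space} (hx : x ≠ 0)
    (hc : HasDerivAt c c' ‖x‖) :
    HasFDerivAt (fun y : Space => c ‖y‖ • y)
      (c ‖x‖ • ContinuousLinearMap.id ℝ Space +
        (c' * ‖x‖⁻¹) • (innerSL ℝ x).smulRight x) x := by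
  have h := (hc.comp_hasFDerivAt x (hasFDerivAt_norm_of_ne_zero hx)).smul (hasFDerivAt_id x)
  refine h.congr_fderiv ?_
  ext v
  simp [smul_smul, mul_left_comm, mul_comm]

/-- The symmetric matrix with eigenvalue `α` orthogonally to `x` and `α + β |x|²` along `x`. -/
def radialMatrix (α β : ℝ) (x : Space) : Matrix (Fin 3) (Fin 3) ℝ :=
  Matrix.of fun i j => α * (if i = j then 1 else 0) + β * (x i * x j)

theorem norm_sq_eq_sum (x : Space) : ‖x‖ ^ 2 = x 0 ^ 2 + x 1 ^ 2 + x 2 ^ 2 := by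
  rw [EuclideanSpace.norm_sq_eq, Fin.sum_univ_three]
  simp

theorem det_radialMatrix (α β : ℝ) (x : Space) :
    (radialMatrix α β x).det = α ^ 2 * (α + β * ‖x‖ ^ 2) := by
  rw [norm_sq_eq_sum, Matrix.det_fin_three]
  simp [radialMatrix]
  ring

theorem transpose_radialMatrix (α β : ℝ) (x : Space) :
    (radialMatrix α β x)ᵀ = radialMatrix α β x := by
  ext i j
  simp [radialMatrix, eq_comm, mul_comm]

theorem applyMatrix_radialMatrix (α β : ℝ) (x : Space) (v : Fin 3 → ℂ) :
    applyMatrix (radialMatrix α β x) v =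
      (α : ℂ) • v + ((β : ℂ) * (position x ⬝ᵥ v)) • position x := by
  ext i
  fin_cases i <;>
    simp [applyMatrix, radialMatrix, Matrix.mulVec, dotProduct, Fin.sum_univ_three, position] <;>
    ring

theorem jacobian_radial {c : ℝ → ℝ} {c' : ℝ} {x : Space} (hx : x ≠ 0)
    (hc : HasDerivAt c c' ‖x‖) :
    jacobian (fun y : Space => c ‖y‖ • y) x = radialMatrix (c ‖x‖) (c' * ‖x‖⁻¹) x := by
  ext i j
  rw [jacobian, (hasFDerivAt_radial hx hc).fderiv]
  simp [radialMatrix, EuclideanSpace.inner_single_right, mul_comm, mul_left_comm]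

theorem hasDerivAt_blowUp_coeff {r : ℝ} (hr : r ≠ 0) :
    HasDerivAt (fun r : ℝ => (r / 2 + 1) / r) (-(1 / r ^ 2)) r := by
  have := (((hasDerivAt_id r).div_const 2).add_const 1).div (hasDerivAt_id r) hr
  refine this.congr_deriv ?_
  simp
  field_simp
  ring

theorem hasDerivAt_blowUpInv_coeff {r : ℝ} (hr : r ≠ 0) :
    HasDerivAt (fun r : ℝ => 2 * (r - 1) / r) (2 / r ^ 2) r := by
  have := (((hasDerivAt_id r).sub_const 1).const_mul 2).div (hasDerivAt_id r) hr
  refine this.congr_deriv ?_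
  simp
  ring

theorem jacobian_blowUp {x : Space} (hx : x ≠ 0) :
    jacobian blowUp x = radialMatrix ((‖x‖ / 2 + 1) / ‖x‖) (-(1 / ‖x‖ ^ 3)) x := by
  have h : ‖x‖ ≠ 0 := by simpa using hx
  have := jacobian_radial hx (hasDerivAt_blowUp_coeff h)
  refine this.trans ?_
  congr 1
  field_simp

theorem jacobian_blowUpInv {y : Space} (hy : y ≠ 0) :
    jacobian blowUpInv y = radialMatrix (2 * (‖y‖ - 1) / ‖y‖) (2 / ‖y‖ ^ 3) y := by
  have h : ‖y‖ ≠ 0 := by simpa using hy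
  have := jacobian_radial hy (hasDerivAt_blowUpInv_coeff h)
  refine this.trans ?_
  congr 1
  field_simp

theorem contDiffAt_blowUp {x : Space} (hx : x ≠ 0) : ContDiffAt ℝ ∞ blowUp x := by
  have h : ‖x‖ ≠ 0 := by simpa using hx
  have hn : ContDiffAt ℝ ∞ (fun y : Space => ‖y‖) x := contDiffAt_norm ℝ hx
  exact (((hn.div_const 2).add contDiffAt_const).div hn h).smul contDiffAt_id

theorem contDiffAt_blowUpInv {y : Space} (hy : y ≠ 0) : ContDiffAt ℝ ∞ blowUpInv y := by
  have h : ‖y‖ ≠ 0 := by simpa using hy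
  have hn : ContDiffAt ℝ ∞ (fun y : Space => ‖y‖) y := contDiffAt_norm ℝ hy
  exact ((contDiffAt_const.mul (hn.sub contDiffAt_const)).div hn h).smul contDiffAt_id

theorem det_jacobian_blowUp {x : Space} (hx : x ≠ 0) :
    (jacobian blowUp x).det = ((‖x‖ / 2 + 1) / ‖x‖) ^ 2 / 2 := by
  have h : ‖x‖ ≠ 0 := by simpa using hx
  rw [jacobian_blowUp hx, det_radialMatrix]
  field_simp
  ring

theorem det_jacobian_blowUp_pos {x : Space} (hx : x ≠ 0) : 0 < (jacobian blowUp x).det := by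
  have h : 0 < ‖x‖ := by simpa using hx
  rw [det_jacobian_blowUp hx]
  positivity

theorem det_jacobian_blowUpInv_pos {y : Space} (hy : 1 < ‖y‖) :
    0 < (jacobian blowUpInv y).det := by
  have h : 0 < ‖y‖ := by linarith
  have h' : 0 < ‖y‖ - 1 := by linarith
  rw [jacobian_blowUpInv (by simpa using h), det_radialMatrix]
  positivity

theorem det_fderiv_eq_det_jacobian (G : Space → Space) (x : Space) :
    (fderiv ℝ G x).det = (jacobian G x).det := by
  have := LinearMap.det_toMatrix (EuclideanSpace.basisFun (Fin 3) ℝ).toBasis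
    (fderiv ℝ G x : Space →ₗ[ℝ] Space)
  rw [ContinuousLinearMap.det, ← this]
  congr 1

theorem one_lt_norm_blowUp {x : Space} (hx : x ≠ 0) : 1 < ‖blowUp x‖ := by
  have h : 0 < ‖x‖ := by simpa using hx
  rw [norm_blowUp hx]
  linarith

theorem blowUp_ne_zero {x : Space} (hx : x ≠ 0) : blowUp x ≠ 0 := by
  have := one_lt_norm_blowUp hx
  rw [← norm_pos_iff]
  linarith

theorem mem_N₁_iff {y : Space} : y ∈ N₁ ↔ 1 < ‖y‖ ∧ ‖y‖ < 2 := by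
  simp [and_comm]

theorem blowUp_mem_N₁ {x : Space} (hx : x ∈ M₁ \ {0}) : blowUp x ∈ N₁ := by
  have h2 : ‖x‖ < 2 := by simpa using hx.1
  rw [mem_N₁_iff]
  refine ⟨one_lt_norm_blowUp hx.2, ?_⟩
  rw [norm_blowUp hx.2]
  linarith

theorem blowUp_image : blowUp '' (M₁ \ {0}) = N₁ := by
  ext y
  constructor
  · rintro ⟨x, hx, rfl⟩
    exact blowUp_mem_N₁ hx
  · intro hy
    rw [mem_N₁_iff] at hy
    have hn := norm_blowUpInv hy.1
    refine ⟨blowUpInv y, ⟨?_, ?_⟩, blowUp_blowUpInv hy.1⟩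
    · rw [mem_ball_zero_iff, hn]
      linarith
    · rw [Set.mem_singleton_iff, ← norm_eq_zero, hn]
      linarith

theorem injOn_blowUp : Set.InjOn blowUp (M₁ \ {0}) := fun x hx y hy h => by
  rw [← blowUpInv_blowUp hx.2, ← blowUpInv_blowUp hy.2, h]

theorem measurableSet_punctured : MeasurableSet (M₁ \ {0} : Set Space) :=
  measurableSet_ball.diff (measurableSet_singleton 0)

theorem measurableSet_N₁ : MeasurableSet N₁ :=
  measurableSet_ball.diff measurableSet_closedBall

theorem hasFDerivWithinAt_blowUp {x : Space} (hx : x ∈ M₁ \ {0}) :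
    HasFDerivWithinAt blowUp (fderiv ℝ blowUp x) (M₁ \ {0}) x :=
  ((contDiffAt_blowUp hx.2).differentiableAt (by simp)).hasFDerivAt.hasFDerivWithinAt

theorem setIntegral_N₁ {F : Type*} [NormedAddCommGroup F] [NormedSpace ℝ F] (g : Space → F) :
    ∫ y in N₁, g y = ∫ x in M₁ \ {0}, (jacobian blowUp x).det • g (blowUp x) := by
  rw [← blowUp_image, integral_image_eq_integral_abs_det_fderiv_smul volume
    measurableSet_punctured (fun x hx => hasFDerivWithinAt_blowUp hx) injOn_blowUp]
  refine setIntegral_congr_fun measurableSet_punctured fun x hx => ?_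
  simp only [det_fderiv_eq_det_jacobian, abs_of_pos (det_jacobian_blowUp_pos hx.2)]

theorem integrableOn_N₁_iff {F : Type*} [NormedAddCommGroup F] [NormedSpace ℝ F] (g : Space → F) :
    IntegrableOn g N₁ ↔
      IntegrableOn (fun x => (jacobian blowUp x).det • g (blowUp x)) (M₁ \ {0}) := by
  rw [← blowUp_image, integrableOn_image_iff_integrableOn_abs_det_fderiv_smul volume
    measurableSet_punctured (fun x hx => hasFDerivWithinAt_blowUp hx) injOn_blowUp]
  refine integrableOn_congr_fun (fun x hx => ?_) measurableSet_punctured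
  simp only [det_fderiv_eq_det_jacobian, abs_of_pos (det_jacobian_blowUp_pos hx.2)]

theorem jacobian_comp {G F : Space → Space} {x : Space} (hG : DifferentiableAt ℝ G (F x))
    (hF : DifferentiableAt ℝ F x) :
    jacobian (G ∘ F) x = jacobian G (F x) * jacobian F x := by
  ext i j
  have key : ∀ v : Space, fderiv ℝ G (F x) v i
      = ∑ k, fderiv ℝ G (F x) (EuclideanSpace.single k 1) i * v k := fun v => by
    conv_lhs => rw [← (EuclideanSpace.basisFun (Fin 3) ℝ).sum_repr v]
    simp [mul_comm]
  rw [Matrix.mul_apply]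
  simp only [jacobian, Matrix.of_apply, fderiv_comp x hG hF, ContinuousLinearMap.comp_apply]
  exact key _

theorem jacobian_blowUpInv_mul_jacobian_blowUp {x : Space} (hx : x ≠ 0) :
    jacobian blowUpInv (blowUp x) * jacobian blowUp x = 1 := by
  rw [← jacobian_comp ((contDiffAt_blowUpInv (blowUp_ne_zero hx)).differentiableAt (by simp))
    ((contDiffAt_blowUp hx).differentiableAt (by simp))]
  have h : blowUpInv ∘ blowUp =ᶠ[nhds x] id := by
    filter_upwards [isOpen_ne.mem_nhds hx] with z hz
    exact blowUpInv_blowUp hz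
  ext i j
  simp [jacobian, h.fderiv_eq, Matrix.one_apply]

theorem jacobian_blowUp_mul_jacobian_blowUpInv {x : Space} (hx : x ≠ 0) :
    jacobian blowUp x * jacobian blowUpInv (blowUp x) = 1 :=
  mul_eq_one_comm.mp (jacobian_blowUpInv_mul_jacobian_blowUp hx)

theorem adjugate_jacobian_blowUpInv {x : Space} (hx : x ≠ 0) :
    (jacobian blowUp x).det • (jacobian blowUpInv (blowUp x)).adjugate = jacobian blowUp x := by
  set A := jacobian blowUp x
  set B := jacobian blowUpInv (blowUp x)
  have h1 : A * B = 1 := jacobian_blowUp_mul_jacobian_blowUpInv hx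
  have h2 : A.det * B.det = 1 := by rw [← Matrix.det_mul, h1, Matrix.det_one]
  have h3 : A * (B * B.adjugate) = B.adjugate := by rw [← mul_assoc, h1, one_mul]
  rw [Matrix.mul_adjugate, Matrix.mul_smul, mul_one] at h3
  rw [← h3, smul_smul, h2, one_smul]

theorem pushTwoForm_eq (G : Space → Space) (J : VField) (y : Space) :
    pushTwoForm G J y = applyMatrix (jacobian G y).adjugate (J (G y)) := by
  rw [Matrix.adjugate_fin_three]
  ext i
  fin_cases i <;>
    simp [pushTwoForm, applyMatrix, Matrix.mulVec, dotProduct, Fin.sum_univ_three, cross_apply] <;>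
    ring

theorem applyMatrix_mul (A B : Matrix (Fin 3) (Fin 3) ℝ) (v : Fin 3 → ℂ) :
    applyMatrix (A * B) v = applyMatrix A (applyMatrix B v) := by
  have : (A * B).map Complex.ofReal = A.map Complex.ofReal * B.map Complex.ofReal :=
    Matrix.map_mul (f := Complex.ofRealHom)
  rw [applyMatrix, applyMatrix, applyMatrix, Matrix.mulVec_mulVec, this]

theorem applyMatrix_one (v : Fin 3 → ℂ) : applyMatrix 1 v = v := by
  simp [applyMatrix]

theorem applyMatrix_smul (c : ℝ) (A : Matrix (Fin 3) (Fin 3) ℝ) (v : Fin 3 → ℂ) :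
    applyMatrix (c • A) v = c • applyMatrix A v := by
  ext i
  simp [applyMatrix, Matrix.mulVec, dotProduct, Fin.sum_univ_three]
  ring

theorem applyMatrix_smul_vec (c : ℂ) (A : Matrix (Fin 3) (Fin 3) ℝ) (v : Fin 3 → ℂ) :
    applyMatrix A (c • v) = c • applyMatrix A v := by
  simp [applyMatrix, Matrix.mulVec_smul]

theorem applyMatrix_sub_vec (A : Matrix (Fin 3) (Fin 3) ℝ) (v w : Fin 3 → ℂ) :
    applyMatrix A (v - w) = applyMatrix A v - applyMatrix A w := by
  simp [applyMatrix, Matrix.mulVec_sub]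

theorem dotProduct_applyMatrix (A : Matrix (Fin 3) (Fin 3) ℝ) (v w : Fin 3 → ℂ) :
    v ⬝ᵥ applyMatrix A w = applyMatrix Aᵀ v ⬝ᵥ w := by
  rw [applyMatrix, applyMatrix, Matrix.dotProduct_mulVec, Matrix.transpose_map,
    Matrix.mulVec_transpose]

theorem materialOfMetric_pushMetric {G : Space → Space} {y : Space}
    (h : 0 < (jacobian G y).det) :
    materialOfMetric (pushMetric G y) * (jacobian G y)ᵀ = (jacobian G y).adjugate := by
  set A := jacobian G y
  have hu : IsUnit A.det := h.ne'.isUnit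
  have hu' : IsUnit Aᵀ.det := by rwa [Matrix.det_transpose]
  rw [materialOfMetric, pushMetric, Matrix.det_mul, Matrix.det_transpose,
    Real.sqrt_mul_self h.le, Matrix.mul_inv_rev, Matrix.smul_mul, mul_assoc,
    Matrix.nonsing_inv_mul _ hu', mul_one, Matrix.inv_def, smul_smul, Ring.inverse_eq_inv',
    mul_inv_cancel₀ h.ne', one_smul]

theorem applyMatrix_singleCoating_pushOneForm {y : Space} (hy : y ∈ N₁) (E : VField) :
    applyMatrix (singleCoating y) (pushOneForm blowUpInv E y) = pushTwoForm blowUpInv E y := by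
  rw [singleCoating, if_pos hy, pushOneForm, ← applyMatrix_mul, materialOfMetric_pushMetric
    (det_jacobian_blowUpInv_pos (mem_N₁_iff.mp hy).1), pushTwoForm_eq]

theorem singleCoating_of_mem_N₂ {y : Space} (hy : y ∈ N₂) : singleCoating y = 1 := by
  rw [singleCoating, if_neg]
  rw [mem_N₁_iff]
  have : ‖y‖ < 1 := by simpa using hy
  rintro ⟨h, -⟩
  linarith

/-! ### Pull-back and push-forward of forms -/

theorem partialD_pushOneForm {G : Space → Space} {E : VField} {y : Space}
    (hG : ContDiffAt ℝ ∞ G y) (hE : DifferentiableAt ℝ E (G y)) (i j : Fin 3) :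
    partialD (pushOneForm G E) i j y = ∑ k,
      ((fderiv ℝ (fderiv ℝ G) y (EuclideanSpace.single i 1) (EuclideanSpace.single j 1) k : ℂ)
          * E (G y) k +
        (jacobian G y k j : ℂ) * ∑ l, (jacobian G y l i : ℂ) * partialD E l k (G y)) := by
  have hG1 : HasFDerivAt G (fderiv ℝ G y) y := (hG.differentiableAt (by simp)).hasFDerivAt
  have hG2 : HasFDerivAt (fderiv ℝ G) (fderiv ℝ (fderiv ℝ G) y) y :=
    ((hG.fderiv_right (m := ∞) (by simp)).differentiableAt (by simp)).hasFDerivAt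
  have h1 : ∀ j k : Fin 3, HasFDerivAt
      (fun z => ((fderiv ℝ G z (EuclideanSpace.single j 1) k : ℝ) : ℂ)) _ y := fun j k =>
    Complex.ofRealCLM.hasFDerivAt.comp y ((EuclideanSpace.proj k : Space →L[ℝ] ℝ).hasFDerivAt.comp y
      (hG2.clm_apply (hasFDerivAt_const (EuclideanSpace.single j (1 : ℝ) : Space) y)))
  have h2 : ∀ k : Fin 3, HasFDerivAt (fun z => E (G z) k) _ y := fun k =>
    (ContinuousLinearMap.proj (R := ℝ) (φ := fun _ : Fin 3 => ℂ) k).hasFDerivAt.comp y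
      (hE.hasFDerivAt.comp y hG1)
  have h3 : ∀ j : Fin 3, HasFDerivAt (fun z => ∑ k,
      ((fderiv ℝ G z (EuclideanSpace.single j 1) k : ℝ) : ℂ) * E (G z) k) _ y := fun j =>
    HasFDerivAt.fun_sum (u := Finset.univ) (fun k _ => (h1 j k).mul (h2 k))
  have h4 : pushOneForm G E = fun z j => ∑ k,
      ((fderiv ℝ G z (EuclideanSpace.single j 1) k : ℝ) : ℂ) * E (G z) k := by
    ext z j
    simp [pushOneForm, applyMatrix, Matrix.mulVec, dotProduct, jacobian]
  have key : ∀ k, fderiv ℝ E (G y) (fderiv ℝ G y (EuclideanSpace.single i 1)) k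
      = ∑ l, (jacobian G y l i : ℂ) * partialD E l k (G y) := fun k => by
    conv_lhs =>
      rw [← (EuclideanSpace.basisFun (Fin 3) ℝ).sum_repr (fderiv ℝ G y (EuclideanSpace.single i 1))]
    simp [jacobian, partialD]
  rw [partialD, h4, (hasFDerivAt_pi.2 h3).fderiv]
  simp [key, jacobian]
  refine Finset.sum_congr rfl fun k _ => by ring

/-- The exterior derivative commutes with pull-backs: on one-forms it is the curl. -/
theorem curl_pushOneForm {G : Space → Space} {E : VField} {y : Space}
    (hG : ContDiffAt ℝ ∞ G y) (hE : DifferentiableAt ℝ E (G y)) :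
    curl (pushOneForm G E) y = pushTwoForm G (curl E) y := by
  have h2 : ((2 : ℕ∞) : WithTop ℕ∞) ≤ ∞ := WithTop.coe_le_coe.2 le_top
  have hs : ∀ i j : Fin 3,
      fderiv ℝ (fderiv ℝ G) y (EuclideanSpace.single i 1) (EuclideanSpace.single j 1) =
      fderiv ℝ (fderiv ℝ G) y (EuclideanSpace.single j 1) (EuclideanSpace.single i 1) :=
    fun i j => (hG.isSymmSndFDerivAt (by simpa using h2)) _ _
  ext i
  fin_cases i
  all_goals
    simp only [curl, partialD_pushOneForm hG hE, pushTwoForm, cross_apply, Fin.sum_univ_three,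
      dotProduct, Fin.zero_eta, Fin.mk_one, Fin.reduceFinMk, Matrix.cons_val, Fin.isValue,
      Fin.reduceAdd, zero_add]
  · rw [hs 1 2]; ring
  · rw [hs 2 0]; ring
  · rw [hs 0 1]; ring

/-- Near the outer boundary the pull-back only changes normal components: `blowUp` is radial. -/
theorem position_cross_pushOneForm_blowUp {x : Space} (hx : x ≠ 0) (h : VField) :
    crossProduct (position x) (pushOneForm blowUp h x) =
      (((‖x‖ / 2 + 1) / ‖x‖ : ℝ) : ℂ) • crossProduct (position x) (h (blowUp x)) := by
  rw [pushOneForm, jacobian_blowUp hx, transpose_radialMatrix, applyMatrix_radialMatrix]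
  simp

theorem cross_pushOneForm_blowUpInv {y : Space} (hy : y ≠ 0) (h : Fin 3 → ℂ) (E : VField) :
    crossProduct (position y) h ⬝ᵥ pushOneForm blowUpInv E y =
      ((2 * (‖y‖ - 1) / ‖y‖ : ℝ) : ℂ) *
        (crossProduct (position y) h ⬝ᵥ E (blowUpInv y)) := by
  rw [pushOneForm, jacobian_blowUpInv hy, transpose_radialMatrix, applyMatrix_radialMatrix,
    dotProduct_add, dotProduct_smul, dotProduct_smul]
  have : crossProduct (position y) h ⬝ᵥ position y = 0 := by
    rw [dotProduct_comm, dot_self_cross]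
  rw [this]
  simp

/-- The pairing of a pushed-forward one-form with a field, in the coordinates of `M₁`. -/
theorem det_smul_dotProduct_pushOneForm {x : Space} (hx : x ≠ 0) (v : VField) (E : VField) :
    (jacobian blowUp x).det •
        (v (blowUp x) ⬝ᵥ pushOneForm blowUpInv E (blowUp x)) =
      pushTwoForm blowUp v x ⬝ᵥ E x := by
  set A := jacobian blowUp x with hA
  set B := jacobian blowUpInv (blowUp x) with hB
  have hBA : B * A = 1 := jacobian_blowUpInv_mul_jacobian_blowUp hx
  have h1 : A.det • B = A.adjugate := by
    calc A.det • B = B * (A * A.adjugate) := by rw [Matrix.mul_adjugate]; simp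
      _ = A.adjugate := by rw [← mul_assoc, hBA, one_mul]
  rw [pushTwoForm_eq, pushOneForm, blowUpInv_blowUp hx, ← hA, ← hB, dotProduct_applyMatrix,
    Matrix.transpose_transpose, ← h1, applyMatrix_smul, smul_dotProduct]

/-- The pairing of a field with a pushed-forward two-form, in the coordinates of `M₁`. -/
theorem det_smul_dotProduct_pushTwoForm {x : Space} (hx : x ≠ 0) (v : VField) (J : VField) :
    (jacobian blowUp x).det •
        (v (blowUp x) ⬝ᵥ pushTwoForm blowUpInv J (blowUp x)) =
      pushOneForm blowUp v x ⬝ᵥ J x := by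
  rw [pushTwoForm_eq, blowUpInv_blowUp hx, ← dotProduct_smul, ← applyMatrix_smul,
    adjugate_jacobian_blowUpInv hx, dotProduct_applyMatrix, pushOneForm]

/-- Change of variables in the weak formulation: the defect of a pushed-forward pair against `h`
is the defect of the original pair against the pull-back of `h`. -/
theorem weakPairing_N₁ (u w h : VField) (hh : ContDiff ℝ ∞ h) :
    weakPairing N₁ (pushOneForm blowUpInv u) (pushTwoForm blowUpInv w) h =
      weakPairing (M₁ \ {0}) u w (pushOneForm blowUp h) := by
  rw [weakPairing, setIntegral_N₁]
  refine setIntegral_congr_fun measurableSet_punctured fun x hx => ?_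
  rw [smul_sub, det_smul_dotProduct_pushOneForm hx.2, det_smul_dotProduct_pushTwoForm hx.2,
    curl_pushOneForm (contDiffAt_blowUp hx.2) (hh.differentiable (by simp) _)]

theorem contDiffAt_pushOneForm {G : Space → Space} {E : VField} {y : Space}
    (hG : ContDiffAt ℝ ∞ G y) (hE : ContDiffAt ℝ ∞ E (G y)) :
    ContDiffAt ℝ ∞ (pushOneForm G E) y := by
  have h4 : pushOneForm G E = fun z j => ∑ k,
      ((fderiv ℝ G z (EuclideanSpace.single j 1) k : ℝ) : ℂ) * E (G z) k := by
    ext z j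
    simp [pushOneForm, applyMatrix, Matrix.mulVec, dotProduct, jacobian]
  rw [h4]
  refine contDiffAt_pi.2 fun j => ContDiffAt.sum fun k _ => ContDiffAt.mul ?_ ?_
  · have h1 : ContDiffAt ℝ ∞ (fun z => fderiv ℝ G z (EuclideanSpace.single j 1)) y :=
      (hG.fderiv_right (m := ∞) (by simp)).clm_apply contDiffAt_const
    exact Complex.ofRealCLM.contDiff.contDiffAt.comp y
      ((EuclideanSpace.proj k : Space →L[ℝ] ℝ).contDiff.contDiffAt.comp y h1)
  · exact contDiffAt_pi.1 (hE.comp y hG) k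

/-! ### From the Maxwell system to the Helmholtz equation -/

/-- The partial derivative of a real function. -/
def pderiv (i : Fin 3) (f : Space → ℝ) : Space → ℝ := fun x =>
  fderiv ℝ f x (EuclideanSpace.single i 1)

/-- The Laplacian of a real function. -/
def laplace (f : Space → ℝ) : Space → ℝ := fun x => ∑ i, pderiv i (pderiv i f) x

/-- Smooth real functions with compact support in `Ω`. -/
def IsTestFunction (Ω : Set Space) (ψ : Space → ℝ) : Prop :=
  ContDiff ℝ ∞ ψ ∧ HasCompactSupport ψ ∧ tsupport ψ ⊆ Ω

theorem contDiff_pderiv {f : Space → ℝ} (hf : ContDiff ℝ ∞ f) (i : Fin 3) :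
    ContDiff ℝ ∞ (pderiv i f) :=
  (hf.fderiv_right (m := ∞) (by simp)).clm_apply contDiff_const

theorem tsupport_pderiv_subset (f : Space → ℝ) (i : Fin 3) :
    tsupport (pderiv i f) ⊆ tsupport f :=
  (closure_mono fun x hx => by
    rw [Function.mem_support] at hx ⊢
    contrapose! hx
    simp [pderiv, hx]).trans (tsupport_fderiv_subset ℝ)

theorem IsTestFunction.pderiv {Ω : Set Space} {ψ : Space → ℝ} (h : IsTestFunction Ω ψ)
    (i : Fin 3) : IsTestFunction Ω (pderiv i ψ) :=
  ⟨contDiff_pderiv h.1 i, h.2.1.mono' ((subset_tsupport _).trans (tsupport_pderiv_subset ψ i)),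
    (tsupport_pderiv_subset ψ i).trans h.2.2⟩

theorem IsTestFunction.sub {Ω : Set Space} {ψ χ : Space → ℝ} (h : IsTestFunction Ω ψ)
    (h' : IsTestFunction Ω χ) : IsTestFunction Ω (fun x => ψ x - χ x) :=
  ⟨h.1.sub h'.1, h.2.1.sub h'.2.1,
    (tsupport_sub _ _).trans (Set.union_subset h.2.2 h'.2.2)⟩

theorem isTestFunction_zero (Ω : Set Space) : IsTestFunction Ω (fun _ => 0) :=
  ⟨contDiff_const, HasCompactSupport.zero, by simp [tsupport]⟩

theorem pderiv_sub {f g : Space → ℝ} (hf : Differentiable ℝ f) (hg : Differentiable ℝ g)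
    (i : Fin 3) : pderiv i (fun x => f x - g x) = fun x => pderiv i f x - pderiv i g x := by
  ext x
  simp [pderiv, fderiv_fun_sub (hf x) (hg x)]

theorem pderiv_add {f g : Space → ℝ} (hf : Differentiable ℝ f) (hg : Differentiable ℝ g)
    (i : Fin 3) : pderiv i (fun x => f x + g x) = fun x => pderiv i f x + pderiv i g x := by
  ext x
  simp [pderiv, fderiv_fun_add (hf x) (hg x)]

theorem pderiv_mul {f g : Space → ℝ} (hf : Differentiable ℝ f) (hg : Differentiable ℝ g)
    (i : Fin 3) :
    pderiv i (fun x => f x * g x) = fun x => f x * pderiv i g x + g x * pderiv i f x := by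
  ext x
  simp [pderiv, fderiv_fun_mul (hf x) (hg x)]

theorem pderiv_const (c : ℝ) (i : Fin 3) : pderiv i (fun _ => c) = fun _ => 0 := by
  ext x
  simp [pderiv]

theorem pderiv_comm {f : Space → ℝ} (hf : ContDiff ℝ ∞ f) (i j : Fin 3) :
    pderiv i (pderiv j f) = pderiv j (pderiv i f) := by
  have h2 : ((2 : ℕ∞) : WithTop ℕ∞) ≤ ∞ := WithTop.coe_le_coe.2 le_top
  have hd : Differentiable ℝ (fderiv ℝ f) :=
    (hf.fderiv_right (m := ∞) (by simp)).differentiable (by simp)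
  have key : ∀ i j x, pderiv i (pderiv j f) x =
      fderiv ℝ (fderiv ℝ f) x (EuclideanSpace.single i 1) (EuclideanSpace.single j 1) := by
    intro i j x
    have := (hd x).hasFDerivAt.clm_apply
      (hasFDerivAt_const (EuclideanSpace.single j (1 : ℝ) : Space) x)
    change fderiv ℝ (fun x => fderiv ℝ f x (EuclideanSpace.single j 1)) x _ = _
    rw [this.fderiv]
    simp
  ext x
  rw [key, key]
  exact (hf.contDiffAt.isSymmSndFDerivAt (by simpa using h2)) _ _

theorem laplace_mul {f g : Space → ℝ} (hf : ContDiff ℝ ∞ f) (hg : ContDiff ℝ ∞ g) (x : Space) :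
    laplace (fun x => f x * g x) x = f x * laplace g x +
      (2 * ∑ i, pderiv i f x * pderiv i g x + laplace f x * g x) := by
  have d : ∀ {f : Space → ℝ}, ContDiff ℝ ∞ f → Differentiable ℝ f :=
    fun h => h.differentiable (by simp)
  have : ∀ i, pderiv i (pderiv i (fun x => f x * g x)) x = f x * pderiv i (pderiv i g) x +
      (2 * (pderiv i f x * pderiv i g x) + pderiv i (pderiv i f) x * g x) := by
    intro i
    rw [pderiv_mul (d hf) (d hg), pderiv_add ((d hf).fun_mul (d (contDiff_pderiv hg i)))
      ((d hg).fun_mul (d (contDiff_pderiv hf i))), pderiv_mul (d hf) (d (contDiff_pderiv hg i)),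
      pderiv_mul (d hg) (d (contDiff_pderiv hf i))]
    ring
  simp only [laplace, this, Finset.sum_add_distrib, Finset.mul_sum, Finset.sum_mul]

/-- The complex field with the given real components. -/
def realField (f : Fin 3 → Space → ℝ) : VField := fun x i => (f i x : ℂ)

theorem partialD_realField {f : Fin 3 → Space → ℝ} (hf : ∀ i, Differentiable ℝ (f i))
    (i j : Fin 3) (x : Space) : partialD (realField f) i j x = (pderiv i (f j) x : ℂ) := by
  have : HasFDerivAt (realField f) _ x := hasFDerivAt_pi.2 fun i =>
    Complex.ofRealCLM.hasFDerivAt.comp x (hf i x).hasFDerivAt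
  rw [partialD, this.fderiv]
  simp [pderiv]

theorem curl_realField {f : Fin 3 → Space → ℝ} (hf : ∀ i, Differentiable ℝ (f i)) :
    curl (realField f) = realField
      ![fun x => pderiv 1 (f 2) x - pderiv 2 (f 1) x,
        fun x => pderiv 2 (f 0) x - pderiv 0 (f 2) x,
        fun x => pderiv 0 (f 1) x - pderiv 1 (f 0) x] := by
  ext x i
  fin_cases i <;> simp [curl, partialD_realField hf] <;> simp [realField]

theorem isTestField_realField {Ω : Set Space} {f : Fin 3 → Space → ℝ}
    (hf : ∀ i, IsTestFunction Ω (f i)) : IsTestField Ω (realField f) := by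
  have hsub : tsupport (realField f) ⊆ ⋃ i, tsupport (f i) := by
    refine closure_minimal (fun x hx => ?_) (isClosed_iUnion_of_finite fun i => isClosed_tsupport _)
    rw [Function.mem_support] at hx
    by_contra h
    simp only [Set.mem_iUnion, not_exists] at h
    exact hx (funext fun i => by simp [realField, image_eq_zero_of_notMem_tsupport (h i)])
  refine ⟨contDiff_pi.2 fun i => Complex.ofRealCLM.contDiff.comp (hf i).1, ?_,
    hsub.trans (Set.iUnion_subset fun i => (hf i).2.2)⟩
  exact IsCompact.of_isClosed_subset (isCompact_iUnion fun i => (hf i).2.1) (isClosed_tsupport _)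
    hsub

/-- The field with `j`-th component `ψ` and the other components zero. -/
def axisField (j : Fin 3) (ψ : Space → ℝ) : Fin 3 → Space → ℝ :=
  fun i => if i = j then ψ else fun _ => 0

/-- The identity `curl curl = grad div - Δ`, on a field along a coordinate axis. -/
theorem curl_curl_axisField {ψ : Space → ℝ} (hψ : ContDiff ℝ ∞ ψ) (j : Fin 3) (x : Space) :
    curl (curl (realField (axisField j ψ))) x =
      realField (fun i => pderiv i (pderiv j ψ)) x - realField (axisField j (laplace ψ)) x := by
  have d : ∀ {f : Space → ℝ}, ContDiff ℝ ∞ f → Differentiable ℝ f :=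
    fun h => h.differentiable (by simp)
  have h0 : ContDiff ℝ ∞ (fun _ : Space => (0 : ℝ)) := contDiff_const
  have hc : ∀ i, ContDiff ℝ ∞ (axisField j ψ i) := fun i => by
    unfold axisField
    split_ifs
    exacts [hψ, h0]
  have hp : ∀ i l, ContDiff ℝ ∞ (pderiv i (axisField j ψ l)) := fun i l => contDiff_pderiv (hc l) i
  rw [curl_realField fun i => d (hc i), curl_realField]
  · have hs : ∀ i a b c e, pderiv i
        (fun x => pderiv a (axisField j ψ b) x - pderiv c (axisField j ψ e) x) =
        fun x => pderiv i (pderiv a (axisField j ψ b)) x -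
          pderiv i (pderiv c (axisField j ψ e)) x :=
      fun i a b c e => pderiv_sub (d (hp a b)) (d (hp c e)) i
    ext i
    simp only [Matrix.cons_val, hs]
    have e1 := fun i j => congrFun (pderiv_comm hψ i j) x
    fin_cases j <;> fin_cases i <;>
      simp [realField, axisField, pderiv_const, laplace, Fin.sum_univ_three] <;>
      (try simp only [e1 1 0, e1 2 0, e1 2 1]) <;> ring
  · intro i
    fin_cases i
    exacts [(d (hp 1 2)).sub (d (hp 2 1)), (d (hp 2 0)).sub (d (hp 0 2)),
      (d (hp 0 1)).sub (d (hp 1 0))]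

theorem curl_gradient {χ : Space → ℝ} (hχ : ContDiff ℝ ∞ χ) :
    curl (realField fun i => pderiv i χ) = 0 := by
  rw [curl_realField fun i => (contDiff_pderiv hχ i).differentiable (by simp)]
  ext x i
  fin_cases i <;> simp [realField, pderiv_comm hχ 1 0, pderiv_comm hχ 2 0, pderiv_comm hχ 2 1]

theorem isTestField_curl {Ω : Set Space} {f : Fin 3 → Space → ℝ}
    (hf : ∀ i, IsTestFunction Ω (f i)) : IsTestField Ω (curl (realField f)) := by
  rw [curl_realField fun i => (hf i).1.differentiable (by simp)]
  refine isTestField_realField fun i => ?_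
  fin_cases i
  exacts [((hf 2).pderiv 1).sub ((hf 1).pderiv 2), ((hf 0).pderiv 2).sub ((hf 2).pderiv 0),
    ((hf 1).pderiv 0).sub ((hf 0).pderiv 1)]

/-- The components of a weak solution of the Maxwell equations without sources are weak solutions
of the Helmholtz equation. The frequency must not vanish, as this is what makes `E` weakly free of
divergence. -/
theorem helmholtz_of_maxwell {R k : ℝ} (hk : k ≠ 0) {E H : VField}
    (hE : IntegrableOn E (ball 0 R))
    (h1 : ∀ h, IsTestField (ball 0 R) h → ∫ x in ball 0 R, curl h x ⬝ᵥ E x =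
      Complex.I * k * ∫ x in ball 0 R, h x ⬝ᵥ H x)
    (h2 : ∀ e, IsTestField (ball 0 R) e → ∫ x in ball 0 R, curl e x ⬝ᵥ H x =
      -(Complex.I * k * ∫ x in ball 0 R, e x ⬝ᵥ E x))
    {ψ : Space → ℝ} (hψ : IsTestFunction (ball 0 R) ψ) (j : Fin 3) :
    ∫ x in ball 0 R, (laplace ψ x + k ^ 2 * ψ x) • E x j = 0 := by
  have hax : ∀ i, IsTestFunction (ball 0 R) (axisField j ψ i) := fun i => by
    unfold axisField
    split_ifs
    exacts [hψ, isTestFunction_zero _]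
  -- Faraday's law is tested with `curl (ψ e_j)`, Ampère's law with `ψ e_j`, and again with the
  -- gradient of `∂_j ψ`, which removes the gradient part of `curl (curl (ψ e_j))`.
  have a1 := h1 _ (isTestField_curl hax)
  have a2 := h2 _ (isTestField_realField hax)
  have a3 := h2 _ (isTestField_realField fun i => (hψ.pderiv j).pderiv i)
  simp only [curl_gradient (hψ.pderiv j).1, Pi.zero_apply, zero_dotProduct, integral_zero] at a3
  have hk' : Complex.I * (k : ℂ) ≠ 0 := by simp [hk]
  have a4 : ∫ x in ball 0 R, realField (fun i => pderiv i (pderiv j ψ)) x ⬝ᵥ E x = 0 := by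
    have := (neg_eq_zero.mp a3.symm)
    exact (mul_eq_zero.mp this).resolve_left hk'
  have int : ∀ f : Fin 3 → Space → ℝ, (∀ i, Continuous (f i)) →
      IntegrableOn (fun x => realField f x ⬝ᵥ E x) (ball 0 R) := fun f hf =>
    integrableOn_dotProduct (subset_refl _) measurableSet_ball
      (continuous_pi fun i => Complex.continuous_ofReal.comp (hf i)) hE
  have cl : Continuous (laplace ψ) := continuous_finsetSum _ fun i _ =>
    ((hψ.pderiv i).pderiv i).1.continuous
  have caxis : ∀ {χ : Space → ℝ}, Continuous χ → ∀ i, Continuous (axisField j χ i) := by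
    intro χ hχ i
    unfold axisField
    split_ifs
    exacts [hχ, continuous_const]
  rw [a2] at a1
  simp only [curl_curl_axisField hψ.1, sub_dotProduct] at a1
  rw [integral_sub (int _ fun i => ((hψ.pderiv j).pderiv i).1.continuous) (int _ (caxis cl)), a4]
    at a1
  have a5 : ∀ (χ : Space → ℝ) x, realField (axisField j χ) x ⬝ᵥ E x = χ x • E x j := by
    intro χ x
    simp only [realField, axisField, dotProduct]
    rw [Finset.sum_eq_single j]
    · simp
    · intro b _ hb
      simp [hb]
    · simp
  simp only [a5] at a1
  have i1 : IntegrableOn (fun x => laplace ψ x • E x j) (ball 0 R) := by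
    simpa only [a5] using int _ (caxis cl)
  have i2 : IntegrableOn (fun x => ψ x • E x j) (ball 0 R) := by
    simpa only [a5] using int _ (caxis hψ.1.continuous)
  have i3 : IntegrableOn (fun x => (k ^ 2 : ℝ) • (ψ x • E x j)) (ball 0 R) :=
    Integrable.fun_smul (k ^ 2) i2
  simp only [add_smul, mul_smul]
  rw [integral_add i1 i3, integral_smul]
  have hI : Complex.I ^ 2 = -1 := Complex.I_sq
  simp only [Complex.real_smul] at a1 ⊢
  push_cast
  linear_combination -a1 + (k : ℂ) ^ 2 * (∫ x in ball 0 R, (ψ x : ℂ) * E x j) * hI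

/-! ### Approximate identities -/

/-- If the convolutions of `U` with an approximate identity built from `φ` are bounded by `C` on a
ball, then so is `U` itself, almost everywhere on a smaller ball. -/
theorem ae_norm_le_of_kernel_bound {φ : Space → ℝ} (hφc : Continuous φ) (hφ0 : ∀ x, 0 ≤ φ x)
    (hφ1 : ∫ x, φ x = 1) {b : ℝ} (hφb : ∀ x, φ x ≤ b)
    (hφd : Filter.Tendsto (fun x : Space => ‖x‖ ^ Module.finrank ℝ Space * φ x)
      (Bornology.cobounded Space) (nhds 0))
    {U : Space → ℂ} (hU : Integrable U) {r C : ℝ} (hr : 0 < r)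
    (hC : ∀ x ∈ ball (0 : Space) r, ∀ c : ℝ, 1 ≤ c →
      ‖∫ y, (c ^ Module.finrank ℝ Space * φ (c • (x - y))) • U y‖ ≤ C) :
    ∀ᵐ z : Space, z ∈ ball (0 : Space) (r / 2) → ‖U z‖ ≤ C := by
  -- Bumps of shrinking radius; their convolutions with `U` tend to `U` almost everywhere.
  have hpos : ∀ n : ℕ, 0 < r / 2 / (n + 1) := fun n => by positivity
  let g : ℕ → ContDiffBump (0 : Space) := fun n =>
    ⟨r / 2 / (n + 1) / 2, r / 2 / (n + 1), by have := hpos n; positivity,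
      by have := hpos n; linarith⟩
  have hg : Filter.Tendsto (fun n => (g n).rOut) Filter.atTop (nhds 0) :=
    (tendsto_const_div_atTop_nhds_zero_nat (r / 2)).comp (Filter.tendsto_add_atTop_nat 1) |>.congr
      fun n => by simp [g]
  have hg' : ∀ᶠ n in Filter.atTop, (g n).rOut ≤ 2 * (g n).rIn :=
    Filter.Eventually.of_forall fun n => by simp only [g]; linarith
  filter_upwards [ContDiffBump.ae_convolution_tendsto_right_of_locallyIntegrable (μ := volume)
    hg hg' hU.locallyIntegrable] with z hz hzr
  refine le_of_tendsto hz.norm (Filter.Eventually.of_forall fun n => ?_)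
  set G : Space → ℝ := (g n).normed volume with hG
  set V : Space → ℂ := convolution G U (ContinuousLinearMap.lsmul ℝ ℝ) volume with hV
  have hGi : Integrable G := (g n).integrable_normed
  have hVi : Integrable V := hGi.integrable_convolution _ hU
  have hVc : Continuous V :=
    (g n).hasCompactSupport_normed.continuous_convolution_left _ (g n).continuous_normed
      hU.locallyIntegrable
  have hlim := tendsto_integral_comp_smul_smul_of_integrable' (μ := volume) hφ0 hφ1 hφd hVi
    (hVc.continuousAt (x := z))
  refine le_of_tendsto hlim.norm ?_
  filter_upwards [Filter.eventually_ge_atTop (1 : ℝ)] with c hc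
  -- By Fubini, smearing `V` out with the kernel averages the smeared values of `U` over the
  -- support of the bump.
  have hswap : ∫ x, (c ^ Module.finrank ℝ Space * φ (c • (z - x))) • V x =
      ∫ t, G t • ∫ y, (c ^ Module.finrank ℝ Space * φ (c • (z - t - y))) • U y := by
    have hint : Integrable (fun p : Space × Space =>
        (c ^ Module.finrank ℝ Space * φ (c • (z - p.1))) • (G p.2 • U (p.1 - p.2)))
        (volume.prod volume) := by
      have h1 := hGi.convolution_integrand (ContinuousLinearMap.lsmul ℝ ℝ) hU (μ := volume)
      refine Integrable.bdd_smul (𝕜 := ℝ) (C := c ^ Module.finrank ℝ Space * b)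
        (φ := fun p : Space × Space => c ^ Module.finrank ℝ Space * φ (c • (z - p.1))) h1 ?_ ?_
      · exact (by fun_prop : Continuous _).aestronglyMeasurable
      · refine Filter.Eventually.of_forall fun p => ?_
        rw [Real.norm_of_nonneg (mul_nonneg (by positivity) (hφ0 _))]
        have := hφb (c • (z - p.1))
        gcongr
    calc _ = ∫ x, ∫ t, (c ^ Module.finrank ℝ Space * φ (c • (z - x))) • (G t • U (x - t)) := by
          refine integral_congr_ae (Filter.Eventually.of_forall fun x => ?_)
          simp only [hV, convolution, integral_smul, ContinuousLinearMap.lsmul_apply]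
      _ = ∫ t, ∫ x, (c ^ Module.finrank ℝ Space * φ (c • (z - x))) • (G t • U (x - t)) :=
          integral_integral_swap hint
      _ = _ := by
          refine integral_congr_ae (Filter.Eventually.of_forall fun t => ?_)
          simp only
          rw [← integral_smul, ← integral_add_right_eq_self _ t]
          refine integral_congr_ae (Filter.Eventually.of_forall fun x => ?_)
          simp only [add_sub_cancel_right]
          rw [smul_comm, sub_sub, add_comm x t]
  rw [hswap]
  calc _ ≤ ∫ t, G t * C := by
        refine norm_integral_le_of_norm_le (hGi.mul_const C)
          (Filter.Eventually.of_forall fun t => ?_)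
        have hG0 : 0 ≤ G t := (g n).nonneg_normed t
        rw [norm_smul, Real.norm_of_nonneg hG0]
        by_cases ht : G t = 0
        · rw [ht]; simp
        · refine mul_le_mul_of_nonneg_left (hC _ ?_ c hc) hG0
          have ht' : t ∈ ball (0 : Space) (g n).rOut := by
            rw [← (g n).support_normed_eq (μ := volume)]
            exact ht
          rw [mem_ball_zero_iff] at ht' hzr ⊢
          have h1 : (g n).rOut ≤ r / 2 := by
            simp only [g]
            exact div_le_self (by positivity) (by linarith [Nat.cast_nonneg (α := ℝ) n])
          linarith [norm_sub_le z t]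
    _ = C := by rw [integral_mul_const, (g n).integral_normed, one_mul]

/-! ### The smoothed Newton kernel -/

/-- The smoothed Newton kernel `(|y - x|² + ε²)^{-1/2}`, as a function of `y`. -/
def newton (ε : ℝ) (x y : Space) : ℝ := (Real.sqrt (‖y - x‖ ^ 2 + ε ^ 2))⁻¹

theorem newton_pos {ε : ℝ} (hε : ε ≠ 0) (x y : Space) : 0 < newton ε x y := by
  have : 0 < ε ^ 2 := by positivity
  unfold newton
  positivity

theorem sq_newton {ε : ℝ} (hε : ε ≠ 0) (x y : Space) :
    (‖y - x‖ ^ 2 + ε ^ 2) * newton ε x y ^ 2 = 1 := by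
  have : 0 < ‖y - x‖ ^ 2 + ε ^ 2 := by positivity
  rw [newton, inv_pow, Real.sq_sqrt this.le]
  field_simp

theorem newton_le_inv_norm {ε : ℝ} {x y : Space} (h : y ≠ x) :
    newton ε x y ≤ ‖y - x‖⁻¹ := by
  have h' : 0 < ‖y - x‖ := norm_pos_iff.mpr (sub_ne_zero.mpr h)
  refine inv_anti₀ h' (Real.le_sqrt_of_sq_le ?_)
  nlinarith [sq_nonneg ε]

theorem contDiff_newton {ε : ℝ} (hε : ε ≠ 0) (x : Space) : ContDiff ℝ ∞ (newton ε x) := by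
  have h : ∀ y : Space, ‖y - x‖ ^ 2 + ε ^ 2 ≠ 0 := fun y => by positivity
  refine ContDiff.inv (ContDiff.sqrt ?_ h) fun y => (Real.sqrt_pos.mpr (by positivity)).ne'
  exact ((contDiff_id.sub contDiff_const).norm_sq ℝ).add contDiff_const

theorem hasFDerivAt_newton {ε : ℝ} (hε : ε ≠ 0) (x y : Space) :
    HasFDerivAt (newton ε x) (-(newton ε x y ^ 3) • innerSL ℝ (y - x)) y := by
  have h0 : 0 < ‖y - x‖ ^ 2 + ε ^ 2 := by positivity
  have h1 : HasFDerivAt (fun y : Space => ‖y - x‖ ^ 2 + ε ^ 2) (2 • innerSL ℝ (y - x)) y := by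
    have := ((hasStrictFDerivAt_norm_sq (y - x)).hasFDerivAt.comp y
      ((hasFDerivAt_id y).sub_const x)).add_const (ε ^ 2)
    exact this
  have h2 := (hasDerivAt_inv (Real.sqrt_pos.mpr h0).ne').comp_hasFDerivAt y (h1.sqrt h0.ne')
  refine h2.congr_fderiv ?_
  ext v
  have : Real.sqrt (‖y - x‖ ^ 2 + ε ^ 2) ≠ 0 := (Real.sqrt_pos.mpr h0).ne'
  simp [newton]
  field_simp

theorem pderiv_newton {ε : ℝ} (hε : ε ≠ 0) (x : Space) (i : Fin 3) :
    pderiv i (newton ε x) = fun y => -(newton ε x y ^ 3) * (y i - x i) := by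
  ext y
  rw [pderiv, (hasFDerivAt_newton hε x y).fderiv]
  simp [EuclideanSpace.inner_single_right]

/-- The smoothed Newton kernel is superharmonic, and its Laplacian is a multiple of an approximate
identity. -/
theorem laplace_newton {ε : ℝ} (hε : ε ≠ 0) (x y : Space) :
    laplace (newton ε x) y = -(3 * ε ^ 2 * newton ε x y ^ 5) := by
  have h : ∀ i, pderiv i (pderiv i (newton ε x)) y =
      3 * newton ε x y ^ 5 * (y i - x i) ^ 2 - newton ε x y ^ 3 := by
    intro i
    have h1 : HasFDerivAt (fun y : Space => y i - x i) (EuclideanSpace.proj i : Space →L[ℝ] ℝ) y :=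
      (EuclideanSpace.proj i : Space →L[ℝ] ℝ).hasFDerivAt.sub_const _
    have h2 := ((hasFDerivAt_newton hε x y).pow 3).neg.mul h1
    rw [pderiv_newton hε, pderiv]
    have h3 : (fun y => -(newton ε x y ^ 3) * (y i - x i)) =
      (-fun y => newton ε x y ^ 3) * fun y : Space => y i - x i := rfl
    rw [h3, h2.fderiv]
    simp [EuclideanSpace.inner_single_right]
    ring
  have h4 := sq_newton hε x y
  have h5 : ‖y - x‖ ^ 2 = (y 0 - x 0) ^ 2 + (y 1 - x 1) ^ 2 + (y 2 - x 2) ^ 2 := by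
    rw [norm_sq_eq_sum]
    simp
  simp only [laplace, h, Fin.sum_univ_three]
  rw [h5] at h4
  linear_combination (3 * newton ε x y ^ 3) * h4

theorem integrableOn_inv_norm_sq {R : ℝ} :
    IntegrableOn (fun x : Space => (‖x‖ ^ 2)⁻¹) (ball 0 R) := by
  have h := integrable_fun_norm_addHaar (E := Space) volume
    (f := (Set.Iio R).indicator fun r => (r ^ 2)⁻¹)
  have h2 : (fun x : Space => (Set.Iio R).indicator (fun r => (r ^ 2)⁻¹) ‖x‖) =
      (ball (0 : Space) R).indicator fun x => (‖x‖ ^ 2)⁻¹ := by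
    ext x
    simp [Set.indicator]
  rw [h2, integrable_indicator_iff measurableSet_ball] at h
  rw [h]
  have h3 : IntegrableOn (fun _ : ℝ => (1 : ℝ)) (Set.Ioo 0 R) := by simp
  have h4 := (integrable_indicator_iff measurableSet_Ioo).mpr h3
  refine (h4.integrableOn (s := Set.Ioi 0)).congr_fun (fun r hr => ?_) measurableSet_Ioi
  have hr' : r ≠ 0 := ne_of_gt hr
  by_cases hrR : r < R
  · have : r ∈ Set.Ioo 0 R := ⟨hr, hrR⟩
    simp [hrR, this, hr']
  · have : r ∉ Set.Ioo 0 R := fun h => hrR h.2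
    simp [hrR, this]

theorem integrable_newton_pow_five : Integrable (fun x : Space => 3 * newton 1 0 x ^ 5) := by
  have h := integrable_rpow_neg_one_add_norm_sq (E := Space) (μ := volume) (r := 5)
    (by rw [finrank_euclideanSpace_fin]; norm_num)
  refine (h.const_mul 3).congr (Filter.Eventually.of_forall fun x => ?_)
  have h0 : (0 : ℝ) ≤ 1 + ‖x‖ ^ 2 := by positivity
  simp only [newton, sub_zero, one_pow, add_comm (‖x‖ ^ 2)]
  have h1 : Real.sqrt (1 + ‖x‖ ^ 2) ^ 5 = (1 + ‖x‖ ^ 2) ^ ((5 : ℝ) / 2) := by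
    rw [Real.sqrt_eq_rpow, ← Real.rpow_natCast ((1 + ‖x‖ ^ 2) ^ (1 / (2 : ℝ))) 5,
      ← Real.rpow_mul h0]
    norm_num
  rw [inv_pow, h1, neg_div, Real.rpow_neg h0]

theorem newton_one_scaling {c : ℝ} (hc : 0 < c) (x y : Space) :
    c ^ 3 * (3 * newton 1 0 (c • (x - y)) ^ 5) = 3 * (c⁻¹) ^ 2 * newton c⁻¹ x y ^ 5 := by
  have h : newton 1 0 (c • (x - y)) = c⁻¹ * newton c⁻¹ x y := by
    rw [newton, newton, sub_zero, norm_smul, Real.norm_of_nonneg hc.le, norm_sub_rev x y,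
      ← mul_inv]
    congr 1
    have : (c * ‖y - x‖) ^ 2 + 1 ^ 2 = c ^ 2 * (‖y - x‖ ^ 2 + c⁻¹ ^ 2) := by
      field_simp
    rw [this, Real.sqrt_mul (by positivity), Real.sqrt_sq hc.le]
  rw [h]
  field_simp

/-! ### Interior regularity for the Helmholtz equation -/

theorem integrableOn_continuous_smul {R : ℝ} {f : Space → ℝ} (hf : Continuous f) {u : Space → ℂ}
    (hu : IntegrableOn u (ball 0 R)) : IntegrableOn (fun x => f x • u x) (ball 0 R) := by
  obtain ⟨C, hC⟩ := (isCompact_closedBall (0 : Space) R).exists_bound_of_continuousOn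
    hf.continuousOn
  refine Integrable.mono' (hu.norm.const_mul C)
    (hf.aestronglyMeasurable.smul hu.aestronglyMeasurable) ?_
  filter_upwards [ae_restrict_mem measurableSet_ball] with x hx
  rw [norm_smul]
  have := hC x (ball_subset_closedBall hx)
  gcongr

theorem pderiv_eq_zero_of_eventuallyEq_const {f : Space → ℝ} {c : ℝ} {x : Space}
    (h : f =ᶠ[nhds x] fun _ => c) (i : Fin 3) : pderiv i f x = 0 := by
  rw [pderiv, h.fderiv_eq]
  simp

/-- Testing the Helmholtz equation with the localized Newton kernel bounds the smeared values of
`χ u` uniformly. The integral over the singularity at `x` is controlled by the Cauchy–Schwarz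
inequality, as `|y - x|⁻¹` is square integrable in dimension three. -/
theorem smeared_bound_of_helmholtz {δ k : ℝ} (hδ : 0 < δ) {u : Space → ℂ}
    (hu : IntegrableOn u (ball 0 δ)) (hu2 : IntegrableOn (fun x => ‖u x‖ ^ 2) (ball 0 δ))
    (hw : ∀ ψ, IsTestFunction (ball 0 δ) ψ →
      ∫ x in ball 0 δ, (laplace ψ x + k ^ 2 * ψ x) • u x = 0)
    {χ : Space → ℝ} (hχ : IsTestFunction (ball 0 δ) χ) (hχ1 : ∀ x ∈ ball 0 (δ / 2), χ x = 1)
    (hχ2 : ∀ x, |χ x| ≤ 1) :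
    ∃ C, ∀ x ∈ ball (0 : Space) (δ / 4), ∀ ε, 0 < ε →
      ‖∫ y in ball 0 δ, (χ y * (3 * ε ^ 2 * newton ε x y ^ 5)) • u y‖ ≤ C := by
  have hD : ∀ i, ∃ C, ∀ x, ‖pderiv i χ x‖ ≤ C := fun i =>
    (hχ.pderiv i).1.continuous.bounded_above_of_compact_support (hχ.pderiv i).2.1
  choose D hD using hD
  have hD' : ∀ i, ∃ C, ∀ x, ‖pderiv i (pderiv i χ) x‖ ≤ C := fun i =>
    ((hχ.pderiv i).pderiv i).1.continuous.bounded_above_of_compact_support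
      ((hχ.pderiv i).pderiv i).2.1
  choose D' hD' using hD'
  have hD0 : ∀ i, 0 ≤ D i := fun i => (norm_nonneg _).trans (hD i 0)
  have hD0' : ∀ i, 0 ≤ D' i := fun i => (norm_nonneg _).trans (hD' i 0)
  set d : ℝ := (δ / 4)⁻¹ with hd
  have hd0 : 0 < d := by positivity
  set C₁ : ℝ := 2 * ∑ i, D i * d ^ 2 + (∑ i, D' i) * d with hC₁
  have hC₁0 : 0 ≤ C₁ := add_nonneg
    (mul_nonneg zero_le_two (Finset.sum_nonneg fun i _ => mul_nonneg (hD0 i) (by positivity)))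
    (mul_nonneg (Finset.sum_nonneg fun i _ => hD0' i) hd0.le)
  set G : Space → ℝ := (ball (0 : Space) (2 * δ)).indicator fun z => (‖z‖ ^ 2)⁻¹ with hG
  have hGi : Integrable G :=
    (integrable_indicator_iff measurableSet_ball).mpr integrableOn_inv_norm_sq
  have hG0 : ∀ z, 0 ≤ G z := fun z => Set.indicator_nonneg (fun z _ => by positivity) z
  refine ⟨C₁ * (∫ y in ball 0 δ, ‖u y‖) + k ^ 2 * ((∫ z, G z) + ∫ y in ball 0 δ, ‖u y‖ ^ 2),
    fun x hx ε hε => ?_⟩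
  have hx' : ‖x‖ < δ / 4 := by simpa using hx
  have hn := contDiff_newton hε.ne' x
  set a : Space → ℝ := fun y => χ y * (3 * ε ^ 2 * newton ε x y ^ 5) with ha
  set b : Space → ℝ := fun y => 2 * ∑ i, pderiv i χ y * pderiv i (newton ε x) y +
    laplace χ y * newton ε x y + k ^ 2 * (χ y * newton ε x y) with hb
  have hψ : IsTestFunction (ball 0 δ) fun y => χ y * newton ε x y :=
    ⟨hχ.1.mul hn, hχ.2.1.mul_right, (tsupport_mul_subset_left).trans hχ.2.2⟩
  have hac : Continuous a := hχ.1.continuous.mul (continuous_const.mul (hn.continuous.pow 5))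
  have hbc : Continuous b := by
    have h1 : Continuous (laplace χ) := continuous_finsetSum _ fun i _ =>
      ((hχ.pderiv i).pderiv i).1.continuous
    have h2 : ∀ i, Continuous (pderiv i χ) := fun i => (hχ.pderiv i).1.continuous
    have h3 : ∀ i, Continuous (pderiv i (newton ε x)) := fun i => (contDiff_pderiv hn i).continuous
    have h4 := hχ.1.continuous
    have h5 := hn.continuous
    fun_prop
  have hab : ∫ y in ball 0 δ, a y • u y = ∫ y in ball 0 δ, b y • u y := by
    have h := hw _ hψ
    have h' : ∀ y, (laplace (fun y => χ y * newton ε x y) y + k ^ 2 * (χ y * newton ε x y)) • u y =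
        b y • u y - a y • u y := fun y => by
      rw [laplace_mul hχ.1 hn, laplace_newton hε.ne', ← sub_smul]
      congr 1
      simp only [ha, hb]
      ring
    simp only [h'] at h
    rw [integral_sub (integrableOn_continuous_smul hbc hu) (integrableOn_continuous_smul hac hu)]
      at h
    exact (sub_eq_zero.mp h).symm
  have hbound : ∀ y ∈ ball (0 : Space) δ, y ≠ x → |b y| ≤ C₁ + k ^ 2 * ‖y - x‖⁻¹ := by
    intro y hy hyx
    have ht0 := newton_pos hε.ne' x y
    have ht1 := newton_le_inv_norm (ε := ε) hyx
    have hyx' : 0 < ‖y - x‖ := norm_pos_iff.mpr (sub_ne_zero.mpr hyx)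
    have hlast : |k ^ 2 * (χ y * newton ε x y)| ≤ k ^ 2 * ‖y - x‖⁻¹ := by
      rw [abs_mul, abs_mul, abs_of_nonneg (sq_nonneg k), abs_of_pos ht0]
      refine mul_le_mul_of_nonneg_left ?_ (sq_nonneg k)
      calc |χ y| * newton ε x y ≤ 1 * newton ε x y := by gcongr; exact hχ2 y
        _ ≤ _ := by rwa [one_mul]
    refine (abs_add_le _ _).trans (add_le_add ?_ hlast)
    -- The derivatives of `χ` vanish for `|y| < δ / 2`; elsewhere `y` is at distance at least `δ / 4`
    -- from `x`, and the kernel is harmless.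
    by_cases hyδ : ‖y‖ < δ / 2
    · have hmem : ball (0 : Space) (δ / 2) ∈ nhds y := isOpen_ball.mem_nhds (by simpa using hyδ)
      have h1 : ∀ i, pderiv i χ =ᶠ[nhds y] fun _ => 0 := fun i => by
        filter_upwards [hmem] with z hz
        refine pderiv_eq_zero_of_eventuallyEq_const (c := 1) ?_ i
        filter_upwards [isOpen_ball.mem_nhds hz] with w hw using hχ1 w hw
      have h2 : ∀ i, pderiv i (pderiv i χ) y = 0 := fun i =>
        pderiv_eq_zero_of_eventuallyEq_const (h1 i) i
      simp [(h1 _).self_of_nhds, laplace, h2, hC₁0]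
    · have hdist : δ / 4 ≤ ‖y - x‖ := by
        have := norm_sub_norm_le y x
        linarith
      have htd : newton ε x y ≤ d := ht1.trans (inv_anti₀ (by positivity) hdist)
      have hgrad : ∀ i, |pderiv i (newton ε x) y| ≤ d ^ 2 := fun i => by
        have h1 : |y i - x i| ≤ ‖y - x‖ := by
          simpa using PiLp.norm_apply_le (y - x) i
        have h2 : newton ε x y * ‖y - x‖ ≤ 1 := by
          calc newton ε x y * ‖y - x‖ ≤ ‖y - x‖⁻¹ * ‖y - x‖ := by gcongr
            _ = 1 := inv_mul_cancel₀ hyx'.ne'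
        rw [pderiv_newton hε.ne', abs_mul, abs_neg, abs_of_pos (pow_pos ht0 3)]
        calc newton ε x y ^ 3 * |y i - x i| ≤ newton ε x y ^ 3 * ‖y - x‖ := by gcongr
          _ = newton ε x y ^ 2 * (newton ε x y * ‖y - x‖) := by ring
          _ ≤ d ^ 2 * 1 := by gcongr
          _ = d ^ 2 := mul_one _
      refine (abs_add_le _ _).trans (add_le_add ?_ ?_)
      · rw [abs_mul, abs_two]
        refine mul_le_mul_of_nonneg_left ?_ zero_le_two
        refine (Finset.abs_sum_le_sum_abs _ _).trans (Finset.sum_le_sum fun i _ => ?_)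
        rw [abs_mul]
        exact mul_le_mul (hD i y) (hgrad i) (abs_nonneg _) (hD0 i)
      · rw [abs_mul, abs_of_pos ht0]
        refine mul_le_mul ?_ htd ht0.le (Finset.sum_nonneg fun i _ => hD0' i)
        exact (Finset.abs_sum_le_sum_abs _ _).trans (Finset.sum_le_sum fun i _ => hD' i y)
  rw [hab]
  have hGx : Integrable (fun y => G (y - x)) := hGi.comp_sub_right x
  have hsum : IntegrableOn (fun y => G (y - x) + ‖u y‖ ^ 2) (ball 0 δ) :=
    hGx.integrableOn.add hu2
  have hle : ‖∫ y in ball 0 δ, b y • u y‖ ≤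
      ∫ y in ball 0 δ, (C₁ * ‖u y‖ + k ^ 2 * (G (y - x) + ‖u y‖ ^ 2)) := by
    refine norm_integral_le_of_norm_le ((hu.norm.const_mul _).add (hsum.const_mul _)) ?_
    have hne : ∀ᵐ y ∂(volume.restrict (ball (0 : Space) δ)), y ≠ x :=
      ae_restrict_of_ae (by simp [ae_iff])
    filter_upwards [ae_restrict_mem measurableSet_ball, hne] with y hy hyx
    have hGy : G (y - x) = (‖y - x‖⁻¹) ^ 2 := by
      have : y - x ∈ ball (0 : Space) (2 * δ) := by
        rw [mem_ball_zero_iff] at hy ⊢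
        linarith [norm_sub_le y x]
      rw [hG, Set.indicator_of_mem this, inv_pow]
    rw [norm_smul, Real.norm_eq_abs, hGy]
    have h1 : ‖y - x‖⁻¹ * ‖u y‖ ≤ (‖y - x‖⁻¹) ^ 2 + ‖u y‖ ^ 2 := by
      nlinarith [sq_nonneg (‖y - x‖⁻¹ - ‖u y‖), sq_nonneg (‖y - x‖⁻¹), sq_nonneg ‖u y‖]
    calc |b y| * ‖u y‖ ≤ (C₁ + k ^ 2 * ‖y - x‖⁻¹) * ‖u y‖ := by
          gcongr
          exact hbound y hy hyx
      _ = C₁ * ‖u y‖ + k ^ 2 * (‖y - x‖⁻¹ * ‖u y‖) := by ring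
      _ ≤ _ := by gcongr
  refine hle.trans ?_
  rw [integral_add (hu.norm.const_mul _) (hsum.const_mul _), integral_const_mul,
    integral_const_mul, integral_add hGx.integrableOn hu2]
  have hG1 : ∫ y in ball 0 δ, G (y - x) ≤ ∫ z, G z := by
    rw [← integral_sub_right_eq_self G x]
    exact setIntegral_le_integral hGx (Filter.Eventually.of_forall fun y => hG0 _)
  gcongr

/-- The total mass of `-Δ (|x|² + 1)^{-1/2}`. -/
def newtonMass : ℝ := ∫ x : Space, 3 * newton 1 0 x ^ 5

theorem newtonMass_pos : 0 < newtonMass := by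
  have h0 : ∀ x, 0 < 3 * newton 1 0 x ^ 5 := fun x => by
    have := newton_pos one_ne_zero 0 x
    positivity
  rw [newtonMass, integral_pos_iff_support_of_nonneg (fun x => (h0 x).le)
    integrable_newton_pow_five]
  have : Function.support (fun x : Space => 3 * newton 1 0 x ^ 5) = Set.univ :=
    Set.eq_univ_of_forall fun x => (h0 x).ne'
  rw [this]
  simp

/-- The normalized kernel `-Δ (|x|² + 1)^{-1/2}`. -/
def peak (x : Space) : ℝ := newtonMass⁻¹ * (3 * newton 1 0 x ^ 5)

theorem peak_nonneg (x : Space) : 0 ≤ peak x := by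
  have := newton_pos one_ne_zero 0 x
  have := newtonMass_pos
  unfold peak
  positivity

theorem peak_le (x : Space) : peak x ≤ newtonMass⁻¹ * 3 := by
  have h3 := newton_pos one_ne_zero 0 x
  have := newtonMass_pos
  have hnle : newton 1 0 x ≤ 1 := by
    rw [newton]
    exact inv_le_one_of_one_le₀ (Real.one_le_sqrt.mpr (by nlinarith [sq_nonneg ‖x - 0‖]))
  calc peak x ≤ newtonMass⁻¹ * (3 * 1 ^ 5) := by
        unfold peak
        gcongr
    _ = _ := by ring

theorem continuous_peak : Continuous peak :=
  continuous_const.mul (continuous_const.mul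
    ((contDiff_newton one_ne_zero 0).continuous.pow 5))

theorem integral_peak : ∫ x, peak x = 1 := by
  simp only [peak]
  rw [integral_const_mul]
  exact inv_mul_cancel₀ newtonMass_pos.ne'

theorem tendsto_norm_pow_mul_peak :
    Filter.Tendsto (fun x : Space => ‖x‖ ^ Module.finrank ℝ Space * peak x)
      (Bornology.cobounded Space) (nhds 0) := by
  have hm := newtonMass_pos
  have h1 : Filter.Tendsto (fun x : Space => newtonMass⁻¹ * 3 * (‖x‖⁻¹) ^ 2)
      (Bornology.cobounded Space) (nhds (newtonMass⁻¹ * 3 * 0 ^ 2)) :=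
    ((tendsto_inv_atTop_zero.comp tendsto_norm_cobounded_atTop).pow 2).const_mul _
  rw [zero_pow two_ne_zero, mul_zero] at h1
  refine squeeze_zero'
    (Filter.Eventually.of_forall fun x => mul_nonneg (by positivity) (peak_nonneg x)) ?_ h1
  filter_upwards [tendsto_norm_cobounded_atTop.eventually_gt_atTop (0 : ℝ)] with x hx
  have h2 := newton_le_inv_norm (ε := 1) (norm_pos_iff.mp hx)
  rw [sub_zero] at h2
  have h3 := newton_pos one_ne_zero 0 x
  rw [finrank_euclideanSpace_fin]
  calc ‖x‖ ^ 3 * peak x ≤ ‖x‖ ^ 3 * (newtonMass⁻¹ * (3 * (‖x‖⁻¹) ^ 5)) := by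
        unfold peak
        gcongr
    _ = _ := by field_simp

/-- The rescaled kernel is the Laplacian of the smoothed Newton kernel. -/
theorem peak_scaling {c : ℝ} (hc : 0 < c) (x y : Space) :
    c ^ 3 * peak (c • (x - y)) = newtonMass⁻¹ * (3 * (c⁻¹) ^ 2 * newton c⁻¹ x y ^ 5) := by
  rw [← newton_one_scaling hc, peak]
  ring

/-- Interior regularity: square integrable weak solutions of the Helmholtz equation are locally
bounded. -/
theorem ae_bounded_of_helmholtz {δ k : ℝ} (hδ : 0 < δ) {u : Space → ℂ}
    (hu : IntegrableOn u (ball 0 δ)) (hu2 : IntegrableOn (fun x => ‖u x‖ ^ 2) (ball 0 δ))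
    (hw : ∀ ψ, IsTestFunction (ball 0 δ) ψ →
      ∫ x in ball 0 δ, (laplace ψ x + k ^ 2 * ψ x) • u x = 0) :
    ∃ C, ∀ᵐ z : Space, z ∈ ball (0 : Space) (δ / 8) → ‖u z‖ ≤ C := by
  obtain ⟨χ, hχ, hχ1, hχ2⟩ : ∃ χ : Space → ℝ, IsTestFunction (ball 0 δ) χ ∧
      (∀ x ∈ ball 0 (δ / 2), χ x = 1) ∧ ∀ x, |χ x| ≤ 1 := by
    let χ : ContDiffBump (0 : Space) := ⟨δ / 2, 3 * δ / 4, by positivity, by linarith⟩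
    refine ⟨χ, ⟨χ.contDiff, χ.hasCompactSupport, ?_⟩, fun x hx =>
      χ.one_of_mem_closedBall (ball_subset_closedBall hx), fun x => ?_⟩
    · rw [χ.tsupport_eq]
      exact closedBall_subset_ball (by simp only [χ]; linarith)
    · rw [abs_of_nonneg χ.nonneg]
      exact χ.le_one
  obtain ⟨C, hC⟩ := smeared_bound_of_helmholtz hδ hu hu2 hw hχ hχ1 hχ2
  have hm := newtonMass_pos
  have hUi : Integrable ((ball (0 : Space) δ).indicator fun y => χ y • u y) :=
    (integrable_indicator_iff measurableSet_ball).mpr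
      (integrableOn_continuous_smul hχ.1.continuous hu)
  have hker : ∀ x ∈ ball (0 : Space) (δ / 4), ∀ c : ℝ, 1 ≤ c →
      ‖∫ y, (c ^ Module.finrank ℝ Space * peak (c • (x - y))) •
        (ball (0 : Space) δ).indicator (fun y => χ y • u y) y‖ ≤ newtonMass⁻¹ * C := by
    intro x hx c hc
    have hc0 : 0 < c := by linarith
    have h1 : ∀ y, (c ^ Module.finrank ℝ Space * peak (c • (x - y))) •
        (ball (0 : Space) δ).indicator (fun y => χ y • u y) y =
        newtonMass⁻¹ • (ball (0 : Space) δ).indicator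
          (fun y => (χ y * (3 * (c⁻¹) ^ 2 * newton c⁻¹ x y ^ 5)) • u y) y := fun y => by
      rw [finrank_euclideanSpace_fin, peak_scaling hc0]
      by_cases hy : y ∈ ball (0 : Space) δ
      · rw [Set.indicator_of_mem hy, Set.indicator_of_mem hy, smul_smul, smul_smul]
        congr 1
        ring
      · rw [Set.indicator_of_notMem hy, Set.indicator_of_notMem hy, smul_zero, smul_zero]
    rw [integral_congr_ae (Filter.Eventually.of_forall h1), integral_smul,
      integral_indicator measurableSet_ball, norm_smul, Real.norm_of_nonneg (by positivity)]
    have := hC x hx c⁻¹ (by positivity)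
    gcongr
  have h := ae_norm_le_of_kernel_bound continuous_peak peak_nonneg integral_peak peak_le
    tendsto_norm_pow_mul_peak hUi (by positivity) hker
  refine ⟨newtonMass⁻¹ * C, ?_⟩
  filter_upwards [h] with z hz hzb
  have h1 := hz (by convert hzb using 2; ring)
  have hz1 : z ∈ ball (0 : Space) δ := ball_subset_ball (by linarith) hzb
  have hz2 : z ∈ ball (0 : Space) (δ / 2) := ball_subset_ball (by linarith) hzb
  rwa [Set.indicator_of_mem hz1, hχ1 z hz2, one_smul] at h1

/-! ### Cutting off test fields -/

theorem smul_crossProduct (c : ℝ) (a b : Fin 3 → ℂ) :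
    crossProduct (c • a) b = c • crossProduct a b := by
  rw [LinearMap.map_smul_of_tower, LinearMap.smul_apply]

/-- A smooth function that vanishes where `q ≤ 1 / n` and is one where `q ≥ 2 / n`. -/
def cutoff (q : Space → ℝ) (n : ℕ) (x : Space) : ℝ := Real.smoothTransition (n * q x - 1)

theorem contDiff_cutoff {q : Space → ℝ} (hq : ContDiff ℝ ∞ q) (n : ℕ) :
    ContDiff ℝ ∞ (cutoff q n) :=
  Real.smoothTransition.contDiff.comp ((contDiff_const.mul hq).sub contDiff_const)

theorem differentiable_smoothTransition : Differentiable ℝ Real.smoothTransition :=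
  (Real.smoothTransition.contDiff (n := ⊤)).differentiable (by simp)

theorem cgrad_cutoff {q : Space → ℝ} (hq : ContDiff ℝ ∞ q) (n : ℕ) (x : Space) :
    cgrad (cutoff q n) x = (n * deriv Real.smoothTransition (n * q x - 1)) • cgrad q x := by
  have h1 : HasFDerivAt (fun x => n * q x - 1) ((n : ℝ) • fderiv ℝ q x) x :=
    (((hq.differentiable (by simp)) x).hasFDerivAt.const_mul (n : ℝ)).sub_const 1
  have h2 := (differentiable_smoothTransition _).hasDerivAt.comp_hasFDerivAt x h1
  have h3 : Real.smoothTransition ∘ (fun x => n * q x - 1) = cutoff q n := rfl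
  rw [h3] at h2
  ext i
  simp only [cgrad, h2.fderiv, Pi.smul_apply]
  simp
  ring

theorem deriv_smoothTransition_eq_zero {t : ℝ} (ht : t ∉ Set.Icc (0 : ℝ) 1) :
    deriv Real.smoothTransition t = 0 := by
  rw [Set.mem_Icc, not_and_or, not_le, not_le] at ht
  rcases ht with h | h
  · have : Real.smoothTransition =ᶠ[nhds t] fun _ => 0 := by
      filter_upwards [Iio_mem_nhds h] with s hs using Real.smoothTransition.zero_of_nonpos hs.le
    rw [this.deriv_eq, deriv_const]
  · have : Real.smoothTransition =ᶠ[nhds t] fun _ => 1 := by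
      filter_upwards [Ioi_mem_nhds h] with s hs using Real.smoothTransition.one_of_one_le hs.le
    rw [this.deriv_eq, deriv_const]

theorem exists_deriv_smoothTransition_bound :
    ∃ K, 0 ≤ K ∧ ∀ t, |deriv Real.smoothTransition t| ≤ K := by
  obtain ⟨K, hK⟩ := (isCompact_Icc (a := (0 : ℝ)) (b := 1)).exists_bound_of_continuousOn
    ((Real.smoothTransition.contDiff (n := ⊤)).continuous_deriv (by simp)).continuousOn
  have h0 : 0 ≤ K := (norm_nonneg _).trans (hK 0 (by simp))
  refine ⟨K, h0, fun t => ?_⟩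
  by_cases ht : t ∈ Set.Icc (0 : ℝ) 1
  · exact hK t ht
  · rw [deriv_smoothTransition_eq_zero ht, abs_zero]
    exact h0

theorem tsupport_cutoff_smul_subset {q : Space → ℝ} (hq : Continuous q) (n : ℕ) (φ : VField) :
    tsupport (fun x => cutoff q n x • φ x) ⊆ {x | 1 ≤ n * q x} ∩ tsupport φ := by
  refine closure_minimal (fun x hx => ?_)
    ((isClosed_le continuous_const (continuous_const.mul hq)).inter (isClosed_tsupport _))
  rw [Function.mem_support] at hx
  constructor
  · by_contra h
    refine hx ?_
    rw [Set.mem_ofPred_eq, not_le] at h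
    simp only [cutoff]
    rw [Real.smoothTransition.zero_of_nonpos (by linarith), zero_smul]
  · exact subset_tsupport _ fun h => hx (by simp [h])

/-- Removal of a set `{q = 0}` from the domain of the weak equation. Cutting `φ` off near this set
produces the error `∇χ × φ · u`, of size `n` in a layer where `q` is of size `1 / n`; it disappears
in the limit as soon as `∇q × φ · u` is `q` times an integrable function. -/
theorem weakPairing_eq_zero_of_cutoff {Ω : Set Space} {q g : Space → ℝ} (hq : ContDiff ℝ ∞ q)
    (hq0 : ∀ᵐ x ∂(volume.restrict Ω), 0 < q x) {φ u w : VField} (hφ : ContDiff ℝ ∞ φ)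
    (hu : AEStronglyMeasurable u (volume.restrict Ω))
    (hint : IntegrableOn (fun x => curl φ x ⬝ᵥ u x - φ x ⬝ᵥ w x) Ω)
    (hg : IntegrableOn g Ω)
    (hb : ∀ᵐ x ∂(volume.restrict Ω), ‖crossProduct (cgrad q x) (φ x) ⬝ᵥ u x‖ ≤ q x * g x)
    (h0 : ∀ n : ℕ, 0 < n → weakPairing Ω u w (fun x => cutoff q n x • φ x) = 0) :
    weakPairing Ω u w φ = 0 := by
  obtain ⟨K, hK0, hK⟩ := exists_deriv_smoothTransition_bound
  set f : Space → ℂ := fun x => curl φ x ⬝ᵥ u x - φ x ⬝ᵥ w x with hf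
  set F : ℕ → Space → ℂ := fun n x => cutoff q n x • f x +
    (n * deriv Real.smoothTransition (n * q x - 1)) •
      (crossProduct (cgrad q x) (φ x) ⬝ᵥ u x) with hF
  have hFeq : ∀ n x, curl (fun x => cutoff q n x • φ x) x ⬝ᵥ u x -
      (cutoff q n x • φ x) ⬝ᵥ w x = F n x := fun n x => by
    rw [curl_smul ((contDiff_cutoff hq n).differentiable (by simp) x)
      (hφ.differentiable (by simp) x), cgrad_cutoff hq, add_dotProduct, smul_dotProduct,
      smul_dotProduct, smul_crossProduct, smul_dotProduct]
    simp only [hF, hf, smul_sub]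
    abel
  have hFint : ∀ n : ℕ, 0 < n → ∫ x in Ω, F n x = 0 := fun n hn => by
    rw [← h0 n hn, weakPairing]
    exact integral_congr_ae (Filter.Eventually.of_forall fun x => (hFeq n x).symm)
  have hcross : AEStronglyMeasurable (fun x => crossProduct (cgrad q x) (φ x) ⬝ᵥ u x)
      (volume.restrict Ω) := by
    refine aestronglyMeasurable_dotProduct (Continuous.aestronglyMeasurable ?_) hu
    have h1 := continuous_pi_iff.mp (continuous_cgrad hq)
    have h2 := continuous_pi_iff.mp hφ.continuous
    simp only [cross_apply]
    refine continuous_pi fun i => ?_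
    fin_cases i
    exacts [((h1 1).mul (h2 2)).sub ((h1 2).mul (h2 1)),
      ((h1 2).mul (h2 0)).sub ((h1 0).mul (h2 2)), ((h1 0).mul (h2 1)).sub ((h1 1).mul (h2 0))]
  have hds : Continuous (deriv Real.smoothTransition) :=
    (Real.smoothTransition.contDiff (n := ⊤)).continuous_deriv (by simp)
  have hqc := hq.continuous
  have hlim := tendsto_integral_of_dominated_convergence (μ := volume.restrict Ω) (F := F) (f := f)
    (fun x => ‖f x‖ + 2 * K * |g x|) (fun n => ?_) (hint.norm.add (hg.norm.const_mul (2 * K)))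
    (fun n => ?_) ?_
  · refine tendsto_nhds_unique hlim (tendsto_const_nhds.congr' ?_)
    filter_upwards [Filter.eventually_gt_atTop 0] with n hn using (hFint n hn).symm
  · refine AEStronglyMeasurable.add ?_ ?_
    · exact (contDiff_cutoff hq n).continuous.aestronglyMeasurable.smul hint.aestronglyMeasurable
    · exact (by fun_prop : Continuous fun x : Space =>
        (n * deriv Real.smoothTransition (n * q x - 1))).aestronglyMeasurable.smul hcross
  · filter_upwards [hq0, hb] with x hx hbx
    refine (norm_add_le _ _).trans (add_le_add ?_ ?_)
    · rw [norm_smul, cutoff, Real.norm_of_nonneg (Real.smoothTransition.nonneg _)]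
      exact mul_le_of_le_one_left (norm_nonneg _) (Real.smoothTransition.le_one _)
    · rw [norm_smul, Real.norm_eq_abs, abs_mul, abs_of_nonneg (Nat.cast_nonneg n)]
      -- The derivative of the cutoff lives where `1 ≤ n q ≤ 2`, so that `n q` is bounded there.
      by_cases ht : n * q x - 1 ∈ Set.Icc (0 : ℝ) 1
      · calc n * |deriv Real.smoothTransition (n * q x - 1)| *
              ‖crossProduct (cgrad q x) (φ x) ⬝ᵥ u x‖
            ≤ n * K * (q x * |g x|) := by
              gcongr
              · exact hK _
              · exact hbx.trans (mul_le_mul_of_nonneg_left (le_abs_self _) hx.le)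
          _ = (n * q x) * (K * |g x|) := by ring
          _ ≤ 2 * (K * |g x|) := by
              gcongr
              linarith [ht.2]
          _ = 2 * K * |g x| := by ring
      · rw [deriv_smoothTransition_eq_zero ht]
        simp only [abs_zero, mul_zero, zero_mul]
        positivity
  · filter_upwards [hq0] with x hx
    refine tendsto_const_nhds.congr' ?_
    obtain ⟨m, hm⟩ := exists_nat_gt (2 / q x)
    filter_upwards [Filter.eventually_ge_atTop m] with n hn
    have h1 : 2 < n * q x := by
      rw [div_lt_iff₀ hx] at hm
      have : (m : ℝ) ≤ n := Nat.cast_le.mpr hn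
      nlinarith
    have h2 : n * q x - 1 ∉ Set.Icc (0 : ℝ) 1 := fun h => by linarith [h.2]
    simp only [hF, cutoff]
    rw [deriv_smoothTransition_eq_zero h2, Real.smoothTransition.one_of_one_le (by linarith)]
    simp

theorem cgrad_norm_sq_add_const (c : ℝ) (x : Space) :
    cgrad (fun x => ‖x‖ ^ 2 + c) x = (2 : ℝ) • position x := by
  ext i
  rw [cgrad, ((hasStrictFDerivAt_norm_sq x).hasFDerivAt.add_const c).fderiv]
  simp [EuclideanSpace.inner_single_right, position]

theorem cgrad_const_sub_norm_sq (c : ℝ) (x : Space) :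
    cgrad (fun x => c - ‖x‖ ^ 2) x = (-2 : ℝ) • position x := by
  ext i
  rw [cgrad, ((hasStrictFDerivAt_norm_sq x).hasFDerivAt.const_sub c).fderiv]
  simp [EuclideanSpace.inner_single_right, position]

theorem norm_position_le (x : Space) : ‖position x‖ ≤ ‖x‖ := by
  refine (pi_norm_le_iff_of_nonneg (norm_nonneg _)).mpr fun i => ?_
  simpa [position] using PiLp.norm_apply_le x i

theorem contDiff_position : ContDiff ℝ ∞ position :=
  contDiff_pi.2 fun i => Complex.ofRealCLM.contDiff.comp
    (EuclideanSpace.proj i : Space →L[ℝ] ℝ).contDiff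

theorem contDiff_crossProduct {a b : VField} (ha : ContDiff ℝ ∞ a) (hb : ContDiff ℝ ∞ b) :
    ContDiff ℝ ∞ fun x => crossProduct (a x) (b x) := by
  have h1 := contDiff_pi.mp ha
  have h2 := contDiff_pi.mp hb
  simp only [cross_apply]
  refine contDiff_pi.2 fun i => ?_
  fin_cases i
  exacts [((h1 1).mul (h2 2)).sub ((h1 2).mul (h2 1)),
    ((h1 2).mul (h2 0)).sub ((h1 0).mul (h2 2)), ((h1 0).mul (h2 1)).sub ((h1 1).mul (h2 0))]

theorem ae_ne (Ω : Set Space) (x : Space) : ∀ᵐ y ∂(volume.restrict Ω), y ≠ x :=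
  ae_restrict_of_ae (by simp [ae_iff])

/-- A field that is normal to the sphere `|x| = 2` is as good as a test field: the tangential trace
does not see normal components. -/
theorem weakPairing_eq_zero_of_normal {u w ψ : VField} (hu : IntegrableOn u (ball 0 2))
    (hw : IntegrableOn w (ball 0 2))
    (h : ∀ φ, IsTestField (ball 0 2) φ → weakPairing (ball 0 2) u w φ = 0)
    (hψ : ContDiff ℝ ∞ ψ) (hn : ∀ x, ‖x‖ = 2 → crossProduct (position x) (ψ x) = 0) :
    weakPairing (ball 0 2) u w ψ = 0 := by
  have hv := contDiff_crossProduct contDiff_position hψ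
  set v : VField := fun x => crossProduct (position x) (ψ x) with hvdef
  obtain ⟨K, hK⟩ := (isCompact_closedBall (0 : Space) 2).exists_bound_of_continuousOn
    (hv.continuous_fderiv (by simp)).continuousOn
  have hK0 : 0 ≤ K := (norm_nonneg _).trans (hK 0 (by simp))
  -- The tangential part of `ψ` is Lipschitz and vanishes at the radial projection of `x` to the
  -- sphere, which is at distance `2 - |x| ≤ 4 - |x|²`.
  have hvb : ∀ x ∈ ball (0 : Space) 2, x ≠ 0 → ‖v x‖ ≤ K * (4 - ‖x‖ ^ 2) := by
    intro x hx hx0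
    have hx' : ‖x‖ < 2 := by simpa using hx
    have hr : 0 < ‖x‖ := norm_pos_iff.mpr hx0
    set y : Space := (2 / ‖x‖) • x with hy
    have hny : ‖y‖ = 2 := by
      rw [hy, norm_smul, Real.norm_of_nonneg (by positivity)]
      field_simp
    have hxy : ‖x - y‖ = 2 - ‖x‖ := by
      have : x - y = (1 - 2 / ‖x‖) • x := by rw [hy, sub_smul, one_smul]
      rw [this, norm_smul, Real.norm_eq_abs, abs_of_nonpos]
      · field_simp
        ring
      · rw [sub_nonpos, le_div_iff₀ hr]
        linarith
    have h1 := (convex_closedBall (0 : Space) 2).norm_image_sub_le_of_norm_fderiv_le (𝕜 := ℝ)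
      (fun z _ => hv.differentiable (by simp) z) hK (x := y) (y := x)
      (by simp [hny]) (ball_subset_closedBall hx)
    have hvy : v y = 0 := hn y hny
    rw [hvy, sub_zero, hxy] at h1
    refine h1.trans (mul_le_mul_of_nonneg_left ?_ hK0)
    nlinarith
  refine weakPairing_eq_zero_of_cutoff (q := fun x => 4 - ‖x‖ ^ 2) (g := fun x => 6 * K * ‖u x‖)
    (contDiff_const.sub (contDiff_norm_sq ℝ)) ?_ hψ hu.aestronglyMeasurable
    ((integrableOn_dotProduct subset_rfl measurableSet_ball (continuous_curl hψ) hu).sub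
      (integrableOn_dotProduct subset_rfl measurableSet_ball hψ.continuous hw))
    (hu.norm.const_mul (6 * K)) ?_ fun n hn => h _ ⟨?_, ?_, ?_⟩
  · filter_upwards [ae_restrict_mem measurableSet_ball] with x hx
    have hx' : ‖x‖ < 2 := by simpa using hx
    nlinarith [norm_nonneg x]
  · filter_upwards [ae_restrict_mem measurableSet_ball, ae_ne _ 0] with x hx hx0
    rw [cgrad_const_sub_norm_sq, smul_crossProduct, smul_dotProduct, norm_smul]
    have := hvb x hx hx0
    calc ‖(-2 : ℝ)‖ * ‖v x ⬝ᵥ u x‖ ≤ 2 * (3 * ‖v x‖ * ‖u x‖) := by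
          rw [norm_neg, Real.norm_two]
          gcongr
          exact norm_dotProduct_le _ _
      _ ≤ 2 * (3 * (K * (4 - ‖x‖ ^ 2)) * ‖u x‖) := by gcongr
      _ = _ := by ring
  · exact (contDiff_cutoff (contDiff_const.sub (contDiff_norm_sq ℝ)) n).smul hψ
  all_goals
    have hs : tsupport (fun x => cutoff (fun x => 4 - ‖x‖ ^ 2) n x • ψ x) ⊆ ball 0 2 := by
      refine (tsupport_cutoff_smul_subset
        (continuous_const.sub (contDiff_norm_sq ℝ (n := ∞)).continuous) n ψ).trans fun x hx => ?_
      have h1 : 1 ≤ n * (4 - ‖x‖ ^ 2) := hx.1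
      rw [mem_ball_zero_iff]
      by_contra hge
      have h2 : (n : ℝ) * (4 - ‖x‖ ^ 2) ≤ 0 :=
        mul_nonpos_of_nonneg_of_nonpos (Nat.cast_nonneg n) (by nlinarith)
      linarith
  · exact IsCompact.of_isClosed_subset (isCompact_closedBall 0 2) (isClosed_tsupport _)
      (hs.trans ball_subset_closedBall)
  · exact hs

/-- The function `|x|⁻¹` is square integrable near the origin in dimension three. -/
theorem integrableOn_inv_norm_mul_norm {u : VField}
    (hu : AEStronglyMeasurable u (volume.restrict (M₁ \ {0})))
    (hu2 : IntegrableOn (fun x => ‖u x‖ ^ 2) (M₁ \ {0})) :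
    IntegrableOn (fun x : Space => ‖x‖⁻¹ * ‖u x‖) (M₁ \ {0}) := by
  have hmeas : Measurable fun x : Space => ‖x‖⁻¹ := measurable_norm.inv
  refine Integrable.mono' ((integrableOn_inv_norm_sq.mono_set Set.sdiff_subset).add hu2)
    (hmeas.aestronglyMeasurable.mul hu.norm) (Filter.Eventually.of_forall fun x => ?_)
  rw [Real.norm_of_nonneg (by positivity)]
  have e : (‖x‖ ^ 2)⁻¹ = (‖x‖⁻¹) ^ 2 := by rw [inv_pow]
  simp only [Pi.add_apply, e]
  nlinarith [sq_nonneg (‖x‖⁻¹ - ‖u x‖), sq_nonneg (‖x‖⁻¹), sq_nonneg ‖u x‖]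

/-- A point is removable for square integrable weak solutions. -/
theorem weakPairing_eq_zero_of_punctured {u w φ : VField}
    (hu : AEStronglyMeasurable u (volume.restrict (M₁ \ {0})))
    (hu2 : IntegrableOn (fun x => ‖u x‖ ^ 2) (M₁ \ {0}))
    (hint : IntegrableOn (fun x => curl φ x ⬝ᵥ u x - φ x ⬝ᵥ w x) (M₁ \ {0}))
    (h : ∀ φ, IsTestField (M₁ \ {0}) φ → weakPairing (M₁ \ {0}) u w φ = 0)
    (hφ : IsTestField M₁ φ) : weakPairing (M₁ \ {0}) u w φ = 0 := by
  obtain ⟨C, hC⟩ := hφ.1.continuous.bounded_above_of_compact_support hφ.2.1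
  have hC0 : 0 ≤ C := (norm_nonneg _).trans (hC 0)
  have hq : ContDiff ℝ ∞ fun x : Space => ‖x‖ ^ 2 + 0 :=
    (contDiff_norm_sq ℝ).add contDiff_const
  have hg : IntegrableOn (fun x : Space => 12 * C * (‖x‖⁻¹ * ‖u x‖)) (M₁ \ {0}) :=
    (integrableOn_inv_norm_mul_norm hu hu2).const_mul _
  refine weakPairing_eq_zero_of_cutoff (q := fun x => ‖x‖ ^ 2 + 0) hq ?_ hφ.1 hu hint hg ?_
    fun n hn => h _ ⟨?_, ?_, ?_⟩
  · filter_upwards [ae_ne _ 0] with x hx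
    have : 0 < ‖x‖ := norm_pos_iff.mpr hx
    positivity
  · filter_upwards [ae_ne _ 0] with x hx
    have hx' : 0 < ‖x‖ := norm_pos_iff.mpr hx
    rw [cgrad_norm_sq_add_const, smul_crossProduct, smul_dotProduct, norm_smul,
      Real.norm_two]
    calc 2 * ‖crossProduct (position x) (φ x) ⬝ᵥ u x‖
        ≤ 2 * (3 * (2 * ‖position x‖ * ‖φ x‖) * ‖u x‖) := by
          gcongr
          refine (norm_dotProduct_le _ _).trans ?_
          gcongr
          exact norm_crossProduct_le _ _
      _ ≤ 2 * (3 * (2 * ‖x‖ * C) * ‖u x‖) := by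
          gcongr
          · exact norm_position_le x
          · exact hC x
      _ = (‖x‖ ^ 2 + 0) * (12 * C * (‖x‖⁻¹ * ‖u x‖)) := by
          field_simp
          ring
  · exact (contDiff_cutoff hq n).smul hφ.1
  · exact hφ.2.1.mono' (((subset_tsupport _).trans
      (tsupport_cutoff_smul_subset hq.continuous n φ)).trans Set.inter_subset_right)
  · refine (tsupport_cutoff_smul_subset hq.continuous n φ).trans fun x hx => ⟨hφ.2.2 hx.2, ?_⟩
    rintro rfl
    have h1 : (1 : ℝ) ≤ n * (‖(0 : Space)‖ ^ 2 + 0) := hx.1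
    simp at h1
    linarith

/-! ### Integrability and energy of the transported fields -/

theorem restrict_punctured :
    volume.restrict (M₁ \ {0} : Set Space) = volume.restrict M₁ :=
  Measure.restrict_congr_set (sdiff_null_ae_eq_self (by simp))

theorem aestronglyMeasurable_radial {μ : Measure Space} {α β : Space → ℝ} (hα : Measurable α)
    (hβ : Measurable β) {v : VField} (hv : AEStronglyMeasurable v μ) :
    AEStronglyMeasurable (fun x => applyMatrix (radialMatrix (α x) (β x) x) (v x)) μ := by
  simp only [applyMatrix_radialMatrix]
  have hp : AEStronglyMeasurable position μ := contDiff_position.continuous.aestronglyMeasurable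
  have hα' : AEStronglyMeasurable (fun x => (α x : ℂ)) μ :=
    (Complex.measurable_ofReal.comp hα).aestronglyMeasurable
  have hβ' : AEStronglyMeasurable (fun x => (β x : ℂ)) μ :=
    (Complex.measurable_ofReal.comp hβ).aestronglyMeasurable
  exact (hα'.smul hv).add ((hβ'.mul (aestronglyMeasurable_dotProduct hp hv)).smul hp)

theorem abs_coord_mul_le (x : Space) (i j : Fin 3) : |x i * x j| ≤ ‖x‖ ^ 2 := by
  have h : ∀ i, |x i| ≤ ‖x‖ := fun i => by simpa using PiLp.norm_apply_le x i
  rw [abs_mul, sq]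
  exact mul_le_mul (h i) (h j) (abs_nonneg _) (norm_nonneg _)

theorem abs_radialMatrix_le (α β : ℝ) (x : Space) (i j : Fin 3) :
    |radialMatrix α β x i j| ≤ |α| + |β| * ‖x‖ ^ 2 := by
  refine (abs_add_le _ _).trans (add_le_add ?_ ?_)
  · rw [abs_mul]
    refine mul_le_of_le_one_right (abs_nonneg _) ?_
    split_ifs <;> simp
  · rw [abs_mul]
    exact mul_le_mul_of_nonneg_left (abs_coord_mul_le x i j) (abs_nonneg _)

theorem abs_jacobian_blowUp_le {x : Space} (hx : x ∈ M₁ \ {0}) (i j : Fin 3) :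
    |jacobian blowUp x i j| ≤ 3 * ‖x‖⁻¹ := by
  have h : 0 < ‖x‖ := by simpa using hx.2
  have h2 : ‖x‖ < 2 := by simpa using hx.1
  rw [jacobian_blowUp hx.2]
  refine (abs_radialMatrix_le _ _ x i j).trans ?_
  rw [abs_neg, abs_of_pos (by positivity), abs_of_pos (by positivity)]
  field_simp
  linarith

theorem abs_jacobian_blowUpInv_le {y : Space} (hy : y ∈ N₁) (i j : Fin 3) :
    |jacobian blowUpInv y i j| ≤ 4 := by
  obtain ⟨h1, h2⟩ := mem_N₁_iff.mp hy
  have h : 0 < ‖y‖ := by linarith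
  have h' : 0 < ‖y‖ - 1 := by linarith
  rw [jacobian_blowUpInv (norm_pos_iff.mp h)]
  refine (abs_radialMatrix_le _ _ y i j).trans ?_
  rw [abs_of_pos (by positivity), abs_of_pos (by positivity)]
  field_simp
  linarith

/-- Boundedness near the origin makes up for the Jacobian determinant of `blowUp`, which is of size
`|x|⁻²`. -/
theorem integrableOn_comp_blowUpInv {u : VField} (hu : IntegrableOn u M₁) {δ C : ℝ} (hδ : 0 < δ)
    (hb : ∀ᵐ z : Space, z ∈ ball (0 : Space) δ → ‖u z‖ ≤ C) :
    IntegrableOn (fun y => u (blowUpInv y)) N₁ := by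
  rw [integrableOn_N₁_iff]
  have hu' : IntegrableOn u (M₁ \ {0}) := hu.mono_set Set.sdiff_subset
  have hb' := ae_restrict_of_ae (s := M₁ \ {0}) hb
  have hmeas : Measurable fun x : Space => ((‖x‖ / 2 + 1) / ‖x‖) ^ 2 / 2 := by fun_prop
  refine Integrable.mono' (g := fun x => 2 * |C| * (‖x‖ ^ 2)⁻¹ + 2 * (δ ^ 2)⁻¹ * ‖u x‖)
    (((integrableOn_inv_norm_sq.mono_set Set.sdiff_subset).const_mul _).add
      (hu'.norm.const_mul _))
    ((hmeas.aestronglyMeasurable.smul hu'.aestronglyMeasurable).congr ?_) ?_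
  · filter_upwards [ae_restrict_mem measurableSet_punctured] with x hx
    rw [det_jacobian_blowUp hx.2, blowUpInv_blowUp hx.2]
    rfl
  · filter_upwards [ae_restrict_mem measurableSet_punctured, hb'] with x hx hbx
    have h : 0 < ‖x‖ := by simpa using hx.2
    have h2 : ‖x‖ < 2 := by simpa using hx.1
    have hdet : (jacobian blowUp x).det ≤ 2 * (‖x‖ ^ 2)⁻¹ := by
      rw [det_jacobian_blowUp hx.2]
      field_simp
      nlinarith
    rw [norm_smul, Real.norm_of_nonneg (det_jacobian_blowUp_pos hx.2).le,
      blowUpInv_blowUp hx.2]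
    have h3 : (jacobian blowUp x).det * ‖u x‖ ≤ 2 * (‖x‖ ^ 2)⁻¹ * ‖u x‖ := by gcongr
    refine h3.trans ?_
    -- Near the origin the bound on `u` is used, elsewhere the bound on the determinant.
    by_cases hxδ : ‖x‖ < δ
    · have h4 := (hbx (by simpa using hxδ)).trans (le_abs_self C)
      calc 2 * (‖x‖ ^ 2)⁻¹ * ‖u x‖ ≤ 2 * (‖x‖ ^ 2)⁻¹ * |C| := by gcongr
        _ = 2 * |C| * (‖x‖ ^ 2)⁻¹ := by ring
        _ ≤ _ := le_add_of_nonneg_right (by positivity)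
    · have h4 : (‖x‖ ^ 2)⁻¹ ≤ (δ ^ 2)⁻¹ := by
        rw [not_lt] at hxδ
        gcongr
      calc 2 * (‖x‖ ^ 2)⁻¹ * ‖u x‖ ≤ 2 * (δ ^ 2)⁻¹ * ‖u x‖ := by gcongr
        _ ≤ _ := le_add_of_nonneg_left (by positivity)

theorem integrableOn_pushOneForm {u : VField}
    (hu : IntegrableOn (fun y => u (blowUpInv y)) N₁) :
    IntegrableOn (pushOneForm blowUpInv u) N₁ := by
  have h1 : Measurable fun y : Space => 2 * (‖y‖ - 1) / ‖y‖ := by fun_prop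
  have h2 : Measurable fun y : Space => 2 / ‖y‖ ^ 3 := by fun_prop
  refine Integrable.mono' (hu.norm.const_mul (3 * 4))
    ((aestronglyMeasurable_radial h1 h2 hu.aestronglyMeasurable).congr ?_) ?_
  · filter_upwards [ae_restrict_mem measurableSet_N₁] with y hy
    have h : y ≠ 0 := norm_pos_iff.mp (by linarith [(mem_N₁_iff.mp hy).1])
    rw [pushOneForm, jacobian_blowUpInv h, transpose_radialMatrix]
  · filter_upwards [ae_restrict_mem measurableSet_N₁] with y hy
    exact norm_applyMatrix_le _ (fun i j => abs_jacobian_blowUpInv_le hy j i) _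

theorem det_smul_pushTwoForm {x : Space} (hx : x ≠ 0) (w : VField) :
    (jacobian blowUp x).det • pushTwoForm blowUpInv w (blowUp x) =
      applyMatrix (jacobian blowUp x) (w x) := by
  rw [pushTwoForm_eq, ← applyMatrix_smul, adjugate_jacobian_blowUpInv hx, blowUpInv_blowUp hx]

theorem integrableOn_pushTwoForm {w : VField}
    (hw : AEStronglyMeasurable w (volume.restrict (M₁ \ {0})))
    (hw2 : IntegrableOn (fun x => ‖w x‖ ^ 2) (M₁ \ {0})) :
    IntegrableOn (pushTwoForm blowUpInv w) N₁ := by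
  rw [integrableOn_N₁_iff]
  have h1 : Measurable fun x : Space => (‖x‖ / 2 + 1) / ‖x‖ := by fun_prop
  have h2 : Measurable fun x : Space => -(1 / ‖x‖ ^ 3) := by fun_prop
  refine Integrable.mono' ((integrableOn_inv_norm_mul_norm hw hw2).const_mul 9)
    ((aestronglyMeasurable_radial h1 h2 hw).congr ?_) ?_
  · filter_upwards [ae_restrict_mem measurableSet_punctured] with x hx
    rw [det_smul_pushTwoForm hx.2, jacobian_blowUp hx.2]
  · filter_upwards [ae_restrict_mem measurableSet_punctured] with x hx
    rw [det_smul_pushTwoForm hx.2]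
    refine (norm_applyMatrix_le _ (abs_jacobian_blowUp_le hx) _).trans (le_of_eq ?_)
    ring

theorem star_pushOneForm (G : Space → Space) (u : VField) (y : Space) :
    star (pushOneForm G u y) = pushOneForm G (fun x => star (u x)) y := by
  ext i
  simp [pushOneForm, applyMatrix, Matrix.mulVec, dotProduct]

/-- The energy density is invariant under the change of variables. -/
theorem det_smul_energy {x : Space} (hx : x ≠ 0) (u : VField) :
    (jacobian blowUp x).det • (pushTwoForm blowUpInv u (blowUp x) ⬝ᵥ
      star (pushOneForm blowUpInv u (blowUp x))) = u x ⬝ᵥ star (u x) := by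
  rw [star_pushOneForm, det_smul_dotProduct_pushOneForm hx, pushTwoForm_eq, pushTwoForm_eq,
    blowUpInv_blowUp hx, ← applyMatrix_mul, ← Matrix.adjugate_mul_distrib,
    jacobian_blowUpInv_mul_jacobian_blowUp hx, Matrix.adjugate_one, applyMatrix_one]

theorem energy_N₁_iff (u : VField) :
    IntegrableOn (fun y => pushTwoForm blowUpInv u y ⬝ᵥ star (pushOneForm blowUpInv u y)) N₁ ↔
      IntegrableOn (fun x => u x ⬝ᵥ star (u x)) (M₁ \ {0}) := by
  rw [integrableOn_N₁_iff]
  exact integrableOn_congr_fun (fun x hx => det_smul_energy hx.2 u) measurableSet_punctured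

theorem dotProduct_star_eq (v : Fin 3 → ℂ) : v ⬝ᵥ star v = ((∑ i, ‖v i‖ ^ 2 : ℝ) : ℂ) := by
  simp [dotProduct, Complex.mul_conj']

theorem norm_sq_le_energy (v : Fin 3 → ℂ) : ‖v‖ ^ 2 ≤ ‖v ⬝ᵥ star v‖ := by
  rw [dotProduct_star_eq, Complex.norm_real, Real.norm_of_nonneg (by positivity)]
  have h : ∀ i, ‖v i‖ ≤ Real.sqrt (∑ i, ‖v i‖ ^ 2) := fun i =>
    Real.le_sqrt_of_sq_le (Finset.single_le_sum (f := fun i => ‖v i‖ ^ 2)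
      (fun j _ => by positivity) (Finset.mem_univ i))
  have := (pi_norm_le_iff_of_nonneg (Real.sqrt_nonneg _)).mpr h
  calc ‖v‖ ^ 2 ≤ Real.sqrt (∑ i, ‖v i‖ ^ 2) ^ 2 := by gcongr
    _ = _ := Real.sq_sqrt (by positivity)

theorem integrableOn_norm_sq {Ω : Set Space} {u : VField}
    (hu : AEStronglyMeasurable u (volume.restrict Ω))
    (h : IntegrableOn (fun x => u x ⬝ᵥ star (u x)) Ω) :
    IntegrableOn (fun x => ‖u x‖ ^ 2) Ω := by
  refine Integrable.mono' h.norm (hu.norm.pow 2) (Filter.Eventually.of_forall fun x => ?_)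
  rw [Real.norm_of_nonneg (by positivity)]
  exact norm_sq_le_energy _

/-- On a set of finite measure, square integrable fields are integrable. -/
theorem integrableOn_of_norm_sq {u : VField}
    (hu : AEStronglyMeasurable u (volume.restrict (M₁ \ {0})))
    (hu2 : IntegrableOn (fun x => ‖u x‖ ^ 2) (M₁ \ {0})) : IntegrableOn u (M₁ \ {0}) := by
  have h1 : IntegrableOn (fun _ : Space => (1 : ℝ)) (M₁ \ {0}) := by
    refine integrableOn_const ?_
    exact ((measure_mono Set.sdiff_subset).trans_lt measure_ball_lt_top).ne
  refine Integrable.mono' (h1.add hu2) hu (Filter.Eventually.of_forall fun x => ?_)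
  simp only [Pi.add_apply]
  nlinarith [sq_nonneg (‖u x‖ - 1), sq_nonneg ‖u x‖]

/-! ### Transport of test fields -/

/-- Smoothness at the origin holds because `blowUp` sends a neighbourhood of it, with the junk value
`blowUp 0 = 0`, into the set where `h` vanishes. -/
theorem contDiff_pushOneForm_blowUp {h : VField} (hh : ContDiff ℝ ∞ h) {r : ℝ} (hr : 1 < r)
    (h0 : ∀ y, ‖y‖ < r → h y = 0) : ContDiff ℝ ∞ (pushOneForm blowUp h) := by
  rw [contDiff_iff_contDiffAt]
  intro x
  by_cases hx : x = 0
  · have : pushOneForm blowUp h =ᶠ[nhds x] fun _ => 0 := by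
      subst hx
      filter_upwards [ball_mem_nhds (0 : Space) (by linarith : 0 < 2 * (r - 1))] with z hz
      have hz' : ‖z‖ < 2 * (r - 1) := by simpa using hz
      have hF : ‖blowUp z‖ < r := by
        by_cases hz0 : z = 0
        · simp only [hz0, blowUp, smul_zero, norm_zero]
          linarith
        · rw [norm_blowUp hz0]
          linarith
      rw [pushOneForm, h0 _ hF, applyMatrix, Matrix.mulVec_zero]
    exact contDiffAt_const.congr_of_eventuallyEq this
  · exact contDiffAt_pushOneForm (contDiffAt_blowUp hx) hh.contDiffAt

theorem IsTestField.exists_radii {h : VField} (hh : IsTestField N₁ h) :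
    ∃ r₁ r₂ : ℝ, 1 < r₁ ∧ r₂ < 2 ∧ ∀ y, h y ≠ 0 → r₁ ≤ ‖y‖ ∧ ‖y‖ ≤ r₂ := by
  by_cases hne : (tsupport h).Nonempty
  · obtain ⟨a, ha, hamin⟩ := hh.2.1.exists_isMinOn hne continuous_norm.continuousOn
    obtain ⟨b, hb, hbmax⟩ := hh.2.1.exists_isMaxOn hne continuous_norm.continuousOn
    exact ⟨‖a‖, ‖b‖, (mem_N₁_iff.mp (hh.2.2 ha)).1, (mem_N₁_iff.mp (hh.2.2 hb)).2, fun y hy =>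
      ⟨hamin (subset_tsupport _ hy), hbmax (subset_tsupport _ hy)⟩⟩
  · exact ⟨3 / 2, 3 / 2, by norm_num, by norm_num, fun y hy =>
      (hne ⟨y, subset_tsupport _ hy⟩).elim⟩

theorem IsTestField.exists_radii_punctured {h : VField} (hh : IsTestField (M₁ \ {0}) h) :
    ∃ r₁ r₂ : ℝ, 0 < r₁ ∧ r₂ < 2 ∧ ∀ y, h y ≠ 0 → r₁ ≤ ‖y‖ ∧ ‖y‖ ≤ r₂ := by
  by_cases hne : (tsupport h).Nonempty
  · obtain ⟨a, ha, hamin⟩ := hh.2.1.exists_isMinOn hne continuous_norm.continuousOn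
    obtain ⟨b, hb, hbmax⟩ := hh.2.1.exists_isMaxOn hne continuous_norm.continuousOn
    exact ⟨‖a‖, ‖b‖, norm_pos_iff.mpr (hh.2.2 ha).2, by simpa using (hh.2.2 hb).1, fun y hy =>
      ⟨hamin (subset_tsupport _ hy), hbmax (subset_tsupport _ hy)⟩⟩
  · exact ⟨1, 1, by norm_num, by norm_num, fun y hy =>
      (hne ⟨y, subset_tsupport _ hy⟩).elim⟩

theorem isTestField_of_radii {Ω : Set Space} {h : VField} (hh : ContDiff ℝ ∞ h) {r₁ r₂ : ℝ}
    (hr : ∀ y, h y ≠ 0 → r₁ ≤ ‖y‖ ∧ ‖y‖ ≤ r₂)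
    (hΩ : ∀ y : Space, r₁ ≤ ‖y‖ → ‖y‖ ≤ r₂ → y ∈ Ω) : IsTestField Ω h := by
  have hcl : IsClosed {y : Space | r₁ ≤ ‖y‖ ∧ ‖y‖ ≤ r₂} :=
    (isClosed_le continuous_const continuous_norm).inter
      (isClosed_le continuous_norm continuous_const)
  have hs : tsupport h ⊆ {y : Space | r₁ ≤ ‖y‖ ∧ ‖y‖ ≤ r₂} :=
    closure_minimal (fun y hy => hr y hy) hcl
  refine ⟨hh, ?_, fun y hy => hΩ y (hs hy).1 (hs hy).2⟩
  exact IsCompact.of_isClosed_subset (isCompact_closedBall 0 r₂) (isClosed_tsupport _)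
    fun y hy => by simpa using (hs hy).2

theorem IsTestField.pushOneForm_blowUp {h : VField} (hh : IsTestField N₁ h) :
    IsTestField (M₁ \ {0}) (pushOneForm blowUp h) := by
  obtain ⟨r₁, r₂, h1, h2, hr⟩ := hh.exists_radii
  have h0 : ∀ y, ‖y‖ < r₁ → h y = 0 := fun y hy => by
    by_contra hne
    linarith [(hr y hne).1]
  refine isTestField_of_radii (contDiff_pushOneForm_blowUp hh.1 h1 h0) (r₁ := 2 * (r₁ - 1))
    (r₂ := 2 * (r₂ - 1)) (fun x hx => ?_) fun y hy1 hy2 => ⟨?_, ?_⟩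
  · have hne : h (blowUp x) ≠ 0 := fun h' => hx (by
      rw [pushOneForm, h', applyMatrix, Matrix.mulVec_zero])
    obtain ⟨hr1, hr2⟩ := hr _ hne
    have hx0 : x ≠ 0 := by
      rintro rfl
      simp only [blowUp, smul_zero, norm_zero] at hr1
      linarith
    rw [norm_blowUp hx0] at hr1 hr2
    constructor <;> linarith
  · rw [mem_ball_zero_iff]
    linarith
  · rintro rfl
    rw [norm_zero] at hy1
    linarith

open Classical in
/-- The transport of a test field on the punctured ball to `N₁`, extended by zero. The truncation is
needed as `blowUpInv` also maps a part of the unit ball into `M₁`. -/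
def transport (φ : VField) : VField := fun y =>
  if 1 < ‖y‖ then pushOneForm blowUpInv φ y else 0

theorem isTestField_transport {φ : VField} (hφ : IsTestField (M₁ \ {0}) φ) :
    IsTestField N₁ (transport φ) := by
  obtain ⟨r₁, r₂, h1, h2, hr⟩ := hφ.exists_radii_punctured
  have hrad : ∀ y, transport φ y ≠ 0 → r₁ / 2 + 1 ≤ ‖y‖ ∧ ‖y‖ ≤ r₂ / 2 + 1 := by
    intro y hy
    unfold transport at hy
    split_ifs at hy with hy1
    · have hne : φ (blowUpInv y) ≠ 0 := fun h' => hy (by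
        rw [pushOneForm, h', applyMatrix, Matrix.mulVec_zero])
      obtain ⟨hr1, hr2⟩ := hr _ hne
      rw [norm_blowUpInv hy1] at hr1 hr2
      constructor <;> linarith
    · exact (hy rfl).elim
  refine isTestField_of_radii ?_ hrad fun y hy1 hy2 =>
    mem_N₁_iff.mpr ⟨by linarith, by linarith⟩
  rw [contDiff_iff_contDiffAt]
  intro y
  by_cases hy : 1 < ‖y‖
  · have : transport φ =ᶠ[nhds y] pushOneForm blowUpInv φ := by
      filter_upwards [(isOpen_lt continuous_const continuous_norm).mem_nhds hy] with z hz
      have hz' : 1 < ‖z‖ := hz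
      rw [transport, if_pos hz']
    exact (contDiffAt_pushOneForm (contDiffAt_blowUpInv (norm_pos_iff.mp (by linarith)))
      hφ.1.contDiffAt).congr_of_eventuallyEq this
  · have : transport φ =ᶠ[nhds y] fun _ => 0 := by
      have hy' : ‖y‖ < r₁ / 2 + 1 := by linarith
      filter_upwards [(isOpen_lt continuous_norm continuous_const).mem_nhds hy'] with z hz
      have hz' : ‖z‖ < r₁ / 2 + 1 := hz
      by_contra hne
      linarith [(hrad z hne).1]
    exact contDiffAt_const.congr_of_eventuallyEq this

theorem pushOneForm_blowUp_transport (φ : VField) {x : Space} (hx : x ≠ 0) :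
    pushOneForm blowUp (transport φ) x = φ x := by
  rw [pushOneForm, transport, if_pos (one_lt_norm_blowUp hx), pushOneForm, blowUpInv_blowUp hx,
    ← applyMatrix_mul, ← Matrix.transpose_mul, jacobian_blowUpInv_mul_jacobian_blowUp hx,
    Matrix.transpose_one, applyMatrix_one]

theorem isOpen_punctured : IsOpen (M₁ \ {0} : Set Space) := isOpen_ball.sdiff isClosed_singleton

theorem weakPairing_transport (u w : VField) {φ : VField} (hφ : IsTestField (M₁ \ {0}) φ) :
    weakPairing (M₁ \ {0}) u w φ =
      weakPairing N₁ (pushOneForm blowUpInv u) (pushTwoForm blowUpInv w) (transport φ) := by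
  rw [weakPairing_N₁ _ _ _ (isTestField_transport hφ).1]
  refine setIntegral_congr_fun measurableSet_punctured fun x hx => ?_
  have h : pushOneForm blowUp (transport φ) =ᶠ[nhds x] φ := by
    filter_upwards [isOpen_punctured.mem_nhds hx] with z hz
    exact pushOneForm_blowUp_transport φ hz.2
  rw [curl_congr h, h.self_of_nhds]

/-- The weak equation on `M₁` carries over to `N₁` without any condition on the interface: there the
tangential components of the transported field vanish to first order. -/
theorem weakPairing_N₁_eq_zero {u w h : VField} (hu : IntegrableOn u M₁) {δ C : ℝ} (hδ : 0 < δ)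
    (hb : ∀ᵐ z : Space, z ∈ ball (0 : Space) δ → ‖u z‖ ≤ C)
    (hweak : ∀ φ, IsTestField (M₁ \ {0}) φ → weakPairing (M₁ \ {0}) u w φ = 0)
    (hh : IsTestField N h)
    (hw : IntegrableOn (fun y => h y ⬝ᵥ pushTwoForm blowUpInv w y) N₁) :
    weakPairing N₁ (pushOneForm blowUpInv u) (pushTwoForm blowUpInv w) h = 0 := by
  have hcomp := integrableOn_comp_blowUpInv hu hδ hb
  have hut := integrableOn_pushOneForm hcomp
  obtain ⟨K, hK⟩ := hh.1.continuous.bounded_above_of_compact_support hh.2.1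
  have hK0 : 0 ≤ K := (norm_nonneg _).trans (hK 0)
  have hq : ContDiff ℝ ∞ fun x : Space => ‖x‖ ^ 2 + (-1 : ℝ) :=
    (contDiff_norm_sq ℝ).add contDiff_const
  have hsub : N₁ ⊆ ball 0 2 := Set.sdiff_subset
  refine weakPairing_eq_zero_of_cutoff hq (g := fun y => 48 * K * ‖u (blowUpInv y)‖) ?_ hh.1
    hut.aestronglyMeasurable
    ((integrableOn_dotProduct hsub measurableSet_N₁ (continuous_curl hh.1) hut).sub hw)
    (hcomp.norm.const_mul _) ?_ fun n hn => ?_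
  · filter_upwards [ae_restrict_mem measurableSet_N₁] with y hy
    nlinarith [(mem_N₁_iff.mp hy).1]
  · filter_upwards [ae_restrict_mem measurableSet_N₁] with y hy
    obtain ⟨h1, h2⟩ := mem_N₁_iff.mp hy
    have h0 : 0 < ‖y‖ := by linarith
    have h1' : 0 < ‖y‖ - 1 := by linarith
    -- The tangential eigenvalue of the Jacobian vanishes at the interface.
    have hcoef : 2 * (‖y‖ - 1) / ‖y‖ ≤ 2 * (‖y‖ ^ 2 + -1) := by
      rw [div_le_iff₀ h0]
      nlinarith [mul_pos h1' h0, mul_pos h1' (mul_pos h0 h0)]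
    have hq0 : 0 ≤ ‖y‖ ^ 2 + -1 := by nlinarith
    rw [cgrad_norm_sq_add_const, smul_crossProduct, smul_dotProduct, norm_smul, Real.norm_two,
      cross_pushOneForm_blowUpInv (norm_pos_iff.mp h0), norm_mul, Complex.norm_real,
      Real.norm_of_nonneg (by positivity)]
    have hd : ‖crossProduct (position y) (h y) ⬝ᵥ u (blowUpInv y)‖ ≤
        3 * (2 * 2 * K) * ‖u (blowUpInv y)‖ := by
      refine (norm_dotProduct_le _ _).trans ?_
      gcongr
      refine (norm_crossProduct_le _ _).trans ?_
      gcongr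
      · exact (norm_position_le y).trans h2.le
      · exact hK y
    calc 2 * (2 * (‖y‖ - 1) / ‖y‖ * ‖crossProduct (position y) (h y) ⬝ᵥ u (blowUpInv y)‖)
        ≤ 2 * (2 * (‖y‖ ^ 2 + -1) * (3 * (2 * 2 * K) * ‖u (blowUpInv y)‖)) := by gcongr
      _ = _ := by ring
  · have htest : IsTestField N₁ fun x => cutoff (fun x => ‖x‖ ^ 2 + (-1 : ℝ)) n x • h x := by
      have hs := tsupport_cutoff_smul_subset hq.continuous n h
      refine ⟨(contDiff_cutoff hq n).smul hh.1,
        hh.2.1.mono' (((subset_tsupport _).trans hs).trans Set.inter_subset_right), ?_⟩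
      intro y hy
      have hy1 : 1 ≤ n * (‖y‖ ^ 2 + (-1 : ℝ)) := (hs hy).1
      have hy2 : ‖y‖ < 2 := by simpa using hh.2.2 (hs hy).2
      refine mem_N₁_iff.mpr ⟨?_, hy2⟩
      by_contra hle
      have : (n : ℝ) * (‖y‖ ^ 2 + (-1 : ℝ)) ≤ 0 :=
        mul_nonpos_of_nonneg_of_nonpos (Nat.cast_nonneg n) (by nlinarith [norm_nonneg y])
      linarith
    rw [weakPairing_N₁ _ _ _ htest.1]
    exact hweak _ htest.pushOneForm_blowUp

/-! ### Weak formulations -/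

/-- `w` is the curl of `u` in the sense of distributions; `w` need not be integrable. -/
def WeakEq (Ω : Set Space) (u w : VField) : Prop :=
  ∀ φ : VField, IsTestField Ω φ → weakPairing Ω u w φ = 0

theorem faraday_iff {Ω : Set Space} {μ : Space → Matrix (Fin 3) (Fin 3) ℝ} {k : ℝ}
    {E H : VField} :
    (∀ h : VField, IsTestField Ω h →
      ∫ x in Ω, (curl h x ⬝ᵥ E x - Complex.I * k * (h x ⬝ᵥ applyMatrix (μ x) (H x))) = 0) ↔
    WeakEq Ω E fun x => (Complex.I * k) • applyMatrix (μ x) (H x) := by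
  simp only [WeakEq, weakPairing, dotProduct_smul, smul_eq_mul]

theorem ampere_iff {Ω : Set Space} {ε : Space → Matrix (Fin 3) (Fin 3) ℝ} {k : ℝ}
    {J E H : VField} :
    (∀ e : VField, IsTestField Ω e → ∫ x in Ω, (curl e x ⬝ᵥ H x +
      e x ⬝ᵥ ((Complex.I * k) • applyMatrix (ε x) (E x) - J x)) = 0) ↔
    WeakEq Ω H fun x => J x - (Complex.I * k) • applyMatrix (ε x) (E x) := by
  have h : ∀ a b c d : Fin 3 → ℂ, ∀ x : ℂ, x + c ⬝ᵥ (a - b) = x - c ⬝ᵥ (b - a) := by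
    intro a b c d x
    rw [dotProduct_sub, dotProduct_sub]
    ring
  simp only [WeakEq, weakPairing, h _ _ _ 0]

theorem weakPairing_congr {Ω : Set Space} (hΩ : MeasurableSet Ω) {u u' w w' φ : VField}
    (hu : ∀ x ∈ Ω, u x = u' x) (hw : ∀ x ∈ Ω, w x = w' x) :
    weakPairing Ω u w φ = weakPairing Ω u' w' φ :=
  setIntegral_congr_fun hΩ fun x hx => by simp only [hu x hx, hw x hx]

theorem weakPairing_congr_test {Ω : Set Space} (hΩ : IsOpen Ω) {u w φ ψ : VField}
    (h : ∀ x ∈ Ω, φ x = ψ x) : weakPairing Ω u w φ = weakPairing Ω u w ψ :=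
  setIntegral_congr_fun hΩ.measurableSet fun x hx => by
    have h' : φ =ᶠ[nhds x] ψ := by
      filter_upwards [hΩ.mem_nhds hx] with z hz using h z hz
    simp only [h x hx, curl_congr h']

theorem weakPairing_punctured (u w φ : VField) :
    weakPairing (M₁ \ {0}) u w φ = weakPairing M₁ u w φ := by
  rw [weakPairing, restrict_punctured, weakPairing]

/-! ### Layer and core -/

theorem N_ae_eq : (N : Set Space) =ᵐ[volume] (N₁ ∪ N₂ : Set Space) := by
  have hs : (N : Set Space) \ sphere 0 1 = N₁ ∪ N₂ := by
    ext y
    simp only [Set.mem_sdiff, mem_ball_zero_iff, mem_sphere_zero_iff_norm, Set.mem_union,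
      mem_closedBall_zero_iff, not_le]
    constructor
    · rintro ⟨h1, h2⟩
      rcases lt_or_gt_of_ne h2 with h | h
      exacts [Or.inr h, Or.inl ⟨h1, h⟩]
    · rintro (⟨h1, h2⟩ | h)
      exacts [⟨h1, h2.ne'⟩, ⟨by linarith, h.ne⟩]
  rw [← hs]
  exact (sdiff_null_ae_eq_self (Measure.addHaar_sphere _ _ _)).symm

theorem disjoint_N₁_N₂ : Disjoint N₁ N₂ := by
  rw [Set.disjoint_left]
  intro y h1 h2
  exact h1.2 (ball_subset_closedBall h2)

theorem integrableOn_N_iff {F : Type*} [NormedAddCommGroup F] {f : Space → F} :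
    IntegrableOn f N ↔ IntegrableOn f N₁ ∧ IntegrableOn f N₂ := by
  rw [integrableOn_congr_set_ae N_ae_eq, integrableOn_union]

theorem N₁_subset_N : N₁ ⊆ N := Set.sdiff_subset

theorem N₂_subset_N : N₂ ⊆ N := ball_subset_ball (by norm_num)

theorem weakPairing_N {u w φ : VField}
    (h : IntegrableOn (fun x => curl φ x ⬝ᵥ u x - φ x ⬝ᵥ w x) N) :
    weakPairing N u w φ = weakPairing N₁ u w φ + weakPairing N₂ u w φ := by
  obtain ⟨h1, h2⟩ := integrableOn_N_iff.mp h
  rw [weakPairing, setIntegral_congr_set N_ae_eq,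
    setIntegral_union disjoint_N₁_N₂ measurableSet_ball h1 h2, weakPairing, weakPairing]

theorem exists_radius {h : VField} (hh : IsTestField (ball 0 2) h) :
    ∃ r < 2, ∀ y, r < ‖y‖ → h y = 0 := by
  by_cases hne : (tsupport h).Nonempty
  · obtain ⟨b, hb, hbmax⟩ := hh.2.1.exists_isMaxOn hne continuous_norm.continuousOn
    refine ⟨‖b‖, by simpa using hh.2.2 hb, fun y hy => ?_⟩
    by_contra hy'
    exact absurd (hbmax (subset_tsupport _ hy')) (not_le.mpr hy)
  · refine ⟨1, by norm_num, fun y _ => ?_⟩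
    by_contra hy'
    exact hne ⟨y, subset_tsupport _ hy'⟩

/-- A cutoff around the unit ball: a smooth field agrees on a neighbourhood of the closed unit ball
with a test field, and the remainder vanishes there. -/
theorem exists_decomposition {φ : VField} (hφ : ContDiff ℝ ∞ φ) :
    ∃ ψ χ : VField, IsTestField N ψ ∧ ContDiff ℝ ∞ χ ∧ (∀ x, φ x = ψ x + χ x) ∧
      (∀ x, ‖x‖ ≤ 5 / 4 → χ x = 0) ∧ (∀ x, ‖x‖ = 2 → χ x = φ x) := by
  let b : ContDiffBump (0 : Space) := ⟨5 / 4, 3 / 2, by norm_num, by norm_num⟩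
  have hbs : tsupport (fun x => b x • φ x) ⊆ closedBall 0 (3 / 2) :=
    (tsupport_smul_subset_left b φ).trans (b.tsupport_eq.subset)
  refine ⟨fun x => b x • φ x, fun x => (1 - b x) • φ x, ⟨b.contDiff.smul hφ, ?_, ?_⟩,
    (contDiff_const.sub b.contDiff).smul hφ, fun x => ?_, fun x hx => ?_, fun x hx => ?_⟩
  · exact b.hasCompactSupport.smul_right
  · exact hbs.trans (closedBall_subset_ball (by norm_num))
  · rw [← add_smul]
    simp
  · change (1 - b x) • φ x = 0
    rw [b.one_of_mem_closedBall (by simpa using hx), sub_self, zero_smul]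
  · change (1 - b x) • φ x = φ x
    rw [b.zero_of_le_dist (by rw [dist_zero_right, hx]; norm_num), sub_zero, one_smul]

/-! ### Tangential traces -/

theorem ae_eq_of_integral_test_eq {Ω : Set Space} {R : ℝ} (hΩ : IsOpen Ω) (hR : Ω ⊆ ball 0 R)
    {w w' : VField} (hw : IntegrableOn w Ω) (hw' : IntegrableOn w' Ω)
    (h : ∀ φ, IsTestField Ω φ → ∫ x in Ω, φ x ⬝ᵥ w x = ∫ x in Ω, φ x ⬝ᵥ w' x) :
    ∀ᵐ x ∂(volume.restrict Ω), w x = w' x := by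
  have key : ∀ j : Fin 3, ∀ᵐ x : Space, x ∈ Ω → w x j - w' x j = 0 := by
    intro j
    have hint : IntegrableOn (fun x => w x j - w' x j) Ω := (hw.eval j).sub (hw'.eval j)
    refine hΩ.ae_eq_zero_of_integral_contDiff_smul_eq_zero hint.locallyIntegrableOn
      fun g hg1 hg2 hg3 => ?_
    have hg : IsTestFunction Ω g := ⟨hg1, hg2, hg3⟩
    have ht : IsTestField Ω (realField (axisField j g)) := isTestField_realField fun i => by
      unfold axisField
      split_ifs
      exacts [hg, isTestFunction_zero _]
    have hd : ∀ v : VField, ∀ x, realField (axisField j g) x ⬝ᵥ v x = g x • v x j := by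
      intro v x
      simp only [realField, axisField, dotProduct]
      rw [Finset.sum_eq_single j]
      · simp
      · intro b _ hb
        simp [hb]
      · simp
    have h1 := h _ ht
    have i1 := integrableOn_dotProduct hR hΩ.measurableSet ht.1.continuous hw
    have i2 := integrableOn_dotProduct hR hΩ.measurableSet ht.1.continuous hw'
    simp only [hd] at h1 i1 i2
    rw [← setIntegral_eq_integral_of_forall_compl_eq_zero (s := Ω)]
    · simp only [smul_sub]
      rw [integral_sub i1 i2, h1, sub_self]
    · intro x hx
      rw [image_eq_zero_of_notMem_tsupport fun h' => hx (hg3 h'), zero_smul]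
  have hall := ae_all_iff.mpr key
  rw [ae_restrict_iff' hΩ.measurableSet]
  filter_upwards [hall] with x hx hxΩ
  ext j
  exact sub_eq_zero.mp (hx j hxΩ)

/-- For a field with a known integrable weak curl the trace is computed from that curl, as weak
curls are unique. -/
theorem hasTangentialTrace_iff {Ω : Set Space} {R : ℝ} (hΩ : IsOpen Ω) (hR : Ω ⊆ ball 0 R)
    {u w : VField} (hu : IntegrableOn u Ω) (hw : IntegrableOn w Ω) (h : WeakEq Ω u w)
    (f : BoundaryDatum Ω) :
    HasTangentialTrace Ω u f ↔ ∀ φ : smoothFields,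
      f (restrictField (frontier Ω) φ) = -weakPairing Ω u w (φ : VField) := by
  have hm := hΩ.measurableSet
  have hcurl : HasWeakCurl Ω u w := fun φ hφ => by
    have h1 := h φ hφ
    rw [weakPairing, integral_sub (integrableOn_dotProduct hR hm (continuous_curl hφ.1) hu)
      (integrableOn_dotProduct hR hm hφ.1.continuous hw)] at h1
    exact sub_eq_zero.mp h1
  have hform : ∀ φ : VField, ∫ x in Ω, (w x ⬝ᵥ φ x - u x ⬝ᵥ curl φ x) = -weakPairing Ω u w φ := by
    intro φ
    rw [weakPairing, ← integral_neg]
    refine integral_congr_ae (Filter.Eventually.of_forall fun x => ?_)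
    simp only [dotProduct_comm (w x), dotProduct_comm (u x), neg_sub]
  constructor
  · rintro ⟨-, w', hw', hcurl', htr⟩ φ
    rw [htr φ, ← hform]
    have hae := ae_eq_of_integral_test_eq hΩ hR hw' hw fun ψ hψ =>
      (hcurl' ψ hψ).symm.trans (hcurl ψ hψ)
    refine integral_congr_ae ?_
    filter_upwards [hae] with x hx
    rw [hx]
  · intro hf
    exact ⟨hu, w, hw, hcurl, fun φ => by rw [hf φ, hform]⟩

theorem boundaryDatum_eq_zero {Ω : Set Space} {f : BoundaryDatum Ω}
    (h : ∀ φ : smoothFields, f (restrictField (frontier Ω) φ) = 0) : f = 0 := by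
  ext ⟨v, hv⟩
  obtain ⟨φ, hφ, rfl⟩ := Submodule.mem_map.mp hv
  exact h ⟨φ, hφ⟩

/-- The traces of a field and of its push-forward on the outer sphere agree. Modulo test fields, a
field on `N` may be pulled back to `M₁`; on the sphere the pull-back only differs from the field in
the normal component. -/
theorem weakPairing_N_eq_weakPairing_M₁ {u w ut wt : VField}
    (hut : ∀ y ∈ N₁, ut y = pushOneForm blowUpInv u y)
    (hwt : ∀ y ∈ N₁, wt y = pushTwoForm blowUpInv w y)
    (iu : IntegrableOn u M₁) (iw : IntegrableOn w M₁) (iut : IntegrableOn ut N)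
    (iwt : IntegrableOn wt N) (h : WeakEq M₁ u w) (ht : WeakEq N ut wt) {φ : VField}
    (hφ : ContDiff ℝ ∞ φ) : weakPairing N ut wt φ = weakPairing M₁ u w φ := by
  obtain ⟨ψ, χ, hψ, hχ, hsum, hχ0, hχ2⟩ := exists_decomposition hφ
  have hint : ∀ {u w φ : VField}, IntegrableOn u (ball 0 2) → IntegrableOn w (ball 0 2) →
      ContDiff ℝ ∞ φ → IntegrableOn (fun x => curl φ x ⬝ᵥ u x - φ x ⬝ᵥ w x) (ball 0 2) :=
    fun hu hw hφ => (integrableOn_dotProduct subset_rfl measurableSet_ball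
      (continuous_curl hφ) hu).sub
        (integrableOn_dotProduct subset_rfl measurableSet_ball hφ.continuous hw)
  have hadd : ∀ {u w φ ψ : VField}, IntegrableOn u (ball 0 2) → IntegrableOn w (ball 0 2) →
      ContDiff ℝ ∞ φ → ContDiff ℝ ∞ ψ → weakPairing (ball 0 2) u w (fun x => φ x + ψ x) =
        weakPairing (ball 0 2) u w φ + weakPairing (ball 0 2) u w ψ := by
    intro u w φ ψ hu hw hφ hψ
    rw [weakPairing, weakPairing, weakPairing, ← integral_add (hint hu hw hφ) (hint hu hw hψ)]
    refine integral_congr_ae (Filter.Eventually.of_forall fun x => ?_)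
    simp only
    rw [curl_add (hφ.differentiable (by simp) x) (hψ.differentiable (by simp) x),
      add_dotProduct, add_dotProduct]
    ring
  have hsum' : φ = fun x => ψ x + χ x := funext hsum
  set η : VField := pushOneForm blowUp χ with hη
  have hηs : ContDiff ℝ ∞ η := contDiff_pushOneForm_blowUp hχ (by norm_num : (1 : ℝ) < 5 / 4)
    fun y hy => hχ0 y hy.le
  have hχN₂ : weakPairing N₂ ut wt χ = 0 := by
    rw [weakPairing_congr_test isOpen_ball (ψ := 0), weakPairing]
    · have : ∀ x, curl (0 : VField) x = 0 := fun x =>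
        curl_zero_of_eventuallyEq Filter.EventuallyEq.rfl
      simp [this]
    · intro x hx
      exact hχ0 x (by linarith [mem_ball_zero_iff.mp hx])
  -- On `N` only `χ` matters, and its pull-back `η` is a smooth field on all of space.
  have h1 : weakPairing N ut wt φ = weakPairing M₁ u w η := by
    rw [hsum', hadd iut iwt hψ.1 hχ, ht ψ hψ, zero_add, weakPairing_N (hint iut iwt hχ), hχN₂,
      add_zero, weakPairing_congr measurableSet_N₁ hut hwt, weakPairing_N₁ _ _ _ hχ,
      weakPairing_punctured]
  have hnormal : weakPairing M₁ u w (fun x => χ x - η x) = 0 := by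
    refine weakPairing_eq_zero_of_normal iu iw h (hχ.sub hηs) fun x hx => ?_
    have hx0 : x ≠ 0 := norm_pos_iff.mp (by rw [hx]; norm_num)
    rw [map_sub, hη, position_cross_pushOneForm_blowUp hx0, blowUp_of_norm_eq_two hx, hx]
    norm_num
  have h2 : weakPairing M₁ u w φ = weakPairing M₁ u w η := by
    have e : χ = fun x => η x + (χ x - η x) := funext fun x => by abel
    rw [hsum', hadd iu iw hψ.1 hχ, h ψ hψ, zero_add]
    conv_lhs => rw [e]
    rw [hadd iu iw hηs (hχ.sub hηs), hnormal, add_zero]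
  rw [h1, h2]

/-! ### Transfer of the weak equations -/

/-- The equation on `N` gives the equation on the punctured ball. -/
theorem WeakEq.of_N {u w ut wt : VField} (hut : ∀ y ∈ N₁, ut y = pushOneForm blowUpInv u y)
    (hwt : ∀ y ∈ N₁, wt y = pushTwoForm blowUpInv w y) (h : WeakEq N ut wt) :
    WeakEq (M₁ \ {0}) u w := fun φ hφ => by
  have ht := isTestField_transport hφ
  rw [weakPairing_transport u w hφ, ← weakPairing_congr measurableSet_N₁ hut hwt,
    ← weakPairing_eq_of_subset N₁_subset_N measurableSet_ball ht]
  exact h _ (ht.mono N₁_subset_N)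

theorem WeakEq.core {u w ut wt : VField} (hut : ∀ y ∈ N₂, ut y = u y)
    (hwt : ∀ y ∈ N₂, wt y = w y) (h : WeakEq N ut wt) : WeakEq N₂ u w := fun φ hφ => by
  rw [← weakPairing_congr measurableSet_ball hut hwt,
    ← weakPairing_eq_of_subset N₂_subset_N measurableSet_ball hφ]
  exact h _ (hφ.mono N₂_subset_N)

/-- If the equation holds on the layer without an interface condition, then inside the interface the
tangential trace vanishes. -/
theorem weakPairing_core_eq_zero {u w ut wt : VField} (hut : ∀ y ∈ N₂, ut y = u y)
    (hwt : ∀ y ∈ N₂, wt y = w y) (h : WeakEq N ut wt) (iut : IntegrableOn ut N)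
    (iwt : ∀ φ, IsTestField N φ → IntegrableOn (fun x => φ x ⬝ᵥ wt x) N)
    (h1 : ∀ φ, IsTestField N φ → weakPairing N₁ ut wt φ = 0) {φ : VField}
    (hφ : ContDiff ℝ ∞ φ) : weakPairing N₂ u w φ = 0 := by
  obtain ⟨ψ, χ, hψ, hχ, hsum, hχ0, -⟩ := exists_decomposition hφ
  have e : ∀ x ∈ N₂, φ x = ψ x := fun x hx => by
    rw [hsum x, hχ0 x (by linarith [mem_ball_zero_iff.mp hx]), add_zero]
  have hs := weakPairing_N (u := ut) (w := wt) ((integrableOn_dotProduct subset_rfl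
    measurableSet_ball (continuous_curl hψ.1) iut).sub (iwt ψ hψ))
  rw [h ψ hψ, h1 ψ hψ, zero_add] at hs
  rw [weakPairing_congr_test isOpen_ball e, ← weakPairing_congr measurableSet_ball hut hwt, ← hs]

/-- Gluing: without interface conditions on the layer, and with vanishing trace inside, the equation
holds across the interface. -/
theorem WeakEq.to_N {u w ut wt : VField} (hut : ∀ y ∈ N₂, ut y = u y)
    (hwt : ∀ y ∈ N₂, wt y = w y) (iut : IntegrableOn ut N)
    (iwt : ∀ φ, IsTestField N φ → IntegrableOn (fun x => φ x ⬝ᵥ wt x) N)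
    (h1 : ∀ φ, IsTestField N φ → weakPairing N₁ ut wt φ = 0)
    (h2 : ∀ φ, ContDiff ℝ ∞ φ → weakPairing N₂ u w φ = 0) : WeakEq N ut wt := fun φ hφ => by
  rw [weakPairing_N ((integrableOn_dotProduct subset_rfl measurableSet_ball
    (continuous_curl hφ.1) iut).sub (iwt φ hφ)), h1 φ hφ, zero_add,
    weakPairing_congr measurableSet_ball hut hwt, h2 φ hφ.1]

/-! ### Regularity near the blown-up point -/

theorem ae_bounded_of_system {r k : ℝ} (hr : 0 < r) (hk : k ≠ 0) {E H : VField}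
    (hE : IntegrableOn E (ball 0 r)) (hE2 : IntegrableOn (fun x => ‖E x‖ ^ 2) (ball 0 r))
    (h1 : ∀ h, IsTestField (ball 0 r) h → ∫ x in ball 0 r, curl h x ⬝ᵥ E x =
      Complex.I * k * ∫ x in ball 0 r, h x ⬝ᵥ H x)
    (h2 : ∀ e, IsTestField (ball 0 r) e → ∫ x in ball 0 r, curl e x ⬝ᵥ H x =
      -(Complex.I * k * ∫ x in ball 0 r, e x ⬝ᵥ E x)) :
    ∃ C, ∀ᵐ z : Space, z ∈ ball (0 : Space) (r / 8) → ‖E z‖ ≤ C := by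
  have hcomp : ∀ j, ∃ C, ∀ᵐ z : Space, z ∈ ball (0 : Space) (r / 8) → ‖E z j‖ ≤ C := by
    intro j
    have i1 : IntegrableOn (fun x => E x j) (ball 0 r) := hE.eval j
    have i2 : IntegrableOn (fun x => ‖E x j‖ ^ 2) (ball 0 r) := by
      refine Integrable.mono' hE2 (i1.norm.aestronglyMeasurable.pow 2)
        (Filter.Eventually.of_forall fun x => ?_)
      rw [Real.norm_of_nonneg (by positivity)]
      gcongr
      exact norm_le_pi_norm (E x) j
    exact ae_bounded_of_helmholtz hr i1 i2 fun ψ hψ => helmholtz_of_maxwell hk hE h1 h2 hψ j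
  choose C hC using hcomp
  refine ⟨∑ j, |C j|, ?_⟩
  filter_upwards [ae_all_iff.mpr hC] with z hz hzb
  refine (pi_norm_le_iff_of_nonneg (Finset.sum_nonneg fun j _ => abs_nonneg _)).mpr fun j => ?_
  exact ((hz j hzb).trans (le_abs_self _)).trans
    (Finset.single_le_sum (f := fun j => |C j|) (fun j _ => abs_nonneg _) (Finset.mem_univ j))

/-- The equations without sources on a small ball, in the form needed for the regularity theory. -/
theorem WeakEq.integral_eq {r : ℝ} (hr : r ≤ 2) {u w v : VField} {c : ℂ}
    (hu : IntegrableOn u M₁) (hv : IntegrableOn v M₁) (h : WeakEq M₁ u w)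
    (hw : ∀ x ∈ ball (0 : Space) r, x ≠ 0 → w x = c • v x) {φ : VField}
    (hφ : IsTestField (ball 0 r) φ) :
    ∫ x in ball 0 r, curl φ x ⬝ᵥ u x = c * ∫ x in ball 0 r, φ x ⬝ᵥ v x := by
  have hs : ball (0 : Space) r ⊆ M₁ := ball_subset_ball hr
  have h1 := h φ (hφ.mono hs)
  rw [weakPairing_eq_of_subset hs measurableSet_ball hφ, weakPairing] at h1
  have h2 : ∫ x in ball 0 r, (curl φ x ⬝ᵥ u x - φ x ⬝ᵥ w x) =
      ∫ x in ball 0 r, (curl φ x ⬝ᵥ u x - c * (φ x ⬝ᵥ v x)) := by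
    refine integral_congr_ae ?_
    filter_upwards [ae_restrict_mem measurableSet_ball, ae_ne _ 0] with x hx hx0
    rw [hw x hx hx0, dotProduct_smul, smul_eq_mul]
  have i2 : IntegrableOn (fun x => c * (φ x ⬝ᵥ v x)) (ball 0 r) :=
    Integrable.const_mul (integrableOn_dotProduct subset_rfl measurableSet_ball hφ.1.continuous
      (hv.mono_set hs)) c
  rw [h2, integral_sub (integrableOn_dotProduct subset_rfl measurableSet_ball
    (continuous_curl hφ.1) (hu.mono_set hs)) i2, integral_const_mul] at h1
  exact sub_eq_zero.mp h1

/-- Finite energy solutions are bounded near a point away from the sources. -/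
theorem ae_bounded_of_maxwell {k : ℝ} (hk : k ≠ 0) {J E H : VField}
    (hE : IntegrableOn E M₁) (hH : IntegrableOn H M₁)
    (hE2 : IntegrableOn (fun x => ‖E x‖ ^ 2) M₁) (hH2 : IntegrableOn (fun x => ‖H x‖ ^ 2) M₁)
    (h1 : WeakEq M₁ E fun x => (Complex.I * k) • H x)
    (h2 : WeakEq M₁ H fun x => J x - (Complex.I * k) • E x)
    (hJ : ∃ δ > 0, ∀ x ∈ M₁ \ {0}, ‖x‖ < δ → J x = 0) :
    ∃ δ > 0, (∃ C, ∀ᵐ z : Space, z ∈ ball (0 : Space) δ → ‖E z‖ ≤ C) ∧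
      ∃ C, ∀ᵐ z : Space, z ∈ ball (0 : Space) δ → ‖H z‖ ≤ C := by
  obtain ⟨δ, hδ, hJ⟩ := hJ
  set r := min δ 2 with hr
  have hr0 : 0 < r := lt_min hδ two_pos
  have hr2 : r ≤ 2 := min_le_right _ _
  have hs : ball (0 : Space) r ⊆ M₁ := ball_subset_ball hr2
  have f1 : ∀ h, IsTestField (ball 0 r) h → ∫ x in ball 0 r, curl h x ⬝ᵥ E x =
      Complex.I * k * ∫ x in ball 0 r, h x ⬝ᵥ H x := fun h hh =>
    h1.integral_eq hr2 hE hH (fun x _ _ => rfl) hh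
  have f2 : ∀ h, IsTestField (ball 0 r) h → ∫ x in ball 0 r, curl h x ⬝ᵥ H x =
      -(Complex.I * k) * ∫ x in ball 0 r, h x ⬝ᵥ E x := fun h hh =>
    h2.integral_eq hr2 hH hE (fun x hx hx0 => by
      have hx' : ‖x‖ < r := by simpa using hx
      rw [hJ x ⟨hs hx, hx0⟩ (hx'.trans_le (min_le_left _ _)), zero_sub, neg_smul]) hh
  refine ⟨r / 8, by positivity, ?_, ?_⟩
  · exact ae_bounded_of_system hr0 hk (hE.mono_set hs) (hE2.mono_set hs) f1
      fun e he => by rw [f2 e he]; ring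
  · -- The equations are invariant under exchanging the fields and reversing the frequency.
    exact ae_bounded_of_system (k := -k) hr0 (neg_ne_zero.mpr hk) (hH.mono_set hs)
      (hH2.mono_set hs) (fun h hh => by rw [f2 h hh]; push_cast; ring)
      fun e he => by rw [f1 e he]; push_cast; ring

/-! ### Sources -/

/-- The source need not be integrable on `M₁`, as it is not controlled near the outer sphere. -/
theorem integrableOn_dotProduct_source {a J : VField} (ha : ContinuousOn a (M₁ \ {0}))
    (hJ : ContDiffOn ℝ ∞ J (M₁ \ {0}))
    (hJ0 : ∃ δ > 0, ∀ x ∈ M₁ \ {0}, ‖x‖ < δ → J x = 0) {r : ℝ} (hr : r < 2)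
    (ha0 : ∀ x ∈ M₁ \ {0}, r < ‖x‖ → a x = 0) :
    IntegrableOn (fun x => a x ⬝ᵥ J x) (M₁ \ {0}) := by
  obtain ⟨δ, hδ, hJ0⟩ := hJ0
  -- The product is supported in a compact shell that avoids the origin and the outer sphere.
  set K : Set Space := closedBall 0 r \ ball 0 δ with hKdef
  have hK : IsCompact K := (isCompact_closedBall 0 r).diff isOpen_ball
  have hKs : K ⊆ M₁ \ {0} := fun x hx => ⟨closedBall_subset_ball hr hx.1, fun h0 => hx.2 (by
    rw [Set.mem_singleton_iff.mp h0]
    exact mem_ball_self hδ)⟩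
  have hc : ContinuousOn (fun x => a x ⬝ᵥ J x) (M₁ \ {0}) :=
    (continuous_dotProduct continuous_fst continuous_snd).comp_continuousOn
      (ha.prodMk hJ.continuousOn)
  refine ((hc.mono hKs).integrableOn_compact hK).of_forall_sdiff_eq_zero measurableSet_punctured
    fun x hx => ?_
  by_cases hxδ : ‖x‖ < δ
  · rw [hJ0 x hx.1 hxδ, dotProduct_zero]
  · have : r < ‖x‖ := by
      by_contra hle
      exact hx.2 ⟨by simpa using hle, by simpa using hxδ⟩
    rw [ha0 x hx.1 this, zero_dotProduct]

theorem integrableOn_dotProduct_pushTwoForm_source {h J : VField} (hh : IsTestField N h)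
    (hJ : ContDiffOn ℝ ∞ J (M₁ \ {0}))
    (hJ0 : ∃ δ > 0, ∀ x ∈ M₁ \ {0}, ‖x‖ < δ → J x = 0) :
    IntegrableOn (fun y => h y ⬝ᵥ pushTwoForm blowUpInv J y) N₁ := by
  obtain ⟨r, hr, hr0⟩ := exists_radius hh
  rw [integrableOn_N₁_iff]
  refine IntegrableOn.congr_fun ?_ (fun x hx => (det_smul_dotProduct_pushTwoForm hx.2 h J).symm)
    measurableSet_punctured
  refine integrableOn_dotProduct_source (fun x hx => ?_) hJ hJ0 (r := 2 * (r - 1)) (by linarith)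
    fun x hx hxr => ?_
  · exact (contDiffAt_pushOneForm (contDiffAt_blowUp hx.2)
      hh.1.contDiffAt).continuousAt.continuousWithinAt
  · rw [pushOneForm, hr0 _ (by rw [norm_blowUp hx.2]; linarith), applyMatrix, Matrix.mulVec_zero]

theorem integrableOn_source_core {J : VField} (hJ : ContDiffOn ℝ ∞ J M₂)
    (hJ0 : ∃ δ > 0, ∀ x ∈ M₂, 1 - δ < ‖x‖ → J x = 0) : IntegrableOn J M₂ := by
  obtain ⟨δ, hδ, hJ0⟩ := hJ0
  have hs : closedBall (0 : Space) (1 - δ) ⊆ M₂ := closedBall_subset_ball (by linarith)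
  refine ((hJ.continuousOn.mono hs).integrableOn_compact
    (isCompact_closedBall _ _)).of_forall_sdiff_eq_zero measurableSet_ball fun x hx => ?_
  exact hJ0 x hx.1 (by simpa using hx.2)

theorem pushTwoForm_smul (G : Space → Space) (c : ℂ) (w : VField) (y : Space) :
    pushTwoForm G (fun x => c • w x) y = c • pushTwoForm G w y := by
  simp only [pushTwoForm_eq, applyMatrix_smul_vec]

theorem pushTwoForm_sub (G : Space → Space) (v w : VField) (y : Space) :
    pushTwoForm G (fun x => v x - w x) y = pushTwoForm G v y - pushTwoForm G w y := by
  simp only [pushTwoForm_eq, applyMatrix_sub_vec]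

/-! ### Equivalence of the two problems -/

/-- In the layer the material law turns the push-forward of a one-form into that of a two-form. -/
theorem singleCoating_apply_layer {E₁ E₂ Et : VField} (h : IsPushOneForm E₁ E₂ Et) {y : Space}
    (hy : y ∈ N₁) : applyMatrix (singleCoating y) (Et y) = pushTwoForm blowUpInv E₁ y := by
  rw [h.1 y hy, applyMatrix_singleCoating_pushOneForm hy]

theorem singleCoating_apply_core {E₁ E₂ Et : VField} (h : IsPushOneForm E₁ E₂ Et) {y : Space}
    (hy : y ∈ N₂) : applyMatrix (singleCoating y) (Et y) = E₂ y := by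
  rw [h.2 y hy, singleCoating_of_mem_N₂ hy, applyMatrix_one]

/-- Finite energy passes from the layer to the punctured ball. -/
theorem energy_of_energy_N {E₁ E₂ Et : VField} (h : IsPushOneForm E₁ E₂ Et)
    (he : IntegrableOn (fun x => applyMatrix (singleCoating x) (Et x) ⬝ᵥ star (Et x)) N) :
    IntegrableOn (fun x => E₁ x ⬝ᵥ star (E₁ x)) M₁ := by
  have h1 : IntegrableOn (fun y => pushTwoForm blowUpInv E₁ y ⬝ᵥ
      star (pushOneForm blowUpInv E₁ y)) N₁ :=
    (he.mono_set N₁_subset_N).congr_fun (fun y hy => by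
      beta_reduce
      rw [singleCoating_apply_layer h hy, h.1 y hy]) measurableSet_N₁
  rw [energy_N₁_iff, IntegrableOn, restrict_punctured] at h1
  exact h1

/-! ### The equivalence for a pair of transported fields -/

theorem isFiniteEnergySolution_one_iff {Ω : Set Space} {k : ℝ} {J E H : VField} :
    IsFiniteEnergySolution Ω 1 1 k J E H ↔
      (IntegrableOn E Ω ∧ IntegrableOn H Ω) ∧
      (IntegrableOn (fun x => E x ⬝ᵥ star (E x)) Ω ∧
        IntegrableOn (fun x => H x ⬝ᵥ star (H x)) Ω) ∧
      WeakEq Ω E (fun x => (Complex.I * k) • H x) ∧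
      WeakEq Ω H (fun x => J x - (Complex.I * k) • E x) := by
  constructor
  · intro h
    refine ⟨⟨h.integrable_E, h.integrable_H⟩, ⟨?_, ?_⟩, ?_, ?_⟩
    · simpa [applyMatrix_one] using h.energy_E
    · simpa [applyMatrix_one] using h.energy_H
    · simpa [applyMatrix_one] using faraday_iff.mp h.faraday
    · simpa [applyMatrix_one] using ampere_iff.mp h.ampere
  · rintro ⟨⟨h1, h2⟩, ⟨h3, h4⟩, h5, h6⟩
    refine ⟨h1, h2, ?_, ?_, ?_, ?_, faraday_iff.mpr ?_, ampere_iff.mpr ?_⟩ <;>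
      simpa [applyMatrix_one]

/-- The standing assumptions on a pair of fields and a source on `M` and on their push-forwards. -/
structure TransportedFields (E₁ H₁ J₁ E₂ H₂ J₂ Et Ht Jt : VField) : Prop where
  meas_E : AEMeasurable E₁ (volume.restrict M₁)
  meas_H : AEMeasurable H₁ (volume.restrict M₁)
  smooth_J₁ : ContDiffOn ℝ ∞ J₁ (M₁ \ {0})
  smooth_J₂ : ContDiffOn ℝ ∞ J₂ M₂
  source_zero : ∃ δ > 0, ∀ x ∈ M₁ \ {0}, ‖x‖ < δ → J₁ x = 0
  source_sphere : ∃ δ > 0, ∀ x ∈ M₂, 1 - δ < ‖x‖ → J₂ x = 0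
  push_E : IsPushOneForm E₁ E₂ Et
  push_H : IsPushOneForm H₁ H₂ Ht
  push_J : IsPushTwoForm J₁ J₂ Jt

namespace TransportedFields

variable {k : ℝ} {E₁ H₁ J₁ E₂ H₂ J₂ Et Ht Jt : VField}

theorem faraday_layer (D : TransportedFields E₁ H₁ J₁ E₂ H₂ J₂ Et Ht Jt) :
    ∀ y ∈ N₁, (Complex.I * k) • applyMatrix (singleCoating y) (Ht y) =
      pushTwoForm blowUpInv (fun x => (Complex.I * k) • H₁ x) y := fun y hy => by
  rw [singleCoating_apply_layer D.push_H hy, pushTwoForm_smul]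

theorem faraday_core (D : TransportedFields E₁ H₁ J₁ E₂ H₂ J₂ Et Ht Jt) :
    ∀ y ∈ N₂, (Complex.I * k) • applyMatrix (singleCoating y) (Ht y) =
      (Complex.I * k) • H₂ y := fun y hy => by
  rw [singleCoating_apply_core D.push_H hy]

theorem ampere_layer (D : TransportedFields E₁ H₁ J₁ E₂ H₂ J₂ Et Ht Jt) :
    ∀ y ∈ N₁, Jt y - (Complex.I * k) • applyMatrix (singleCoating y) (Et y) =
      pushTwoForm blowUpInv (fun x => J₁ x - (Complex.I * k) • E₁ x) y := fun y hy => by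
  rw [singleCoating_apply_layer D.push_E hy, D.push_J.1 y hy, pushTwoForm_sub, pushTwoForm_smul]

theorem ampere_core (D : TransportedFields E₁ H₁ J₁ E₂ H₂ J₂ Et Ht Jt) :
    ∀ y ∈ N₂, Jt y - (Complex.I * k) • applyMatrix (singleCoating y) (Et y) =
      J₂ y - (Complex.I * k) • E₂ y := fun y hy => by
  rw [singleCoating_apply_core D.push_E hy, D.push_J.2 y hy]

/-- A solution on `N` solves the equations on `M₁`: finite energy makes the origin removable. -/
theorem solution_M₁ (D : TransportedFields E₁ H₁ J₁ E₂ H₂ J₂ Et Ht Jt)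
    (h : IsFiniteEnergySolution N singleCoating singleCoating k Jt Et Ht) :
    IsFiniteEnergySolution M₁ 1 1 k J₁ E₁ H₁ := by
  have eE := energy_of_energy_N D.push_E h.energy_E
  have eH := energy_of_energy_N D.push_H h.energy_H
  have mE := D.meas_E.aestronglyMeasurable
  have mH := D.meas_H.aestronglyMeasurable
  have sE := integrableOn_norm_sq mE eE
  have sH := integrableOn_norm_sq mH eH
  have r := restrict_punctured
  rw [IntegrableOn, ← r] at sE sH
  rw [← r] at mE mH
  have iE := integrableOn_of_norm_sq mE sE
  have iH := integrableOn_of_norm_sq mH sH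
  have hsub : M₁ \ {0} ⊆ ball (0 : Space) 2 := Set.sdiff_subset
  have iE' : IntegrableOn E₁ M₁ := by rwa [IntegrableOn, ← r]
  have iH' : IntegrableOn H₁ M₁ := by rwa [IntegrableOn, ← r]
  have w1 := (faraday_iff.mp h.faraday).of_N D.push_E.1 D.faraday_layer
  have w2 := (ampere_iff.mp h.ampere).of_N D.push_H.1 D.ampere_layer
  refine isFiniteEnergySolution_one_iff.mpr ⟨⟨iE', iH'⟩, ⟨eE, eH⟩, fun φ hφ => ?_, fun φ hφ => ?_⟩
  · rw [← weakPairing_punctured]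
    refine weakPairing_eq_zero_of_punctured mE sE ?_ w1 hφ
    exact (integrableOn_dotProduct hsub measurableSet_punctured (continuous_curl hφ.1) iE).sub
      (integrableOn_dotProduct hsub measurableSet_punctured hφ.1.continuous (iH.fun_smul _))
  · rw [← weakPairing_punctured]
    refine weakPairing_eq_zero_of_punctured mH sH ?_ w2 hφ
    refine (integrableOn_dotProduct hsub measurableSet_punctured (continuous_curl hφ.1) iH).sub ?_
    obtain ⟨ρ, hρ, hρ0⟩ := exists_radius hφ
    have i1 := integrableOn_dotProduct_source hφ.1.continuous.continuousOn D.smooth_J₁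
      D.source_zero hρ fun x _ hx => hρ0 x hx
    have i2 := integrableOn_dotProduct hsub measurableSet_punctured hφ.1.continuous
      (iE.fun_smul (Complex.I * (k : ℂ)))
    simp only [dotProduct_sub]
    exact i1.sub i2

theorem solution_M₂ (D : TransportedFields E₁ H₁ J₁ E₂ H₂ J₂ Et Ht Jt)
    (h : IsFiniteEnergySolution N singleCoating singleCoating k Jt Et Ht) :
    IsFiniteEnergySolution M₂ 1 1 k J₂ E₂ H₂ := by
  refine isFiniteEnergySolution_one_iff.mpr ⟨⟨?_, ?_⟩, ⟨?_, ?_⟩, ?_, ?_⟩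
  · exact (h.integrable_E.mono_set N₂_subset_N).congr_fun D.push_E.2 measurableSet_ball
  · exact (h.integrable_H.mono_set N₂_subset_N).congr_fun D.push_H.2 measurableSet_ball
  · refine (h.energy_E.mono_set N₂_subset_N).congr_fun (fun y hy => ?_) measurableSet_ball
    beta_reduce
    rw [singleCoating_apply_core D.push_E hy, D.push_E.2 y hy]
  · refine (h.energy_H.mono_set N₂_subset_N).congr_fun (fun y hy => ?_) measurableSet_ball
    beta_reduce
    rw [singleCoating_apply_core D.push_H hy, D.push_H.2 y hy]
  · exact (faraday_iff.mp h.faraday).core D.push_E.2 D.faraday_core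
  · exact (ampere_iff.mp h.ampere).core D.push_H.2 D.ampere_core

/-- What a solution on `M₁` implies on the layer: the transported fields and fluxes are integrable,
have finite energy, and satisfy the equations up to and including the interface. -/
theorem layer (D : TransportedFields E₁ H₁ J₁ E₂ H₂ J₂ Et Ht Jt) (hk : k ≠ 0)
    (h : IsFiniteEnergySolution M₁ 1 1 k J₁ E₁ H₁) :
    (IntegrableOn Et N₁ ∧ IntegrableOn Ht N₁) ∧
    (IntegrableOn (fun x => applyMatrix (singleCoating x) (Et x)) N₁ ∧
      IntegrableOn (fun x => applyMatrix (singleCoating x) (Ht x)) N₁) ∧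
    (IntegrableOn (fun x => applyMatrix (singleCoating x) (Et x) ⬝ᵥ star (Et x)) N₁ ∧
      IntegrableOn (fun x => applyMatrix (singleCoating x) (Ht x) ⬝ᵥ star (Ht x)) N₁) ∧
    (∀ φ, IsTestField N φ → weakPairing N₁ Et
      (fun x => (Complex.I * k) • applyMatrix (singleCoating x) (Ht x)) φ = 0) ∧
    (∀ φ, IsTestField N φ → weakPairing N₁ Ht
      (fun x => Jt x - (Complex.I * k) • applyMatrix (singleCoating x) (Et x)) φ = 0) := by
  obtain ⟨⟨iE, iH⟩, ⟨eE, eH⟩, w1, w2⟩ := isFiniteEnergySolution_one_iff.mp h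
  have sE := integrableOn_norm_sq iE.aestronglyMeasurable eE
  have sH := integrableOn_norm_sq iH.aestronglyMeasurable eH
  obtain ⟨δ, hδ, ⟨CE, hCE⟩, ⟨CH, hCH⟩⟩ :=
    ae_bounded_of_maxwell hk iE iH sE sH w1 w2 D.source_zero
  have hp : ∀ {F : Type} [NormedAddCommGroup F] {f : Space → F}, IntegrableOn f M₁ →
      IntegrableOn f (M₁ \ {0}) := fun hf => hf.mono_set Set.sdiff_subset
  have iEt := integrableOn_pushOneForm (integrableOn_comp_blowUpInv iE hδ hCE)
  have iHt := integrableOn_pushOneForm (integrableOn_comp_blowUpInv iH hδ hCH)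
  have iDt := integrableOn_pushTwoForm (hp iE).aestronglyMeasurable (hp sE)
  have iBt := integrableOn_pushTwoForm (hp iH).aestronglyMeasurable (hp sH)
  have w1' : WeakEq (M₁ \ {0}) E₁ fun x => (Complex.I * k) • H₁ x := fun φ hφ => by
    rw [weakPairing_punctured]
    exact w1 φ (hφ.mono Set.sdiff_subset)
  have w2' : WeakEq (M₁ \ {0}) H₁ fun x => J₁ x - (Complex.I * k) • E₁ x := fun φ hφ => by
    rw [weakPairing_punctured]
    exact w2 φ (hφ.mono Set.sdiff_subset)
  refine ⟨⟨?_, ?_⟩, ⟨?_, ?_⟩, ⟨?_, ?_⟩, fun φ hφ => ?_, fun φ hφ => ?_⟩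
  · exact iEt.congr_fun (fun y hy => (D.push_E.1 y hy).symm) measurableSet_N₁
  · exact iHt.congr_fun (fun y hy => (D.push_H.1 y hy).symm) measurableSet_N₁
  · exact iDt.congr_fun (fun y hy => (singleCoating_apply_layer D.push_E hy).symm) measurableSet_N₁
  · exact iBt.congr_fun (fun y hy => (singleCoating_apply_layer D.push_H hy).symm) measurableSet_N₁
  · refine ((energy_N₁_iff E₁).mpr (hp eE)).congr_fun (fun y hy => ?_) measurableSet_N₁
    beta_reduce
    rw [singleCoating_apply_layer D.push_E hy, D.push_E.1 y hy]
  · refine ((energy_N₁_iff H₁).mpr (hp eH)).congr_fun (fun y hy => ?_) measurableSet_N₁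
    beta_reduce
    rw [singleCoating_apply_layer D.push_H hy, D.push_H.1 y hy]
  · rw [weakPairing_congr measurableSet_N₁ D.push_E.1 D.faraday_layer]
    refine weakPairing_N₁_eq_zero iE hδ hCE w1' hφ ?_
    simp only [pushTwoForm_smul]
    exact integrableOn_dotProduct N₁_subset_N measurableSet_N₁ hφ.1.continuous (iBt.fun_smul _)
  · rw [weakPairing_congr measurableSet_N₁ D.push_H.1 D.ampere_layer]
    refine weakPairing_N₁_eq_zero iH hδ hCH w2' hφ ?_
    simp only [pushTwoForm_smul, pushTwoForm_sub, dotProduct_sub]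
    exact (integrableOn_dotProduct_pushTwoForm_source hφ D.smooth_J₁ D.source_zero).sub
      (integrableOn_dotProduct N₁_subset_N measurableSet_N₁ hφ.1.continuous (iDt.fun_smul _))

theorem integrableOn_ampere (D : TransportedFields E₁ H₁ J₁ E₂ H₂ J₂ Et Ht Jt)
    (iD : IntegrableOn (fun x => applyMatrix (singleCoating x) (Et x)) N) {φ : VField}
    (hφ : IsTestField N φ) : IntegrableOn (fun x => φ x ⬝ᵥ
      (Jt x - (Complex.I * k) • applyMatrix (singleCoating x) (Et x))) N := by
  have i1 : IntegrableOn (fun x => φ x ⬝ᵥ Jt x) N := by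
    refine integrableOn_N_iff.mpr ⟨?_, ?_⟩
    · refine (integrableOn_dotProduct_pushTwoForm_source hφ D.smooth_J₁ D.source_zero).congr_fun
        (fun y hy => ?_) measurableSet_N₁
      simp only [D.push_J.1 y hy]
    · refine (integrableOn_dotProduct N₂_subset_N measurableSet_ball hφ.1.continuous
        (integrableOn_source_core D.smooth_J₂ D.source_sphere)).congr_fun
        (fun y hy => ?_) measurableSet_ball
      simp only [D.push_J.2 y hy]
  simp only [dotProduct_sub]
  exact i1.sub (integrableOn_dotProduct subset_rfl measurableSet_ball hφ.1.continuous (iD.fun_smul _))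

theorem faraday_trace_M₂_iff (h : IsFiniteEnergySolution M₂ 1 1 k J₂ E₂ H₂)
    (f : BoundaryDatum M₂) : HasTangentialTrace M₂ E₂ f ↔ ∀ φ : smoothFields,
      f (restrictField (frontier M₂) φ) =
        -weakPairing M₂ E₂ (fun x => (Complex.I * k) • H₂ x) (φ : VField) := by
  obtain ⟨⟨iE, iH⟩, -, w1, -⟩ := isFiniteEnergySolution_one_iff.mp h
  exact hasTangentialTrace_iff isOpen_ball subset_rfl iE (iH.fun_smul _) w1 f

theorem ampere_trace_M₂_iff (D : TransportedFields E₁ H₁ J₁ E₂ H₂ J₂ Et Ht Jt)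
    (h : IsFiniteEnergySolution M₂ 1 1 k J₂ E₂ H₂)
    (f : BoundaryDatum M₂) : HasTangentialTrace M₂ H₂ f ↔ ∀ φ : smoothFields,
      f (restrictField (frontier M₂) φ) =
        -weakPairing M₂ H₂ (fun x => J₂ x - (Complex.I * k) • E₂ x) (φ : VField) := by
  obtain ⟨⟨iE, iH⟩, -, -, w2⟩ := isFiniteEnergySolution_one_iff.mp h
  exact hasTangentialTrace_iff isOpen_ball subset_rfl iH
    ((integrableOn_source_core D.smooth_J₂ D.source_sphere).sub (iE.fun_smul _)) w2 f

/-- A finite energy solution on `N` has vanishing Cauchy data on the inner side of the interface. -/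
theorem cauchy_data_eq_zero (D : TransportedFields E₁ H₁ J₁ E₂ H₂ J₂ Et Ht Jt) (hk : k ≠ 0)
    (h : IsFiniteEnergySolution N singleCoating singleCoating k Jt Et Ht) (φ : VField)
    (hφ : ContDiff ℝ ∞ φ) :
    weakPairing M₂ E₂ (fun x => (Complex.I * k) • H₂ x) φ = 0 ∧
      weakPairing M₂ H₂ (fun x => J₂ x - (Complex.I * k) • E₂ x) φ = 0 := by
  obtain ⟨-, -, -, l1, l2⟩ := D.layer hk (D.solution_M₁ h)
  constructor
  · exact weakPairing_core_eq_zero D.push_E.2 D.faraday_core (faraday_iff.mp h.faraday)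
      h.integrable_E (fun ψ hψ => integrableOn_dotProduct subset_rfl measurableSet_ball
        hψ.1.continuous (h.integrable_B.fun_smul _)) l1 hφ
  · exact weakPairing_core_eq_zero D.push_H.2 D.ampere_core (ampere_iff.mp h.ampere)
      h.integrable_H (fun ψ hψ => D.integrableOn_ampere h.integrable_D hψ) l2 hφ

/-- Gluing: a solution on `M₁` and a solution on `M₂` with vanishing Cauchy data give a finite
energy solution on `N`. -/
theorem solution_N (D : TransportedFields E₁ H₁ J₁ E₂ H₂ J₂ Et Ht Jt) (hk : k ≠ 0)
    (h₁ : IsFiniteEnergySolution M₁ 1 1 k J₁ E₁ H₁)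
    (h₂ : IsFiniteEnergySolution M₂ 1 1 k J₂ E₂ H₂)
    (tE : HasTangentialTrace M₂ E₂ 0) (tH : HasTangentialTrace M₂ H₂ 0) :
    IsFiniteEnergySolution N singleCoating singleCoating k Jt Et Ht := by
  obtain ⟨⟨iE, iH⟩, ⟨iD, iB⟩, ⟨eE, eH⟩, l1, l2⟩ := D.layer hk h₁
  obtain ⟨⟨iE₂, iH₂⟩, ⟨eE₂, eH₂⟩, -, -⟩ := isFiniteEnergySolution_one_iff.mp h₂
  have c1 : ∀ φ, ContDiff ℝ ∞ φ → weakPairing N₂ E₂ (fun x => (Complex.I * k) • H₂ x) φ = 0 :=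
    fun φ hφ => (neg_eq_zero.mp ((faraday_trace_M₂_iff h₂ 0).mp tE ⟨φ, hφ⟩).symm)
  have c2 : ∀ φ, ContDiff ℝ ∞ φ →
      weakPairing N₂ H₂ (fun x => J₂ x - (Complex.I * k) • E₂ x) φ = 0 :=
    fun φ hφ => (neg_eq_zero.mp ((D.ampere_trace_M₂_iff h₂ 0).mp tH ⟨φ, hφ⟩).symm)
  have iEt : IntegrableOn Et N := integrableOn_N_iff.mpr
    ⟨iE, iE₂.congr_fun (fun y hy => (D.push_E.2 y hy).symm) measurableSet_ball⟩
  have iHt : IntegrableOn Ht N := integrableOn_N_iff.mpr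
    ⟨iH, iH₂.congr_fun (fun y hy => (D.push_H.2 y hy).symm) measurableSet_ball⟩
  have iDt : IntegrableOn (fun x => applyMatrix (singleCoating x) (Et x)) N :=
    integrableOn_N_iff.mpr ⟨iD, iE₂.congr_fun
      (fun y hy => (singleCoating_apply_core D.push_E hy).symm) measurableSet_ball⟩
  have iBt : IntegrableOn (fun x => applyMatrix (singleCoating x) (Ht x)) N :=
    integrableOn_N_iff.mpr ⟨iB, iH₂.congr_fun
      (fun y hy => (singleCoating_apply_core D.push_H hy).symm) measurableSet_ball⟩
  refine ⟨iEt, iHt, iDt, iBt, integrableOn_N_iff.mpr ⟨eE, ?_⟩, integrableOn_N_iff.mpr ⟨eH, ?_⟩,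
    faraday_iff.mpr ?_, ampere_iff.mpr ?_⟩
  · refine eE₂.congr_fun (fun y hy => ?_) measurableSet_ball
    beta_reduce
    rw [singleCoating_apply_core D.push_E hy, D.push_E.2 y hy]
  · refine eH₂.congr_fun (fun y hy => ?_) measurableSet_ball
    beta_reduce
    rw [singleCoating_apply_core D.push_H hy, D.push_H.2 y hy]
  · exact WeakEq.to_N D.push_E.2 D.faraday_core iEt (fun ψ hψ => integrableOn_dotProduct subset_rfl
      measurableSet_ball hψ.1.continuous (iBt.fun_smul _)) l1 c1
  · exact WeakEq.to_N D.push_H.2 D.ampere_core iHt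
      (fun ψ hψ => D.integrableOn_ampere iDt hψ) l2 c2

/-- The outer boundary data of the two problems coincide. -/
theorem trace_iff (D : TransportedFields E₁ H₁ J₁ E₂ H₂ J₂ Et Ht Jt)
    (h : IsFiniteEnergySolution N singleCoating singleCoating k Jt Et Ht)
    (h₁ : IsFiniteEnergySolution M₁ 1 1 k J₁ E₁ H₁) (f : BoundaryDatum N) :
    HasTangentialTrace N Et f ↔ HasTangentialTrace M₁ E₁ f := by
  obtain ⟨⟨iE, iH⟩, -, w1, -⟩ := isFiniteEnergySolution_one_iff.mp h₁
  have iw : IntegrableOn (fun x => (Complex.I * (k : ℂ)) • H₁ x) M₁ := iH.fun_smul _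
  have iwt : IntegrableOn
      (fun x => (Complex.I * (k : ℂ)) • applyMatrix (singleCoating x) (Ht x)) N :=
    h.integrable_B.fun_smul _
  have wt := faraday_iff.mp h.faraday
  rw [hasTangentialTrace_iff isOpen_ball subset_rfl h.integrable_E iwt wt,
    hasTangentialTrace_iff isOpen_ball subset_rfl iE iw w1]
  refine forall_congr' fun φ => ?_
  rw [weakPairing_N_eq_weakPairing_M₁ D.push_E.1 D.faraday_layer iE iw h.integrable_E iwt w1 wt φ.2]

end TransportedFields

end

end Cloaking

theorem mainTheorem3 (k : ℝ) (hk : k ≠ 0)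
    (E₁ H₁ J₁ E₂ H₂ J₂ Et Ht Jt : VField)
    (hE₁ : AEMeasurable E₁ (volume.restrict M₁)) (hH₁ : AEMeasurable H₁ (volume.restrict M₁))
    (hE₂ : AEMeasurable E₂ (volume.restrict M₂)) (hH₂ : AEMeasurable H₂ (volume.restrict M₂))
    (hJ₁ : ContDiffOn ℝ ∞ J₁ (M₁ \ {0})) (hJ₂ : ContDiffOn ℝ ∞ J₂ M₂)
    (hJ_zero : ∃ δ > 0, ∀ x ∈ M₁ \ {0}, ‖x‖ < δ → J₁ x = 0)
    (hJ_sphere : ∃ δ > 0, ∀ x ∈ M₂, 1 - δ < ‖x‖ → J₂ x = 0)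
    (hEt : IsPushOneForm E₁ E₂ Et) (hHt : IsPushOneForm H₁ H₂ Ht)
    (hJt : IsPushTwoForm J₁ J₂ Jt) :
    (∀ f : BoundaryDatum N,
      (IsFiniteEnergySolution N singleCoating singleCoating k Jt Et Ht ∧
          HasTangentialTrace N Et f) ↔
        (IsFiniteEnergySolution M₁ 1 1 k J₁ E₁ H₁ ∧ HasTangentialTrace M₁ E₁ f) ∧
        (IsFiniteEnergySolution M₂ 1 1 k J₂ E₂ H₂ ∧
          HasTangentialTrace M₂ E₂ 0 ∧ HasTangentialTrace M₂ H₂ 0)) ∧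
    (∀ (f : BoundaryDatum M₁) (be bh : BoundaryDatum M₂),
      IsFiniteEnergySolution M₁ 1 1 k J₁ E₁ H₁ → HasTangentialTrace M₁ E₁ f →
      IsFiniteEnergySolution M₂ 1 1 k J₂ E₂ H₂ →
      HasTangentialTrace M₂ E₂ be → HasTangentialTrace M₂ H₂ bh →
      (be ≠ 0 ∨ bh ≠ 0) →
      ¬ IsFiniteEnergySolution N singleCoating singleCoating k Jt Et Ht) := by
  have D : TransportedFields E₁ H₁ J₁ E₂ H₂ J₂ Et Ht Jt :=
    ⟨hE₁, hH₁, hJ₁, hJ₂, hJ_zero, hJ_sphere, hEt, hHt, hJt⟩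
  refine ⟨fun f => ⟨?_, ?_⟩, ?_⟩
  · rintro ⟨h, hf⟩
    have h₁ := D.solution_M₁ h
    have h₂ := D.solution_M₂ h
    refine ⟨⟨h₁, (D.trace_iff h h₁ f).mp hf⟩, h₂, ?_, ?_⟩
    · exact (TransportedFields.faraday_trace_M₂_iff h₂ 0).mpr fun φ => by
        rw [(D.cauchy_data_eq_zero hk h φ φ.2).1, neg_zero, LinearMap.zero_apply]
    · exact (D.ampere_trace_M₂_iff h₂ 0).mpr fun φ => by
        rw [(D.cauchy_data_eq_zero hk h φ φ.2).2, neg_zero, LinearMap.zero_apply]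
  · rintro ⟨⟨h₁, hf⟩, h₂, tE, tH⟩
    have h := D.solution_N hk h₁ h₂ tE tH
    exact ⟨h, (D.trace_iff h h₁ f).mpr hf⟩
  · intro f be bh _ _ h₂ tE tH hne h
    have hbe : be = 0 := boundaryDatum_eq_zero fun φ => by
      rw [(TransportedFields.faraday_trace_M₂_iff h₂ be).mp tE φ,
        (D.cauchy_data_eq_zero hk h φ φ.2).1, neg_zero]
    have hbh : bh = 0 := boundaryDatum_eq_zero fun φ => by
      rw [(D.ampere_trace_M₂_iff h₂ bh).mp tH φ,
        (D.cauchy_data_eq_zero hk h φ φ.2).2, neg_zero]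
    exact hne.elim (fun h' => h' hbe) fun h' => h' hbh
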